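/- Let $N$ be a set of $n$ agents and $M$ a non-empty set of $m$ indivisible chores (items). Agent $i$ has a cost $c_i(e)\ge 0$ for each item $e$, extended additively to bundles by $c_i(X)=\sum_{e\in X}c_i(e)$ for $X\subseteq M$. The instance is *bi-valued* if there are two numbers $a,b\ge 0$ such that $c_i(e)\in\{a,b\}$ for every agent $i$ and every item $e$. An *allocation* is a tuple $(X_i)_{i\in N}$ of pairwise disjoint (possibly empty) bundles with $\bigcup_{i\in N}X_i=M$; for $\alpha\ge 1$ it is *$\alpha$-EFX* if $c_i(X_i\setminus\{e\})\le\alpha\cdot c_i(X_j)$ for all $i,j\in N$ and all $e\in X_i$. **Theorem.** There exists an algorithm that, for every bi-valued instance with $n\ge 4$ agents and $m\ge 1$ items, computes an $(n-1)$-EFX allocation (in particular, one exists) in $O(nm)$ time. That is, there are a single program and a single constant $C$, independent of $n$, $m$, $a$, $b$ and the costs, such that on every such input the program halts after at most $C\,nm$ steps and outputs the receiver of each item in an $(n-1)$-EFX allocation. Time is counted on a unit-cost random access machine whose input consists of $n$, $m$ and the matrix of costs, whose operations on natural numbers are successor, predecessor, comparison and indexed memory access, and whose operations on real numbers (the costs)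 are addition, subtraction, comparison and indexed memory access. -/

import Mathlib

namespace ChoreDivision

section Fairness

variable {n m : ℕ}

/-- The additive extension of the item costs `c i e` of agent `i` to a bundle. -/
noncomputable def bundleCost (c : Fin n → Fin m → ℝ) (i : Fin n) (X : Finset (Fin m)) : ℝ :=
  ∑ e ∈ X, c i e

/-- An allocation: pairwise disjoint bundles, one per agent, that cover all items
(bundles may be empty). -/
def IsAllocation (X : Fin n → Finset (Fin m)) : Prop :=
  (∀ i j, i ≠ j → Disjoint (X i) (X j)) ∧ ∀ e, ∃ i, e ∈ X i

/-- `α`-approximate envy-freeness up to any item, for chores. -/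
def IsEFX (α : ℝ) (c : Fin n → Fin m → ℝ) (X : Fin n → Finset (Fin m)) : Prop :=
  ∀ i j, ∀ e ∈ X i, bundleCost c i ((X i).erase e) ≤ α * bundleCost c i (X j)

/-- Bi-valued costs: two nonnegative numbers, the same for all agents, are the only costs of
single items. -/
def IsBivalued (c : Fin n → Fin m → ℝ) : Prop :=
  ∃ a b : ℝ, 0 ≤ a ∧ 0 ≤ b ∧ ∀ i e, c i e = a ∨ c i e = b

end Fairness

/-! Machine model: a unit-cost random access machine with structured programs. Its memory
consists of cells for natural numbers and of cells for real numbers; a cell is addressed by the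
name of an array (fixed in the program) and two computed indices. On natural numbers there are
only successor, predecessor and comparison, so that no number exceeds the largest input number by
more than a constant times the number of steps (unit cost hides no arithmetic on long numbers); on
real numbers there are only addition, subtraction and comparison. -/

/-- The memory: a cell is given by an array name and two indices. -/
structure Store where
  nat : ℕ → ℕ → ℕ → ℕ
  real : ℕ → ℕ → ℕ → ℝ

/-- Expressions for natural numbers. -/
inductive NatExpr : Type
  | const (k : ℕ)
  | cell (a : ℕ) (i j : NatExpr)
  | succ (x : NatExpr)
  | pred (x : NatExpr)

/-- Expressions for real numbers. -/
inductive RealExpr : Type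
  | zero
  | cell (a : ℕ) (i j : NatExpr)
  | add (x y : RealExpr)
  | sub (x y : RealExpr)

/-- Tests. -/
inductive Test : Type
  | natLe (x y : NatExpr)
  | realLe (x y : RealExpr)
  | not (b : Test)
  | and (b b' : Test)

/-- Programs. -/
inductive Program : Type
  | skip
  | setNat (a : ℕ) (i j : NatExpr) (x : NatExpr)
  | setReal (a : ℕ) (i j : NatExpr) (x : RealExpr)
  | seq (p q : Program)
  | ite (b : Test) (p q : Program)
  | while (b : Test) (p : Program)

/-- Value of a natural number expression. -/
def NatExpr.eval (s : Store) : NatExpr → ℕ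
  | .const k => k
  | .cell a i j => s.nat a (i.eval s) (j.eval s)
  | .succ x => x.eval s + 1
  | .pred x => x.eval s - 1

/-- Number of steps for evaluating a natural number expression: one per node. -/
def NatExpr.cost : NatExpr → ℕ
  | .const _ => 1
  | .cell _ i j => i.cost + j.cost + 1
  | .succ x => x.cost + 1
  | .pred x => x.cost + 1

/-- Value of a real expression. -/
noncomputable def RealExpr.eval (s : Store) : RealExpr → ℝ
  | .zero => 0
  | .cell a i j => s.real a (i.eval s) (j.eval s)
  | .add x y => x.eval s + y.eval s
  | .sub x y => x.eval s - y.eval s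

/-- Number of steps for evaluating a real expression: one per node. -/
def RealExpr.cost : RealExpr → ℕ
  | .zero => 1
  | .cell _ i j => i.cost + j.cost + 1
  | .add x y => x.cost + y.cost + 1
  | .sub x y => x.cost + y.cost + 1

/-- Truth of a test. -/
def Test.Holds (s : Store) : Test → Prop
  | .natLe x y => x.eval s ≤ y.eval s
  | .realLe x y => x.eval s ≤ y.eval s
  | .not b => ¬ b.Holds s
  | .and b b' => b.Holds s ∧ b'.Holds s

/-- Number of steps for evaluating a test: one per node. -/
def Test.cost : Test → ℕ
  | .natLe x y => x.cost + y.cost + 1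
  | .realLe x y => x.cost + y.cost + 1
  | .not b => b.cost + 1
  | .and b b' => b.cost + b'.cost + 1

/-- Overwriting one cell for natural numbers. -/
def Store.writeNat (s : Store) (a i j v : ℕ) : Store :=
  { s with nat := fun a' i' j' => if a' = a ∧ i' = i ∧ j' = j then v else s.nat a' i' j' }

/-- Overwriting one cell for real numbers. -/
def Store.writeReal (s : Store) (a i j : ℕ) (v : ℝ) : Store :=
  { s with real := fun a' i' j' => if a' = a ∧ i' = i ∧ j' = j then v else s.real a' i' j' }

/-- `Exec p s t s'`: started in memory `s`, the program `p` halts after exactly `t` steps, in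
memory `s'`. -/
inductive Exec : Program → Store → ℕ → Store → Prop
  | skip (s : Store) : Exec .skip s 1 s
  | setNat (a : ℕ) (i j x : NatExpr) (s : Store) :
      Exec (.setNat a i j x) s (i.cost + j.cost + x.cost + 1)
        (s.writeNat a (i.eval s) (j.eval s) (x.eval s))
  | setReal (a : ℕ) (i j : NatExpr) (x : RealExpr) (s : Store) :
      Exec (.setReal a i j x) s (i.cost + j.cost + x.cost + 1)
        (s.writeReal a (i.eval s) (j.eval s) (x.eval s))
  | seq {p q : Program} {s s' s'' : Store} {t t' : ℕ} :
      Exec p s t s' → Exec q s' t' s'' → Exec (.seq p q) s (t + t') s''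
  | iteTrue {b : Test} {p q : Program} {s s' : Store} {t : ℕ} :
      b.Holds s → Exec p s t s' → Exec (.ite b p q) s (b.cost + t + 1) s'
  | iteFalse {b : Test} {p q : Program} {s s' : Store} {t : ℕ} :
      ¬ b.Holds s → Exec q s t s' → Exec (.ite b p q) s (b.cost + t + 1) s'
  | whileTrue {b : Test} {p : Program} {s s' s'' : Store} {t t' : ℕ} :
      b.Holds s → Exec p s t s' → Exec (.while b p) s' t' s'' →
        Exec (.while b p) s (b.cost + t + t' + 1) s''
  | whileFalse {b : Test} {p : Program} {s : Store} :
      ¬ b.Holds s → Exec (.while b p) s (b.cost + 1) s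

/-- Execution is deterministic, so the number of steps of a halting run and its result are
determined by the program and the initial memory. -/
theorem Exec.deterministic {p : Program} {s s₁ : Store} {t₁ : ℕ} (h₁ : Exec p s t₁ s₁) :
    ∀ {t₂ : ℕ} {s₂ : Store}, Exec p s t₂ s₂ → t₁ = t₂ ∧ s₁ = s₂ := by
  induction h₁ with
  | skip s => intro t₂ s₂ h; cases h; exact ⟨rfl, rfl⟩
  | setNat a i j x s => intro t₂ s₂ h; cases h; exact ⟨rfl, rfl⟩
  | setReal a i j x s => intro t₂ s₂ h; cases h; exact ⟨rfl, rfl⟩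
  | seq _ _ ih ih' =>
    intro t₂ s₂ h
    cases h with
    | seq g g' =>
      obtain ⟨rfl, rfl⟩ := ih g
      obtain ⟨rfl, rfl⟩ := ih' g'
      exact ⟨rfl, rfl⟩
  | iteTrue hb _ ih =>
    intro t₂ s₂ h
    cases h with
    | iteTrue _ g => obtain ⟨rfl, rfl⟩ := ih g; exact ⟨rfl, rfl⟩
    | iteFalse hb' _ => exact absurd hb hb'
  | iteFalse hb _ ih =>
    intro t₂ s₂ h
    cases h with
    | iteTrue hb' _ => exact absurd hb' hb
    | iteFalse _ g => obtain ⟨rfl, rfl⟩ := ih g; exact ⟨rfl, rfl⟩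
  | whileTrue hb _ _ ih ih' =>
    intro t₂ s₂ h
    cases h with
    | whileTrue _ g g' =>
      obtain ⟨rfl, rfl⟩ := ih g
      obtain ⟨rfl, rfl⟩ := ih' g'
      exact ⟨rfl, rfl⟩
    | whileFalse hb' => exact absurd hb hb'
  | whileFalse hb =>
    intro t₂ s₂ h
    cases h with
    | whileTrue hb' _ _ => exact absurd hb' hb
    | whileFalse _ => exact ⟨rfl, rfl⟩

/-- The input: the numbers `n` of agents and `m` of items are in the cells `(0, 0)` and `(0, 1)`
of array `0` of natural numbers, and the cost of item `e` to agent `i` is in the cell `(i, e)` of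
array `0` of real numbers. All other cells are zero. -/
noncomputable def inputStore {n m : ℕ} (c : Fin n → Fin m → ℝ) : Store where
  nat := fun a i j =>
    if a = 0 ∧ i = 0 ∧ j = 0 then n else if a = 0 ∧ i = 0 ∧ j = 1 then m else 0
  real := fun a i j =>
    if h : a = 0 ∧ i < n ∧ j < m then c ⟨i, h.2.1⟩ ⟨j, h.2.2⟩ else 0

/-- The output: the receiver of item `e` is in the cell `(0, e)` of array `1` of natural
numbers. -/
def Outputs {n m : ℕ} (s : Store) (X : Fin n → Finset (Fin m)) : Prop :=
  ∀ i e, e ∈ X i ↔ s.nat 1 0 (e : ℕ) = (i : ℕ)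

end ChoreDivision

/-! Let s and l be the least and the largest cost that occur. If m ≤ n or l ≤ 2s, dealing the items
out cyclically is fair: a bundle minus an item is empty, or it costs agent i at most |X_j| l ≤ 2
c_i(X_j) (`efx_of_mod`). Otherwise m > n and 2s < l, and every cost is s or l.

In that case agents pick items, preferring an item small for themselves, then one that is large for
everybody, then any. After r rounds, an agent with only small items may hold up to r + n - 1 of
them, because (r + n - 2) s ≤ (n - 1) r s (`tolerates_of_small`). An agent without small free items
at the start of a later round sees all items of that round as large: its bundle and every other one
grow by l, so the factor n - 1 leaves it slack for n - 2 more large items (`MainInv.pass`). Such a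
round is safe if each agent has no small free item or at least n of them, as the latter guarantees
it one. An agent with between 1 and n - 1 small free items therefore takes all of them before the
next round. Once fewer than n items are free, every agent takes what is small for it, and R < n
items remain, all large for everybody.

Call an agent poor if it owns no item that is large for everybody. If R > 0, the order of preference
ensures that poor agents own only small items, and that each other agent owns a single item or has
slack n - 2 (`MainInv.ready`). Three cases exhaust the endgame. If there are at most R poor agents,
each of them receives one item and the rest go to distinct other agents (`Ready.efx_of_gifts`).
Otherwise, if some agent that is not poor owns two items, then R ≤ n - 2 and its slack absorbs all
free items (`Ready.feed`, `FeedInv.give`). Otherwise the items are given out singly. Let i be a poor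
agent, not yet served, with the fewest items, and X_j the bundle cheapest to i among those of the
other such agents. If l ≤ 2 c_i(X_j), agent i takes the item, since c_i(X_i) + l ≤ 3 c_i(X_j) and n
- 1 ≥ 3 (`SplitInv.take`). If not, X_i ∪ X_j costs i less than l, so i takes over X_j and j receives
the item alone (`SplitInv.merge`).

The running time is amortised. For each agent, for the items large for everybody and for all items,
a counter of free items and a monotone pointer to the first candidate are maintained. A pick costs
O(n) plus the advance of one pointer; `potential`, which is O(nm) initially, pays for all picks
(`runs_pick`). A split step costs O(n + m), and there are fewer than n < m of them. -/

namespace ChoreDivision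

/-! ### Time-credit logic for programs -/

/-- Started in memory `s` with a budget of `b` steps, the program halts within the budget, and the
final memory together with the remaining budget satisfies `Q`. -/
def Runs (p : Program) (s : Store) (b : ℕ) (Q : Store → ℕ → Prop) : Prop :=
  ∃ t s' b', Exec p s t s' ∧ t + b' ≤ b ∧ Q s' b'

namespace Runs

variable {p q : Program} {s : Store} {b : ℕ} {Q Q' : Store → ℕ → Prop}

theorem mono (h : Runs p s b Q) (hQ : ∀ s' b', Q s' b' → Q' s' b') : Runs p s b Q' := by
  obtain ⟨t, s', b', h1, h2, h3⟩ := h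
  exact ⟨t, s', b', h1, h2, hQ _ _ h3⟩

theorem skip (hb : 1 ≤ b) (h : Q s (b - 1)) : Runs .skip s b Q :=
  ⟨1, s, b - 1, .skip s, by omega, h⟩

theorem setNat {a : ℕ} {i j x : NatExpr} (hb : i.cost + j.cost + x.cost + 1 ≤ b)
    (h : Q (s.writeNat a (i.eval s) (j.eval s) (x.eval s))
      (b - (i.cost + j.cost + x.cost + 1))) : Runs (.setNat a i j x) s b Q :=
  ⟨_, _, _, .setNat a i j x s, by omega, h⟩

theorem setReal {a : ℕ} {i j : NatExpr} {x : RealExpr} (hb : i.cost + j.cost + x.cost + 1 ≤ b)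
    (h : Q (s.writeReal a (i.eval s) (j.eval s) (x.eval s))
      (b - (i.cost + j.cost + x.cost + 1))) : Runs (.setReal a i j x) s b Q :=
  ⟨_, _, _, .setReal a i j x s, by omega, h⟩

theorem seq (h : Runs p s b fun s' b' => Runs q s' b' Q) : Runs (.seq p q) s b Q := by
  obtain ⟨t, s', b', h1, h2, t', s'', b'', h3, h4, h5⟩ := h
  exact ⟨_, _, b'', .seq h1 h3, by omega, h5⟩

theorem ite {T : Test} (hb : T.cost + 1 ≤ b) (h1 : T.Holds s → Runs p s (b - (T.cost + 1)) Q)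
    (h2 : ¬ T.Holds s → Runs q s (b - (T.cost + 1)) Q) : Runs (.ite T p q) s b Q := by
  by_cases hT : T.Holds s
  · obtain ⟨t, s', b', g1, g2, g3⟩ := h1 hT
    exact ⟨_, _, b', .iteTrue hT g1, by omega, g3⟩
  · obtain ⟨t, s', b', g1, g2, g3⟩ := h2 hT
    exact ⟨_, _, b', .iteFalse hT g1, by omega, g3⟩

/-- Termination of a loop comes for free, because every iteration uses up some budget. -/
theorem while_loop {T : Test} {I : Store → ℕ → Prop}
    (hstep : ∀ s b, I s b → T.Holds s → T.cost + 1 ≤ b ∧ Runs p s (b - (T.cost + 1)) I)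
    (hend : ∀ s b, I s b → ¬ T.Holds s → T.cost + 1 ≤ b ∧ Q s (b - (T.cost + 1)))
    (h : I s b) : Runs (.while T p) s b Q := by
  induction b using Nat.strong_induction_on generalizing s with
  | _ b ih =>
    by_cases hT : T.Holds s
    · obtain ⟨h0, t, s', b', h1, h2, h3⟩ := hstep s b h hT
      obtain ⟨t', s'', b'', h4, h5, h6⟩ := ih b' (by omega) h3
      exact ⟨_, _, b'', .whileTrue hT h1 h4, by omega, h6⟩
    · obtain ⟨h0, h1⟩ := hend s b h hT
      exact ⟨_, _, _, .whileFalse hT, by omega, h1⟩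

/-- Unspent credit of a piece with worst-case cost C is discarded, so that exactly b - C is left for
what follows. -/
theorem frame {C : ℕ} {P : Store → Prop} (h : Runs p s C fun s' _ => P s') (hb : C ≤ b)
    (hQ : ∀ s', P s' → Q s' (b - C)) : Runs p s b Q := by
  obtain ⟨t, s', b', h1, h2, h3⟩ := h
  exact ⟨t, s', b - C, h1, by omega, hQ _ h3⟩

end Runs

/-! ### Scalars and counting loops -/

/-- The scalar kept in the cell `(0, 0)` of array `k`. -/
abbrev scalar (k : ℕ) : NatExpr := .cell k (.const 0) (.const 0)

/-- Assignment to a scalar. -/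
abbrev assign (k : ℕ) (x : NatExpr) : Program := .setNat k (.const 0) (.const 0) x

/-- The loop running `body` with scalar `k` equal to `0, 1, …, bound - 1`. -/
abbrev forLoop (k : ℕ) (bound : NatExpr) (body : Program) : Program :=
  .seq (assign k (.const 0))
    (.while (.natLe (.succ (scalar k)) bound) (.seq body (assign k (.succ (scalar k)))))

@[simp] theorem Store.nat_writeNat_of_ne {s : Store} {a a' i j v : ℕ} (h : a' ≠ a) :
    (s.writeNat a i j v).nat a' = s.nat a' := by
  funext i' j'
  simp [Store.writeNat, h]

@[simp] theorem Store.nat_writeNat_same {s : Store} {a i j v : ℕ} (i' j' : ℕ) :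
    (s.writeNat a i j v).nat a i' j' = if i' = i ∧ j' = j then v else s.nat a i' j' := by
  simp [Store.writeNat]

@[simp] theorem Store.real_writeNat {s : Store} {a i j v : ℕ} :
    (s.writeNat a i j v).real = s.real := rfl

@[simp] theorem Store.nat_writeReal {s : Store} {a i j : ℕ} {v : ℝ} :
    (s.writeReal a i j v).nat = s.nat := rfl

@[simp] theorem Store.real_writeReal_of_ne {s : Store} {a a' i j : ℕ} {v : ℝ} (h : a' ≠ a) :
    (s.writeReal a i j v).real a' = s.real a' := by
  funext i' j'
  simp [Store.writeReal, h]

@[simp] theorem Store.real_writeReal_same {s : Store} {a i j : ℕ} {v : ℝ} (i' j' : ℕ) :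
    (s.writeReal a i j v).real a i' j' = if i' = i ∧ j' = j then v else s.real a i' j' := by
  simp [Store.writeReal]

namespace Runs

variable {body : Program} {bound : NatExpr} {s : Store} {b k N : ℕ}

/-- Initialising the counter takes 4 steps, a test `bound.cost + 6`, and an increment 7, whence
`bound.cost + 13` per iteration. For the bounds `numAgents` and `numItems`, of cost 3, this produces
the summands 16 per iteration and 13 per loop that recur below. -/
theorem for_loop {I : ℕ → Store → ℕ → Prop} {Q : Store → ℕ → Prop}
    (hb : 4 ≤ b) (hinit : I 0 (s.writeNat k 0 0 0) (b - 4))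
    (hbound : ∀ i s b, I i s b → bound.eval s = N)
    (hbody : ∀ i s b, i < N → s.nat k 0 0 = i → I i s b → bound.cost + 13 ≤ b ∧
      Runs body s (b - (bound.cost + 13)) fun s' b' =>
        s'.nat k 0 0 = i ∧ I (i + 1) (s'.writeNat k 0 0 (i + 1)) b')
    (hend : ∀ s b, s.nat k 0 0 = N → I N s b → bound.cost + 6 ≤ b ∧ Q s (b - (bound.cost + 6))) :
    Runs (forLoop k bound body) s b Q := by
  refine seq (setNat (by simpa [NatExpr.cost] using hb) ?_)
  refine while_loop (I := fun s b => s.nat k 0 0 ≤ N ∧ I (s.nat k 0 0) s b) ?_ ?_ ?_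
  · rintro s b ⟨h1, h2⟩ hT
    have hB := hbound _ _ _ h2
    simp only [Test.Holds, NatExpr.eval, hB] at hT
    obtain ⟨h3, t, s', b', h4, h5, h6, h7⟩ := hbody _ s b (by omega) rfl h2
    refine ⟨by simp [Test.cost, NatExpr.cost]; omega, ?_⟩
    refine seq ⟨t, s', b' + 7, h4, ?_, ?_⟩
    · simp [Test.cost, NatExpr.cost]; omega
    · refine setNat (by simp [NatExpr.cost]) ?_
      simp only [NatExpr.eval, NatExpr.cost, h6]
      simpa using ⟨by omega, h7⟩
  · rintro s b ⟨h1, h2⟩ hT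
    have hB := hbound _ _ _ h2
    simp only [Test.Holds, NatExpr.eval, hB] at hT
    have hN : s.nat k 0 0 = N := by omega
    obtain ⟨h3, h4⟩ := hend s b hN (hN ▸ h2)
    have : (Test.natLe (NatExpr.succ (scalar k)) bound).cost + 1 = bound.cost + 6 := by
      simp [Test.cost, NatExpr.cost]; omega
    rw [this]; exact ⟨h3, h4⟩
  · simpa [NatExpr.eval, NatExpr.cost] using hinit

/-- Counting loops whose body has a fixed cost. -/
theorem for_loop_const {C : ℕ} {J : ℕ → Store → Prop} {P : Store → Prop}
    (hinit : J 0 (s.writeNat k 0 0 0))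
    (hbound : ∀ i s, J i s → bound.eval s = N)
    (hbody : ∀ i s, i < N → s.nat k 0 0 = i → J i s →
      Runs body s C fun s' _ => s'.nat k 0 0 = i ∧ J (i + 1) (s'.writeNat k 0 0 (i + 1)))
    (hend : ∀ s, J N s → P s) :
    Runs (ChoreDivision.forLoop k bound body) s (N * (C + (bound.cost + 13)) + (bound.cost + 10))
      fun s' _ => P s' := by
  refine for_loop (N := N)
    (I := fun i s b => J i s ∧ i ≤ N ∧ (N - i) * (C + (bound.cost + 13)) + (bound.cost + 6) ≤ b)
    (by omega) ⟨hinit, by omega, by simp; omega⟩ (fun i s b h => hbound i s h.1) ?_ ?_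
  · rintro i s b hi hk ⟨h1, h2, h3⟩
    have e : N - i = (N - (i + 1)) + 1 := by omega
    rw [e, add_mul, one_mul] at h3
    refine ⟨by omega, ?_⟩
    refine frame (hbody i s hi hk h1) (by omega) ?_
    rintro s' ⟨h4, h5⟩
    exact ⟨h4, h5, by omega, by omega⟩
  · rintro s b _ ⟨h1, h2, h3⟩
    exact ⟨by omega, hend s h1⟩

end Runs

/-! ### Combinatorics of partial allocations

A partial allocation is a family `X` of bundles, where `X i` for `i < n` is the bundle of agent `i`
and `X n` is the set of free items. -/

/-- The cost of a set of items to agent `i`. -/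
noncomputable def setCost (c : ℕ → ℕ → ℝ) (i : ℕ) (S : Finset ℕ) : ℝ := ∑ e ∈ S, c i e

/-- For `v < n`, item `e` is small for agent `v`; for `v = n`, it is small for no agent; for
`v > n`, no condition. -/
def Hits (n : ℕ) (c : ℕ → ℕ → ℝ) (s : ℝ) (v e : ℕ) : Prop :=
  if v < n then c v e = s else v = n → ∀ i < n, c i e ≠ s

open Classical in
/-- The number of free items hit by `v`. -/
noncomputable def avail (n : ℕ) (c : ℕ → ℕ → ℝ) (s : ℝ) (X : ℕ → Finset ℕ) (v : ℕ) : ℕ :=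
  ((X n).filter (Hits n c s v)).card

/-- Bi-valued costs with a large value exceeding twice the small one. -/
structure Separated (n m : ℕ) (c : ℕ → ℕ → ℝ) (s l : ℝ) : Prop where
  four_le : 4 ≤ n
  nonneg : 0 ≤ s
  two_mul_lt : 2 * s < l
  small_or_large : ∀ i < n, ∀ e < m, c i e = s ∨ c i e = l

/-- Approximate envy-freeness up to any item for the bundles of the agents `0, …, n - 1`. -/
def EFX (n : ℕ) (c : ℕ → ℕ → ℝ) (X : ℕ → Finset ℕ) : Prop :=
  ∀ i < n, ∀ j < n, i ≠ j → ∀ e ∈ X i,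
    setCost c i (X i) - c i e ≤ ((n : ℝ) - 1) * setCost c i (X j)

/-- Agent `i` remains envy-free up to any item after receiving `k` more large items. -/
def Tolerates (n : ℕ) (c : ℕ → ℕ → ℝ) (l : ℝ) (X : ℕ → Finset ℕ) (i : ℕ) (k : ℝ) : Prop :=
  ∀ j < n, i ≠ j → ∀ e ∈ X i,
    setCost c i (X i) - c i e + k * l ≤ ((n : ℝ) - 1) * setCost c i (X j)

/-- `X'` arises from `X` by giving the free item `f` to agent `i`. -/
structure Give (n i f : ℕ) (X X' : ℕ → Finset ℕ) : Prop where
  lt : i < n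
  free : f ∈ X n
  notMem : f ∉ X i
  self : X' i = insert f (X i)
  rest : X' n = (X n).erase f
  other : ∀ j < n, j ≠ i → X' j = X j

/-! ### Elementary estimates for two cost values, and the effect of giving away one item -/

section Basic

variable {n m : ℕ} {c : ℕ → ℕ → ℝ} {s l : ℝ} {X X' : ℕ → Finset ℕ}

theorem hits_agent {v e : ℕ} (hv : v < n) : Hits n c s v e ↔ c v e = s := by
  simp [Hits, hv]

theorem hits_none {e : ℕ} : Hits n c s n e ↔ ∀ i < n, c i e ≠ s := by
  simp [Hits]

theorem hits_all {e : ℕ} : Hits n c s (n + 1) e := by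
  simp [Hits]

theorem avail_pos_iff {v : ℕ} : 0 < avail n c s X v ↔ ∃ e ∈ X n, Hits n c s v e := by
  classical
  simp [avail, Finset.card_pos, Finset.Nonempty]

theorem avail_eq_zero_iff {v : ℕ} : avail n c s X v = 0 ↔ ∀ e ∈ X n, ¬ Hits n c s v e := by
  classical
  simp [avail, Finset.filter_eq_empty_iff]

theorem avail_mono {v : ℕ} (h : X' n ⊆ X n) : avail n c s X' v ≤ avail n c s X v := by
  classical
  exact Finset.card_le_card (Finset.filter_subset_filter _ h)

theorem avail_all : avail n c s X (n + 1) = (X n).card := by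
  classical
  simp [avail, hits_all]

theorem avail_le_all {v : ℕ} : avail n c s X v ≤ avail n c s X (n + 1) := by
  classical
  rw [avail_all]
  exact Finset.card_filter_le _ _

theorem Give.avail_add_one {i f v : ℕ} (h : Give n i f X X') (hv : Hits n c s v f) :
    avail n c s X' v + 1 = avail n c s X v := by
  classical
  have hmem : f ∈ (X n).filter (Hits n c s v) := by simp [h.free, hv]
  rw [avail, avail, h.rest, Finset.filter_erase, Finset.card_erase_add_one hmem]

theorem Give.avail_eq {i f v : ℕ} (h : Give n i f X X') (hv : ¬ Hits n c s v f) :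
    avail n c s X' v = avail n c s X v := by
  classical
  have hmem : f ∉ (X n).filter (Hits n c s v) := by simp [hv]
  rw [avail, avail, h.rest, Finset.filter_erase, Finset.erase_eq_of_notMem hmem]

theorem Give.avail_le_add_one {i f v : ℕ} (h : Give n i f X X') :
    avail n c s X v ≤ avail n c s X' v + 1 := by
  by_cases hv : Hits n c s v f
  · exact (h.avail_add_one hv).ge
  · exact (h.avail_eq hv).ge.trans (Nat.le_succ _)

theorem Give.rest_subset {i f : ℕ} (h : Give n i f X X') : X' n ⊆ X n := by
  rw [h.rest]; exact Finset.erase_subset _ _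

theorem Give.subset {i f j : ℕ} (h : Give n i f X X') (hj : j < n) : X j ⊆ X' j := by
  by_cases e : j = i
  · subst e; rw [h.self]; exact Finset.subset_insert _ _
  · rw [h.other j hj e]

theorem Give.subset_range {i f : ℕ} (h : Give n i f X X')
    (hX : ∀ j ≤ n, X j ⊆ Finset.range m) : ∀ j ≤ n, X' j ⊆ Finset.range m := by
  intro j hj
  rcases hj.lt_or_eq with hj | rfl
  · by_cases e : j = i
    · subst e
      rw [h.self]
      exact Finset.insert_subset (hX n le_rfl h.free) (hX j hj.le)
    · rw [h.other j hj e]; exact hX j hj.le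
  · exact h.rest_subset.trans (hX j le_rfl)

theorem setCost_insert {i f : ℕ} {S : Finset ℕ} (h : f ∉ S) :
    setCost c i (insert f S) = setCost c i S + c i f := by
  rw [setCost, Finset.sum_insert h, add_comm, setCost]

theorem setCost_of_small {i : ℕ} {S : Finset ℕ} (h : ∀ e ∈ S, c i e = s) :
    setCost c i S = S.card * s := by
  rw [setCost, Finset.sum_congr rfl h, Finset.sum_const, nsmul_eq_mul]

namespace Separated

variable (hI : Separated n m c s l)
include hI

theorem lt : s < l := by linarith [hI.nonneg, hI.two_mul_lt]

theorem pos : 0 < l := hI.nonneg.trans_lt hI.lt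

theorem three_le : (3 : ℝ) ≤ (n : ℝ) - 1 := by
  have : (4 : ℝ) ≤ n := by exact_mod_cast hI.four_le
  linarith

theorem eq_large_of_ne {i e : ℕ} (hi : i < n) (he : e < m) (h : c i e ≠ s) : c i e = l :=
  (hI.small_or_large i hi e he).resolve_left h

theorem le_cost {i e : ℕ} (hi : i < n) (he : e < m) : s ≤ c i e := by
  rcases hI.small_or_large i hi e he with h | h <;> rw [h]
  exact hI.lt.le

theorem cost_le {i e : ℕ} (hi : i < n) (he : e < m) : c i e ≤ l := by
  rcases hI.small_or_large i hi e he with h | h <;> rw [h]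
  exact hI.lt.le

theorem large_of_hits {i e : ℕ} (hi : i < n) (he : e < m) (h : Hits n c s n e) : c i e = l :=
  hI.eq_large_of_ne hi he (hits_none.1 h i hi)

theorem card_mul_le {i : ℕ} {S : Finset ℕ} (hi : i < n) (hS : S ⊆ Finset.range m) :
    S.card * s ≤ setCost c i S := by
  rw [setCost, ← nsmul_eq_mul, ← Finset.sum_const]
  exact Finset.sum_le_sum fun e he => hI.le_cost hi (Finset.mem_range.1 (hS he))

theorem setCost_nonneg {i : ℕ} {S : Finset ℕ} (hi : i < n) (hS : S ⊆ Finset.range m) :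
    0 ≤ setCost c i S :=
  le_trans (mul_nonneg (Nat.cast_nonneg _) hI.nonneg) (hI.card_mul_le hi hS)

theorem setCost_mono {i : ℕ} {S S' : Finset ℕ} (hi : i < n) (h : S ⊆ S')
    (hS : S' ⊆ Finset.range m) : setCost c i S ≤ setCost c i S' :=
  Finset.sum_le_sum_of_subset_of_nonneg h fun _ he _ =>
    hI.nonneg.trans (hI.le_cost hi (Finset.mem_range.1 (hS he)))

theorem card_mul_add_le {i f : ℕ} {S : Finset ℕ} (hi : i < n) (hS : S ⊆ Finset.range m)
    (hf : f ∈ S) (hl : c i f = l) : ((S.card : ℝ) - 1) * s + l ≤ setCost c i S := by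
  have h1 := hI.card_mul_le hi ((Finset.erase_subset f S).trans hS)
  have h2 : setCost c i (S.erase f) + c i f = setCost c i S := Finset.sum_erase_add _ _ hf
  have h3 : ((S.erase f).card : ℝ) = S.card - 1 := by
    rw [Finset.card_erase_of_mem hf, Nat.cast_pred (Finset.card_pos.2 ⟨f, hf⟩)]
  rw [h3] at h1
  linarith

theorem large_le_setCost {i f : ℕ} {S : Finset ℕ} (hi : i < n) (hS : S ⊆ Finset.range m)
    (hf : f ∈ S) (hl : c i f = l) : l ≤ setCost c i S := by
  have h1 := hI.card_mul_add_le hi hS hf hl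
  have h2 : (1 : ℝ) ≤ S.card := by exact_mod_cast Finset.card_pos.2 ⟨f, hf⟩
  nlinarith [hI.nonneg]

/-- Removing an item leaves at most what remains after removing a small one. -/
theorem sub_cost_le {i e : ℕ} {S : Finset ℕ} (hi : i < n) (hS : S ⊆ Finset.range m)
    (he : e ∈ S) : setCost c i S - c i e ≤ setCost c i S - s := by
  linarith [hI.le_cost hi (Finset.mem_range.1 (hS he))]

end Separated

theorem Tolerates.mono_left {i : ℕ} {k k' : ℝ} (h : Tolerates n c l X i k) (hk : k' * l ≤ k * l) :
    Tolerates n c l X i k' := fun j hj hij e he => by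
  linarith [h j hj hij e he]

/-- Envy does not increase when the other bundles grow. -/
theorem Tolerates.grow (hI : Separated n m c s l) {i : ℕ} {k : ℝ} (hi : i < n)
    (h : Tolerates n c l X i k) (hself : X' i = X i) (hsub : ∀ j < n, X j ⊆ X' j)
    (hX' : ∀ j ≤ n, X' j ⊆ Finset.range m) : Tolerates n c l X' i k := by
  intro j hj hij e he
  rw [hself] at he ⊢
  have h1 := h j hj hij e he
  have h2 := hI.setCost_mono hi (hsub j hj) (hX' j hj.le)
  nlinarith [hI.three_le]

theorem efx_iff : EFX n c X ↔ ∀ i < n, Tolerates n c l X i 0 := by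
  simp [EFX, Tolerates]

end Basic

/-! ### Invariant of the picking rounds -/

section Rounds

variable {n m : ℕ} {c : ℕ → ℕ → ℝ} {s l : ℝ} {X X' : ℕ → Finset ℕ}

/-- Agent `i` receives a large item, while the cost to `i` of every other bundle grows by at least
`g`. -/
theorem Tolerates.insert_large (hI : Separated n m c s l) {i f : ℕ} {k k' g : ℝ} (hi : i < n)
    (h : Tolerates n c l X i k) (hX : X i ⊆ Finset.range m) (hne : (X i).Nonempty)
    (hf : f ∉ X i) (hl : c i f = l) (hself : X' i = insert f (X i))
    (hg : ∀ j < n, i ≠ j → setCost c i (X j) + g ≤ setCost c i (X' j))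
    (hk : (k' + 1) * l ≤ k * l + ((n : ℝ) - 1) * g) : Tolerates n c l X' i k' := by
  intro j hj hij e he
  have h3 := hI.three_le
  have hg' := hg j hj hij
  have key : ∀ e ∈ X i, setCost c i (X i) - c i e + (k' + 1) * l ≤
      ((n : ℝ) - 1) * setCost c i (X' j) := fun e he => by
    have := h j hj hij e he
    nlinarith
  rw [hself, setCost_insert hf, hl]
  rw [hself] at he
  rcases Finset.mem_insert.1 he with rfl | he
  · obtain ⟨e₀, he₀⟩ := hne
    have h1 := key e₀ he₀
    have h2 := hI.cost_le hi (Finset.mem_range.1 (hX he₀))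
    rw [hl]; linarith
  · linarith [key e he]

/-- The invariant of the main loop, after `r` rounds in which every agent has picked an item.
Agent `g` is in the course of taking all its small items (`g = n`: nobody is). -/
structure MainInv (n m : ℕ) (c : ℕ → ℕ → ℝ) (s l : ℝ) (r g : ℕ) (X : ℕ → Finset ℕ) : Prop where
  subset : ∀ j ≤ n, X j ⊆ Finset.range m
  pos : 1 ≤ r
  size : ∀ j < n, r ≤ (X j).card
  fresh : ∀ i < n, i ≠ g → 0 < avail n c s X i → (X i).card = r ∧ ∀ e ∈ X i, c i e = s
  taking : g < n → (X g).card + avail n c s X g + 1 ≤ r + n ∧ ∀ e ∈ X g, c g e = s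
  efx : ∀ i < n, Tolerates n c l X i 0
  final : 0 < avail n c s X n → ∀ i < n,
    ((∀ e ∈ X i, c i e = s) ∧ (X i).card + 1 ≤ r + n) ∨
    ((∃ e ∈ X i, Hits n c s n e) ∧ ((X i).card = 1 ∨ Tolerates n c l X i ((n : ℝ) - 2)))

/-- Every other bundle has at least r items and costs at least r s, while (n - 1) r - (r + n - 2) =
(n - 2)(r - 1) ≥ 0. -/
theorem tolerates_of_small (hI : Separated n m c s l) {i r : ℕ} (hi : i < n)
    (hsub : ∀ j ≤ n, X j ⊆ Finset.range m) (hr : 1 ≤ r) (hsize : ∀ j < n, r ≤ (X j).card)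
    (hsmall : ∀ e ∈ X i, c i e = s) (hcard : (X i).card + 1 ≤ r + n) :
    Tolerates n c l X i 0 := by
  intro j hj _ e he
  have h1 := hI.card_mul_le hi (hsub j hj.le)
  have h2 : (r : ℝ) ≤ (X j).card := by exact_mod_cast hsize j hj
  have h3 : ((X i).card : ℝ) + 1 ≤ r + n := by exact_mod_cast hcard
  have h4 : (1 : ℝ) ≤ r := by exact_mod_cast hr
  have h5 := hI.three_le
  have h0 := hI.nonneg
  rw [setCost_of_small hsmall, hsmall e he]
  have h6 : ((X i).card : ℝ) - 1 ≤ ((n : ℝ) - 1) * (X j).card := by nlinarith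
  have h7 : ((n : ℝ) - 1) * ((X j).card * s) ≤ ((n : ℝ) - 1) * setCost c i (X j) :=
    mul_le_mul_of_nonneg_left h1 (by linarith)
  nlinarith [mul_le_mul_of_nonneg_right h6 h0]

/-- The size of the taker's bundle plus the number of its small free items does not change, so the
bound r + n - 1 survives. For the other agents only foreign bundles grow. -/
theorem MainInv.give (hI : Separated n m c s l) {r g f : ℕ} (h : MainInv n m c s l r g X)
    (hG : Give n g f X X') (hf : c g f = s) : MainInv n m c s l r g X' := by
  have hg := hG.lt
  have hsub' := hG.subset_range h.subset
  have hsize' : ∀ j < n, r ≤ (X' j).card := fun j hj =>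
    (h.size j hj).trans (Finset.card_le_card (hG.subset hj))
  obtain ⟨t1, t2⟩ := h.taking hg
  have t3 := hG.avail_add_one (c := c) (s := s) ((hits_agent hg).2 hf)
  have t4 : (X' g).card = (X g).card + 1 := by
    rw [hG.self, Finset.card_insert_of_notMem hG.notMem]
  have t5 : ∀ e ∈ X' g, c g e = s := by
    rw [hG.self]
    intro e he
    rcases Finset.mem_insert.1 he with rfl | he
    exacts [hf, t2 e he]
  have hmono : ∀ v, avail n c s X' v ≤ avail n c s X v := fun v => avail_mono hG.rest_subset
  refine ⟨hsub', h.pos, hsize', ?_, fun _ => ⟨by omega, t5⟩, ?_, ?_⟩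
  · intro i hi hig hav
    rw [hG.other i hi hig]
    exact h.fresh i hi hig (hav.trans_le (hmono i))
  · intro i hi
    by_cases hig : i = g
    · subst hig
      exact tolerates_of_small hI hi hsub' h.pos hsize' t5 (by omega)
    · exact (h.efx i hi).grow hI hi (hG.other i hi hig) (fun j hj => hG.subset hj) hsub'
  · intro hav i hi
    by_cases hig : i = g
    · subst hig
      exact Or.inl ⟨t5, by omega⟩
    · rw [hG.other i hi hig]
      refine (h.final (hav.trans_le (hmono n)) i hi).imp_right fun ⟨h1, h2⟩ => ⟨h1, ?_⟩
      exact h2.imp_right fun h2 =>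
        h2.grow hI hi (hG.other i hi hig) (fun j hj => hG.subset hj) hsub'

theorem MainInv.release {r g : ℕ} (h : MainInv n m c s l r g X)
    (hav : avail n c s X g = 0) : MainInv n m c s l r n X :=
  ⟨h.subset, h.pos, h.size, fun i hi _ hp => h.fresh i hi (by rintro rfl; omega) hp,
    fun hn => absurd hn (lt_irrefl n), h.efx, h.final⟩

/-- An agent that still has small free items holds exactly r items, all small, so at most n - 1 more
keep it within r + n - 1. -/
theorem MainInv.seize {r g : ℕ} (h : MainInv n m c s l r n X) (hg : g < n)
    (hpos : 0 < avail n c s X g) (hlt : avail n c s X g < n) : MainInv n m c s l r g X := by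
  obtain ⟨h1, h2⟩ := h.fresh g hg hg.ne hpos
  exact ⟨h.subset, h.pos, h.size, fun i hi _ hp => h.fresh i hi hi.ne hp,
    fun _ => ⟨by omega, h2⟩, h.efx, h.final⟩

/-- A pick of agent `i` respects the preferences: a small item if there is one, else an item that
is large for everybody if there is one. -/
def Prefers (n : ℕ) (c : ℕ → ℕ → ℝ) (s : ℝ) (X : ℕ → Finset ℕ) (i f : ℕ) : Prop :=
  Hits n c s i f ∨ avail n c s X i = 0 ∧ (Hits n c s n f ∨ avail n c s X n = 0)

/-- `X` arises from `X₀` by picks of the agents `0, …, k - 1`. -/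
def Picked (n m : ℕ) (c : ℕ → ℕ → ℝ) (s : ℝ) (X₀ : ℕ → Finset ℕ) (k : ℕ) (X : ℕ → Finset ℕ) :
    Prop :=
  (∃ f : ℕ → ℕ, ∀ i < k, f i ∈ X₀ n ∧ f i ∉ X₀ i ∧ X i = insert (f i) (X₀ i) ∧
    Prefers n c s X i (f i) ∧ (n ≤ avail n c s X₀ i → Hits n c s i (f i))) ∧
  (∀ i, k ≤ i → i < n → X i = X₀ i) ∧ X n ⊆ X₀ n ∧ (∀ j ≤ n, X j ⊆ Finset.range m) ∧
  ∀ v, avail n c s X₀ v ≤ avail n c s X v + k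

end Rounds

/-! ### A full round of picks -/

section Passes

variable {n m : ℕ} {c : ℕ → ℕ → ℝ} {s l : ℝ} {X X' X₀ : ℕ → Finset ℕ}

/-- A counter that was zero stays zero while the free set shrinks; hence preferences at the time of
a pick can be evaluated at the end of the round. -/
theorem Prefers.mono {i f : ℕ} (h : Prefers n c s X i f) (hX : X' n ⊆ X n) :
    Prefers n c s X' i f := by
  have h1 := avail_mono (c := c) (s := s) (v := i) hX
  have h2 := avail_mono (c := c) (s := s) (v := n) hX
  exact h.imp_right fun ⟨g1, g2⟩ => ⟨by omega, g2.imp_right fun g3 => by omega⟩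

theorem Picked.zero (h : ∀ j ≤ n, X j ⊆ Finset.range m) : Picked n m c s X 0 X :=
  ⟨⟨id, by simp⟩, by simp, subset_rfl, h, by simp⟩

theorem Picked.succ {k f : ℕ} (h : Picked n m c s X₀ k X) (hG : Give n k f X X')
    (hf : Prefers n c s X k f) : Picked n m c s X₀ (k + 1) X' := by
  obtain ⟨⟨F, h1⟩, h2, h3, h4, h5⟩ := h
  refine ⟨⟨Function.update F k f, ?_⟩, ?_, hG.rest_subset.trans h3, hG.subset_range h4, ?_⟩
  · intro i hi
    by_cases e : i = k
    · subst e
      have hX := h2 i le_rfl hG.lt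
      simp only [Function.update_self]
      refine ⟨h3 hG.free, hX ▸ hG.notMem, hX ▸ hG.self, hf.mono hG.rest_subset, fun hn => ?_⟩
      -- Fewer than n items have been taken before this pick, so of n small ones at least one is
      -- still free, which rules out the second alternative of `Prefers`.
      have := h5 i
      have := hG.lt
      rcases hf with hf | hf
      · exact hf
      · omega
    · have hik : i < k := by omega
      obtain ⟨g1, g2, g3, g4, g5⟩ := h1 i hik
      simp only [Function.update_of_ne e]
      exact ⟨g1, g2, (hG.other i (hik.trans hG.lt) e).trans g3, g4.mono hG.rest_subset, g5⟩
  · intro i hi hin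
    rw [hG.other i hin (by omega)]
    exact h2 i (by omega) hin
  · intro v
    have := h5 v
    have := hG.avail_le_add_one (c := c) (s := s) (v := v)
    omega

/-- Removing the only item of a bundle leaves cost 0, so fairness is automatic. An agent whose item
is not small for it found an item large for everybody, unless none of these is left. -/
theorem Picked.mainInv_one (hI : Separated n m c s l) (h : Picked n m c s X₀ n X)
    (h₀ : ∀ i < n, X₀ i = ∅) : MainInv n m c s l 1 n X := by
  obtain ⟨⟨F, h1⟩, -, -, h4, -⟩ := h
  have hX : ∀ i < n, X i = {F i} := fun i hi => by rw [(h1 i hi).2.2.1, h₀ i hi]; rfl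
  have hcard : ∀ i < n, (X i).card = 1 := fun i hi => by rw [hX i hi]; simp
  have hFm : ∀ i < n, F i < m := fun i hi => by
    have := h4 i hi.le
    rw [hX i hi] at this
    simpa using this
  refine ⟨h4, le_rfl, fun j hj => (hcard j hj).ge, ?_, fun hn => absurd hn (lt_irrefl n), ?_, ?_⟩
  · intro i hi _ hav
    refine ⟨hcard i hi, ?_⟩
    rw [hX i hi]
    rcases (h1 i hi).2.2.2.1 with hp | hp
    · simpa using (hits_agent hi).1 hp
    · omega
  · intro i hi j hj hij e he
    rw [hX i hi, Finset.mem_singleton] at he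
    have := hI.setCost_nonneg hj (h4 j hj.le)
    have := hI.setCost_nonneg hi (h4 j hj.le)
    have := hI.three_le
    have e1 : setCost c i (X i) = c i (F i) := by rw [hX i hi]; simp [setCost]
    rw [e1, he]
    nlinarith
  · intro hav i hi
    have hn := hI.four_le
    rcases (h1 i hi).2.2.2.1 with hp | ⟨-, hp | hp⟩
    · left
      refine ⟨?_, by rw [hcard i hi]; omega⟩
      rw [hX i hi]
      simpa using (hits_agent hi).1 hp
    · right
      refine ⟨⟨F i, by rw [hX i hi]; simp, hp⟩, Or.inl (hcard i hi)⟩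
    · omega

/-- The dichotomy `hav` is what the main loop enforces before a round. Agents with n small free
items surely get one and go on holding r + 1 small items; the others gain slack, and by preference
they pick items that are large for everybody as long as these last. -/
theorem MainInv.pass (hI : Separated n m c s l) {r : ℕ} (h : MainInv n m c s l r n X₀)
    (hP : Picked n m c s X₀ n X) (hav : ∀ i < n, avail n c s X₀ i = 0 ∨ n ≤ avail n c s X₀ i) :
    MainInv n m c s l (r + 1) n X := by
  obtain ⟨⟨F, h1⟩, -, h3, h4, -⟩ := hP
  have hcard : ∀ i < n, (X i).card = (X₀ i).card + 1 := fun i hi => by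
    rw [(h1 i hi).2.2.1, Finset.card_insert_of_notMem (h1 i hi).2.1]
  have hsize : ∀ j < n, r + 1 ≤ (X j).card := fun j hj => by
    rw [hcard j hj]
    exact Nat.succ_le_succ (h.size j hj)
  have hmono : ∀ v, avail n c s X v ≤ avail n c s X₀ v := fun v => avail_mono h3
  have hFm : ∀ i < n, F i < m := fun i hi =>
    Finset.mem_range.1 (h.subset n le_rfl (h1 i hi).1)
  have hn := hI.four_le
  have fresh : ∀ i < n, n ≤ avail n c s X₀ i → (X i).card = r + 1 ∧ ∀ e ∈ X i, c i e = s := by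
    intro i hi hge
    obtain ⟨g1, g2⟩ := h.fresh i hi hi.ne (by omega)
    refine ⟨by rw [hcard i hi, g1], ?_⟩
    rw [(h1 i hi).2.2.1]
    intro e he
    rcases Finset.mem_insert.1 he with rfl | he
    · exact (hits_agent hi).1 ((h1 i hi).2.2.2.2 hge)
    · exact g2 e he
  -- All picks of the round are large for such an agent: the right-hand side gains (n - 1) l, of
  -- which its own pick uses up l.
  have stuck : ∀ i < n, avail n c s X₀ i = 0 → Tolerates n c l X i ((n : ℝ) - 2) := by
    intro i hi h0
    have hlarge : ∀ j < n, c i (F j) = l := fun j hj =>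
      hI.eq_large_of_ne hi (hFm j hj) fun hs =>
        avail_eq_zero_iff.1 h0 (F j) (h1 j hj).1 ((hits_agent hi).2 hs)
    refine (h.efx i hi).insert_large hI hi (g := l) (h.subset i hi.le)
      (Finset.card_pos.1 (h.pos.trans (h.size i hi))) (h1 i hi).2.1 (hlarge i hi)
      (h1 i hi).2.2.1 ?_ (by linarith)
    intro j hj _
    rw [(h1 j hj).2.2.1, setCost_insert (h1 j hj).2.1, hlarge j hj]
  refine ⟨h4, by omega, hsize, ?_, fun hn => absurd hn (lt_irrefl n), ?_, ?_⟩
  · intro i hi _ hp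
    have := hmono i
    exact fresh i hi ((hav i hi).resolve_left (by omega))
  · intro i hi
    rcases hav i hi with h0 | hge
    · refine (stuck i hi h0).mono_left ?_
      have := hI.three_le
      nlinarith [hI.pos]
    · obtain ⟨g1, g2⟩ := fresh i hi hge
      exact tolerates_of_small hI hi h4 (by omega) hsize g2 (by omega)
  · intro hp i hi
    rcases hav i hi with h0 | hge
    · right
      refine ⟨⟨F i, by rw [(h1 i hi).2.2.1]; simp, ?_⟩, Or.inr (stuck i hi h0)⟩
      rcases (h1 i hi).2.2.2.1 with hp' | ⟨-, hp' | hp'⟩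
      · exact absurd hp' (avail_eq_zero_iff.1 h0 _ (h1 i hi).1)
      · exact hp'
      · omega
    · obtain ⟨g1, g2⟩ := fresh i hi hge
      exact Or.inl ⟨g2, by omega⟩

end Passes

/-! ### Distribution of the last items, which are large for everybody -/

section Endgame

variable {n m : ℕ} {c : ℕ → ℕ → ℝ} {s l : ℝ} {X X' X₀ : ℕ → Finset ℕ}

/-- Agent `i` owns no item that is large for everybody. -/
def Poor (n : ℕ) (c : ℕ → ℕ → ℝ) (s : ℝ) (X : ℕ → Finset ℕ) (i : ℕ) : Prop :=
  ∀ e ∈ X i, ¬ Hits n c s n e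

/-- The situation when only items are free that are large for everybody. -/
structure Ready (n m : ℕ) (c : ℕ → ℕ → ℝ) (s l : ℝ) (r : ℕ) (X : ℕ → Finset ℕ) : Prop where
  subset : ∀ j ≤ n, X j ⊆ Finset.range m
  pos : 1 ≤ r
  size : ∀ j < n, r ≤ (X j).card
  efx : ∀ i < n, Tolerates n c l X i 0
  poor : ∀ i < n, Poor n c s X i → (∀ e ∈ X i, c i e = s) ∧ (X i).card + 1 ≤ r + n
  rich : ∀ i < n, ¬ Poor n c s X i → (X i).card = 1 ∨ Tolerates n c l X i ((n : ℝ) - 2)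
  free : ∀ e ∈ X n, ∀ i < n, c i e = l

/-- No free item is small for anybody, so some free item is large for everybody and `final` applies.
An agent in its first alternative is poor, since an item large for everybody is not small for its
owner. -/
theorem MainInv.ready (hI : Separated n m c s l) {r : ℕ} (h : MainInv n m c s l r n X)
    (hav : ∀ i < n, avail n c s X i = 0) (hpos : 0 < avail n c s X (n + 1)) :
    Ready n m c s l r X := by
  have hfree : ∀ e ∈ X n, ∀ i < n, c i e ≠ s := fun e he i hi hs =>
    avail_eq_zero_iff.1 (hav i hi) e he ((hits_agent hi).2 hs)
  have hn : 0 < avail n c s X n := by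
    obtain ⟨e, he, -⟩ := avail_pos_iff.1 hpos
    exact avail_pos_iff.2 ⟨e, he, hits_none.2 (hfree e he)⟩
  refine ⟨h.subset, h.pos, h.size, h.efx, ?_, ?_, ?_⟩
  · intro i hi hp
    rcases h.final hn i hi with h1 | ⟨⟨e, he, h1⟩, -⟩
    · exact h1
    · exact absurd h1 (hp e he)
  · intro i hi hp
    rcases h.final hn i hi with h1 | h1
    · exact absurd (fun e he hh => hits_none.1 hh i hi (h1.1 e he)) hp
    · exact h1.2
  · exact fun e he i hi =>
      hI.eq_large_of_ne hi (Finset.mem_range.1 (h.subset n le_rfl he)) (hfree e he i hi)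

theorem Ready.large_of_not_poor (hI : Separated n m c s l) {r i j : ℕ} (h : Ready n m c s l r X)
    (hi : i < n) (hj : j < n) (hp : ¬ Poor n c s X j) : ∃ e ∈ X j, c i e = l := by
  simp only [Poor, not_forall, not_not] at hp
  obtain ⟨e, he, h1⟩ := hp
  exact ⟨e, he, hI.large_of_hits hi (Finset.mem_range.1 (h.subset j hj.le he)) h1⟩

/-- A poor agent can afford one large item as far as rich bundles are concerned: (r + n - 2) s + l ≤
(n - 1)((r - 1) s + l), because 2s < l gives (n - 1) s ≤ (n - 2) l. -/
theorem Ready.poor_rich (hI : Separated n m c s l) {r i j : ℕ} (h : Ready n m c s l r X)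
    (hi : i < n) (hj : j < n) (hpi : Poor n c s X i) (hpj : ¬ Poor n c s X j) :
    setCost c i (X i) - s + l ≤ ((n : ℝ) - 1) * setCost c i (X j) := by
  obtain ⟨h1, h2⟩ := h.poor i hi hpi
  obtain ⟨e, he, h3⟩ := h.large_of_not_poor hI hi hj hpj
  have h4 := hI.card_mul_add_le hi (h.subset j hj.le) he h3
  have h5 : (r : ℝ) ≤ (X j).card := by exact_mod_cast h.size j hj
  have h6 : ((X i).card : ℝ) + 1 ≤ r + n := by exact_mod_cast h2
  have h7 : (1 : ℝ) ≤ r := by exact_mod_cast h.pos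
  have h8 := hI.three_le
  have h9 := hI.nonneg
  have h10 := hI.two_mul_lt
  rw [setCost_of_small h1]
  have h11 : ((r : ℝ) - 1) * s + l ≤ setCost c i (X j) := by nlinarith
  have h12 : ((X i).card : ℝ) * s - s ≤ (r + n - 2) * s := by nlinarith
  have h13 : ((n : ℝ) - 1) * (((r : ℝ) - 1) * s + l) ≤ ((n : ℝ) - 1) * setCost c i (X j) :=
    mul_le_mul_of_nonneg_left h11 (by linarith)
  have h14 : 0 ≤ ((n : ℝ) - 2) * (((r : ℝ) - 1) * s) :=
    mul_nonneg (by linarith) (mul_nonneg (by linarith) h9)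
  have h15 : ((n : ℝ) - 1) * s ≤ ((n : ℝ) - 2) * l := by nlinarith
  nlinarith

/-- If all poor agents receive a free item, and every agent receives at most one, then the result
is fair. -/
theorem Ready.efx_of_gifts (hI : Separated n m c s l) {r : ℕ} (h : Ready n m c s l r X)
    {D : ℕ → Prop} (hD : ∀ i < n, Poor n c s X i → D i)
    (hX' : ∀ j ≤ n, X' j ⊆ Finset.range m)
    (hgift : ∀ i < n, D i → ∃ f ∈ X n, f ∉ X i ∧ X' i = insert f (X i))
    (hkeep : ∀ i < n, ¬ D i → X' i = X i) : ∀ i < n, Tolerates n c l X' i 0 := by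
  have hsub : ∀ j < n, X j ⊆ X' j := fun j hj => by
    by_cases hd : D j
    · obtain ⟨f, -, -, e⟩ := hgift j hj hd
      rw [e]; exact Finset.subset_insert _ _
    · rw [hkeep j hj hd]
  intro i hi
  by_cases hd : D i
  · obtain ⟨f, hf, hfi, e⟩ := hgift i hi hd
    have hlf := h.free f hf i hi
    have hne : (X i).Nonempty := Finset.card_pos.1 (h.pos.trans (h.size i hi))
    by_cases hp : Poor n c s X i
    · obtain ⟨h1, h2⟩ := h.poor i hi hp
      intro j hj hij e' he'
      have h3 := hI.sub_cost_le hi (hX' i hi.le) he'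
      rw [e, setCost_insert hfi, hlf] at h3
      rw [e, setCost_insert hfi, hlf, zero_mul, add_zero]
      refine h3.trans ?_
      -- Against a poor agent, the gift to j adds (n - 1) l on the right and outweighs the gift to
      -- i; against a rich one, the old bundle of j suffices.
      by_cases hpj : Poor n c s X j
      · obtain ⟨f', hf', hfj, e2⟩ := hgift j hj (hD j hj hpj)
        rw [e2, setCost_insert hfj, h.free f' hf' i hi]
        obtain ⟨e₀, he₀⟩ := hne
        have h4 := h.efx i hi j hj hij e₀ he₀
        rw [h1 e₀ he₀, zero_mul, add_zero] at h4
        nlinarith [hI.three_le, hI.pos]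
      · have h4 := h.poor_rich hI hi hj hp hpj
        have h5 := hI.setCost_mono hi (hsub j hj) (hX' j hj.le)
        nlinarith [hI.three_le]
    · rcases h.rich i hi hp with h1 | h1
      -- The single old item is large, so after the gift and a removal the cost is l; every other
      -- bundle now contains an item that is large for i, either an old one or a gift.
      · obtain ⟨e₀, he₀⟩ := Finset.card_eq_one.1 h1
        obtain ⟨e₁, he₁, hl₁⟩ := h.large_of_not_poor hI hi hi hp
        have h01 : e₁ = e₀ := by rw [he₀] at he₁; simpa using he₁
        subst h01
        intro j hj hij e' he'
        have h3 : l ≤ setCost c i (X' j) := by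
          by_cases hpj : Poor n c s X j
          · obtain ⟨f', hf', hfj, e2⟩ := hgift j hj (hD j hj hpj)
            exact hI.large_le_setCost hi (hX' j hj.le) (by rw [e2]; simp) (h.free f' hf' i hi)
          · obtain ⟨e₂, he₂, hl₂⟩ := h.large_of_not_poor hI hi hj hpj
            exact hI.large_le_setCost hi (hX' j hj.le) (hsub j hj he₂) hl₂
        have h4 : c i e' = l := by
          rw [e, he₀] at he'
          rcases Finset.mem_insert.1 he' with rfl | he'
          · exact hlf
          · rw [Finset.mem_singleton.1 he', hl₁]
        have h5 : setCost c i (X i) = l := by rw [he₀]; simp [setCost, hl₁]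
        rw [e, setCost_insert hfi, hlf, h4, h5]
        nlinarith [hI.three_le, hI.pos]
      · refine h1.insert_large hI hi (g := 0) (h.subset i hi.le) hne hfi hlf e ?_ ?_
        · intro j hj _
          rw [add_zero]
          exact hI.setCost_mono hi (hsub j hj) (hX' j hj.le)
        · nlinarith [hI.three_le, hI.pos]
  · exact (h.efx i hi).grow hI hi (hkeep i hi hd) hsub hX'

end Endgame

/-! ### Giving all remaining items to one agent -/

section Feed

variable {n m : ℕ} {c : ℕ → ℕ → ℝ} {s l : ℝ} {X X' : ℕ → Finset ℕ}

/-- Agent `k` can receive all free items. -/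
structure FeedInv (n m : ℕ) (c : ℕ → ℕ → ℝ) (l : ℝ) (k : ℕ) (X : ℕ → Finset ℕ) : Prop where
  subset : ∀ j ≤ n, X j ⊆ Finset.range m
  nonempty : (X k).Nonempty
  efx : ∀ i < n, i ≠ k → Tolerates n c l X i 0
  tolerates : Tolerates n c l X k (X n).card
  free : ∀ e ∈ X n, c k e = l

/-- Having two items excludes the first alternative of `rich`, and the slack n - 2 covers all free
items. -/
theorem Ready.feed (hI : Separated n m c s l) {r k : ℕ} (h : Ready n m c s l r X) (hk : k < n)
    (hp : ¬ Poor n c s X k) (hc : 2 ≤ (X k).card) (hR : (X n).card + 2 ≤ n) :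
    FeedInv n m c l k X := by
  refine ⟨h.subset, Finset.card_pos.1 (by omega), fun i hi _ => h.efx i hi, ?_,
    fun e he => h.free e he k hk⟩
  refine ((h.rich k hk hp).resolve_left (by omega)).mono_left ?_
  have : ((X n).card : ℝ) + 2 ≤ n := by exact_mod_cast hR
  nlinarith [hI.pos]

theorem FeedInv.give (hI : Separated n m c s l) {k f : ℕ} (h : FeedInv n m c l k X)
    (hG : Give n k f X X') : FeedInv n m c l k X' := by
  have hsub := hG.subset_range h.subset
  have hcard : ((X' n).card : ℝ) + 1 = (X n).card := by
    rw [hG.rest]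
    exact_mod_cast Finset.card_erase_add_one hG.free
  refine ⟨hsub, h.nonempty.mono (hG.subset hG.lt), ?_, ?_, ?_⟩
  · intro i hi hik
    exact (h.efx i hi hik).grow hI hi (hG.other i hi hik) (fun j hj => hG.subset hj) hsub
  · refine h.tolerates.insert_large hI hG.lt (g := 0) (h.subset k hG.lt.le) h.nonempty hG.notMem
      (h.free f hG.free) hG.self ?_ (by rw [hcard, mul_zero, add_zero])
    intro j hj _
    rw [add_zero]
    exact hI.setCost_mono hG.lt (hG.subset hj) (hsub j hj.le)
  · exact fun e he => h.free e (hG.rest_subset he)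

end Feed

/-! ### Serving poor agents one at a time, by a plain gift or by merging two bundles -/

section Split

variable {n m : ℕ} {c : ℕ → ℕ → ℝ} {s l : ℝ} {X X' X'' : ℕ → Finset ℕ}

/-- The invariant while the free items are given one by one to agents in `W`, the set of agents
all of whose items are small for themselves. -/
structure SplitInv (n m : ℕ) (c : ℕ → ℕ → ℝ) (s l : ℝ) (r : ℕ) (W : ℕ → Prop)
    (X : ℕ → Finset ℕ) : Prop where
  subset : ∀ j ≤ n, X j ⊆ Finset.range m
  pos : 1 ≤ r
  efx : ∀ i < n, Tolerates n c l X i 0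
  small : ∀ i < n, W i → (∀ e ∈ X i, c i e = s) ∧ r ≤ (X i).card
  large : ∀ j < n, ¬ W j → ∀ i < n, l ≤ setCost c i (X j)
  tolerant : ∀ i < n, W i → ∀ j < n, ¬ W j →
    setCost c i (X i) - s + l ≤ ((n : ℝ) - 1) * setCost c i (X j)
  light : 2 * (r * s) < l → ∀ i < n,
    (∀ e ∈ X i, setCost c i (X i) - c i e ≤ ((n : ℝ) - 1) * l) ∧
    (W i → setCost c i (X i) - s ≤ ((n : ℝ) - 2) * l)
  free : ∀ e ∈ X n, ∀ i < n, c i e = l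

/-- For `light`, both rs and s are below l / 2, so a poor bundle minus an item costs at most (r + n
- 2) s ≤ (n - 1) l / 2 ≤ (n - 2) l. A rich bundle is a singleton. -/
theorem Ready.split (hI : Separated n m c s l) {r : ℕ} (h : Ready n m c s l r X)
    (hc : ∀ i < n, ¬ Poor n c s X i → (X i).card < 2) :
    SplitInv n m c s l r (Poor n c s X) X := by
  refine ⟨h.subset, h.pos, h.efx, fun i hi hp => ⟨(h.poor i hi hp).1, h.size i hi⟩, ?_, ?_, ?_,
    h.free⟩
  · intro j hj hp i hi
    obtain ⟨e, he, h1⟩ := h.large_of_not_poor hI hi hj hp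
    exact hI.large_le_setCost hi (h.subset j hj.le) he h1
  · exact fun i hi hpi j hj hpj => h.poor_rich hI hi hj hpi hpj
  · intro hr i hi
    have h3 := hI.three_le
    have h4 := hI.pos
    have hP : Poor n c s X i → setCost c i (X i) - s ≤ ((n : ℝ) - 2) * l := fun hp => by
      obtain ⟨h1, h2⟩ := h.poor i hi hp
      have h6 : ((X i).card : ℝ) + 1 ≤ r + n := by exact_mod_cast h2
      rw [setCost_of_small h1]
      have h7 : ((X i).card : ℝ) * s ≤ (r + n - 1) * s :=
        mul_le_mul_of_nonneg_right (by linarith) hI.nonneg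
      nlinarith [hI.two_mul_lt, hI.nonneg]
    refine ⟨fun e he => ?_, hP⟩
    by_cases hp : Poor n c s X i
    · have := hI.sub_cost_le hi (h.subset i hi.le) he
      linarith [hP hp]
    · have h1 : (X i).card = 1 := by
        have := hc i hi hp
        have := Finset.card_pos.2 ⟨e, he⟩
        omega
      obtain ⟨e₀, he₀⟩ := Finset.card_eq_one.1 h1
      rw [he₀, Finset.mem_singleton] at he
      rw [he₀, he]
      simp only [setCost, Finset.sum_singleton, sub_self]
      nlinarith

/-- Towards j in W: c_i(X_i) ≤ c_i(X_j) since X_i is all small and has no more items, and l ≤ 2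
c_i(X_j), so the new cost is at most 3 c_i(X_j). Towards the others `tolerant` was kept for this
moment. It passes on to the remaining members of W, because their earlier fairness towards i gains
(n - 1) l. -/
theorem SplitInv.take (hI : Separated n m c s l) {r i f : ℕ} {W : ℕ → Prop}
    (h : SplitInv n m c s l r W X) (hW : W i)
    (hmin : ∀ j < n, W j → j ≠ i → (X i).card ≤ (X j).card)
    (hge : ∀ j < n, W j → j ≠ i → l ≤ 2 * setCost c i (X j)) (hG : Give n i f X X') :
    SplitInv n m c s l r (fun j => W j ∧ j ≠ i) X' := by
  have hi := hG.lt
  have hsub := hG.subset_range h.subset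
  have h3 := hI.three_le
  have h0 := hI.nonneg
  have hmono : ∀ k < n, ∀ j < n, setCost c k (X j) ≤ setCost c k (X' j) := fun k hk j hj =>
    hI.setCost_mono hk (hG.subset hj) (hsub j hj.le)
  have hgain : ∀ k < n, setCost c k (X' i) = setCost c k (X i) + l := fun k hk => by
    rw [hG.self, setCost_insert hG.notMem, h.free f hG.free k hk]
  obtain ⟨hs, hr⟩ := h.small i hi hW
  refine ⟨hsub, h.pos, ?_, ?_, ?_, ?_, ?_, fun e he => h.free e (hG.rest_subset he)⟩
  · intro k hk
    by_cases hki : k = i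
    · subst hki
      intro j hj hkj e he
      have h1 := hI.sub_cost_le hk (hsub k hk.le) he
      rw [hgain k hk] at h1 ⊢
      rw [zero_mul, add_zero]
      refine h1.trans ?_
      rw [hG.other j hj (Ne.symm hkj)]
      by_cases hWj : W j
      · have h4 := hge j hj hWj (Ne.symm hkj)
        have h5 : ((X k).card : ℝ) ≤ (X j).card := by exact_mod_cast hmin j hj hWj (Ne.symm hkj)
        have h6 := hI.card_mul_le hk (h.subset j hj.le)
        have h7 := setCost_of_small hs
        have h8 := mul_le_mul_of_nonneg_right h5 h0
        have h9 := mul_le_mul_of_nonneg_right h3 (hI.setCost_nonneg hk (h.subset j hj.le))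
        linarith
      · linarith [h.tolerant k hk hW j hj hWj]
    · exact (h.efx k hk).grow hI hk (hG.other k hk hki) (fun j hj => hG.subset hj) hsub
  · rintro k hk ⟨hWk, hki⟩
    rw [hG.other k hk hki]
    exact h.small k hk hWk
  · intro j hj hWj k hk
    by_cases hji : j = i
    · subst hji
      rw [hgain k hk]
      linarith [hI.setCost_nonneg hk (h.subset j hj.le)]
    · exact (h.large j hj (fun hw => hWj ⟨hw, hji⟩) k hk).trans (hmono k hk j hj)
  · rintro k hk ⟨hWk, hki⟩ j hj hWj
    rw [hG.other k hk hki]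
    by_cases hji : j = i
    · subst hji
      rw [hgain k hk]
      obtain ⟨h1, h2⟩ := h.small k hk hWk
      obtain ⟨e, he⟩ := Finset.card_pos.1 (h.pos.trans h2)
      have h4 := h.efx k hk j hj hki e he
      rw [h1 e he, zero_mul, add_zero] at h4
      nlinarith [hI.pos]
    · rw [hG.other j hj hji]
      exact h.tolerant k hk hWk j hj fun hw => hWj ⟨hw, hji⟩
  · intro hrs k hk
    obtain ⟨h1, h2⟩ := h.light hrs k hk
    by_cases hki : k = i
    · subst hki
      refine ⟨fun e he => ?_, fun hw => absurd rfl hw.2⟩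
      have h4 := hI.sub_cost_le hk (hsub k hk.le) he
      rw [hgain k hk] at h4 ⊢
      linarith [h2 hW]
    · rw [hG.other k hk hki]
      exact ⟨h1, fun hw => h2 hw.1⟩

/-- As X_j costs i less than l / 2, all of it is small for i, so i stays in W with a bundle costing
at most l, and at most twice the cost to i of any other bundle in W. Agent j ends with one item, so
it envies nobody. The others now compare themselves with a bundle of cost l, which is what `light`
bounds. -/
theorem SplitInv.merge (hI : Separated n m c s l) {r i j f : ℕ} {W : ℕ → Prop}
    (h : SplitInv n m c s l r W X) (hi : i < n) (hWi : W i) (hWj : W j) (hij : j ≠ i)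
    (hdisj : Disjoint (X i) (X j))
    (hmin : ∀ k < n, W k → (X i).card ≤ (X k).card)
    (hmin' : ∀ k < n, W k → k ≠ i → setCost c i (X j) ≤ setCost c i (X k))
    (hlt : 2 * setCost c i (X j) < l)
    (hi' : X' i = X i ∪ X j) (hj' : X' j = ∅) (hrest : ∀ k ≤ n, k ≠ i → k ≠ j → X' k = X k)
    (hG : Give n j f X' X'') : SplitInv n m c s l r (fun k => W k ∧ k ≠ j) X'' := by
  have hj := hG.lt
  have h3 := hI.three_le
  have h0 := hI.nonneg
  have hl := hI.pos
  have hn' : X' n = X n := hrest n le_rfl hi.ne' hj.ne'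
  have ei : X'' i = X i ∪ X j := by rw [hG.other i hi hij.symm, hi']
  have ej : X'' j = {f} := by rw [hG.self, hj']; rfl
  have ek : ∀ k < n, k ≠ i → k ≠ j → X'' k = X k := fun k hk h1 h2 => by
    rw [hG.other k hk h2, hrest k hk.le h1 h2]
  have hf : ∀ k < n, c k f = l := h.free f (hn' ▸ hG.free)
  have hsub : ∀ k ≤ n, X'' k ⊆ Finset.range m := by
    refine hG.subset_range fun k hk => ?_
    by_cases h1 : k = i
    · rw [h1, hi']
      exact Finset.union_subset (h.subset i hi.le) (h.subset j hj.le)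
    · by_cases h2 : k = j
      · rw [h2, hj']; simp
      · rw [hrest k hk h1 h2]; exact h.subset k hk
  have cj : ∀ k < n, setCost c k (X'' j) = l := fun k hk => by
    rw [ej]; simp [setCost, hf k hk]
  have ci : ∀ k, setCost c k (X'' i) = setCost c k (X i) + setCost c k (X j) := fun k => by
    rw [ei, setCost, Finset.sum_union hdisj]; rfl
  obtain ⟨si, ri⟩ := h.small i hi hWi
  obtain ⟨sj, rj⟩ := h.small j hj hWj
  have hxi := setCost_of_small si
  have hcardj := hI.card_mul_le hi (h.subset j hj.le)
  have hxij : setCost c i (X i) ≤ setCost c i (X j) := by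
    have h5 : ((X i).card : ℝ) ≤ (X j).card := by exact_mod_cast hmin j hj hWj
    nlinarith
  have hxj : ∀ e ∈ X j, c i e = s := fun e he => by
    by_contra hne
    have := hI.large_le_setCost hi (h.subset j hj.le) he
      (hI.eq_large_of_ne hi (Finset.mem_range.1 (h.subset j hj.le he)) hne)
    linarith
  -- X_j has at least r items, hence r s ≤ c_i(X_j). This makes `light` available.
  have hrs : 2 * (r * s) < l := by
    have : (r : ℝ) ≤ (X j).card := by exact_mod_cast rj
    nlinarith
  have hlight := h.light hrs
  have mergeCost : setCost c i (X'' i) ≤ l := by rw [ci]; linarith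
  refine ⟨hsub, h.pos, ?_, ?_, ?_, ?_, ?_, ?_⟩
  · intro k hk
    by_cases hkj : k = j
    · subst hkj
      intro k' hk' hne e he
      rw [ej, Finset.mem_singleton] at he
      rw [cj k hk, he, hf k hk, sub_self, zero_mul, add_zero]
      exact mul_nonneg (by linarith) (hI.setCost_nonneg hk (hsub k' hk'.le))
    · intro k' hk' hne e he
      rw [zero_mul, add_zero]
      by_cases hki : k = i
      · subst hki
        have h5 := hI.sub_cost_le hk (hsub k hk.le) he
        refine h5.trans ?_
        by_cases hk'j : k' = j
        · rw [hk'j, cj k hk]; nlinarith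
        · rw [ek k' hk' (Ne.symm hne) hk'j]
          by_cases hWk' : W k'
          · have h6 := hmin' k' hk' hWk' (Ne.symm hne)
            have h7 := hI.setCost_nonneg hk (h.subset j hj.le)
            rw [ci]
            nlinarith
          · have h6 := h.large k' hk' hWk' k hk
            nlinarith
      · have hself := ek k hk hki hkj
        rw [hself] at he ⊢
        by_cases hk'j : k' = j
        · rw [hk'j, cj k hk]
          exact (hlight k hk).1 e he
        · have h5 := h.efx k hk k' hk' hne e he
          rw [zero_mul, add_zero] at h5
          by_cases hk'i : k' = i
          · subst hk'i
            rw [ci]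
            have := hI.setCost_nonneg hk (h.subset j hj.le)
            nlinarith
          · rw [ek k' hk' hk'i hk'j]
            exact h5
  · rintro k hk ⟨hWk, hkj⟩
    by_cases hki : k = i
    · subst hki
      rw [ei]
      refine ⟨fun e he => ?_, ri.trans (Finset.card_le_card Finset.subset_union_left)⟩
      exact (Finset.mem_union.1 he).elim (si e) (hxj e)
    · rw [ek k hk hki hkj]
      exact h.small k hk hWk
  · intro k hk hWk k' hk'
    by_cases hkj : k = j
    · rw [hkj, cj k' hk']
    · have hWk' : ¬ W k := fun hw => hWk ⟨hw, hkj⟩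
      rw [ek k hk (by rintro rfl; exact hWk' hWi) hkj]
      exact h.large k hk hWk' k' hk'
  · rintro k hk ⟨hWk, hkj⟩ k' hk' hWk'
    by_cases hk'j : k' = j
    · rw [hk'j, cj k hk]
      by_cases hki : k = i
      · subst hki
        nlinarith
      · rw [ek k hk hki hkj]
        have := (hlight k hk).2 hWk
        linarith
    · have hw : ¬ W k' := fun hw => hWk' ⟨hw, hk'j⟩
      rw [ek k' hk' (by rintro rfl; exact hw hWi) hk'j]
      by_cases hki : k = i
      · subst hki
        have h6 := h.large k' hk' hw k hk
        nlinarith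
      · rw [ek k hk hki hkj]
        exact h.tolerant k hk hWk k' hk' hw
  · intro _ k hk
    by_cases hkj : k = j
    · subst hkj
      refine ⟨fun e he => ?_, fun hw => absurd rfl hw.2⟩
      rw [ej, Finset.mem_singleton] at he
      rw [cj k hk, he, hf k hk]
      nlinarith
    · by_cases hki : k = i
      · subst hki
        refine ⟨fun e he => ?_, fun _ => by nlinarith⟩
        have := hI.sub_cost_le hk (hsub k hk.le) he
        nlinarith
      · rw [ek k hk hki hkj]
        exact ⟨(hlight k hk).1, fun hw => (hlight k hk).2 hw.1⟩
  · intro e he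
    exact h.free e (hn' ▸ hG.rest_subset he)

end Split

/-! ### The picking procedure

Arrays of natural numbers: `1` owners of items (`n`: free), `2` the relation `Hits`, `3` the numbers
`avail`, `4` pointers to the first candidate. -/

/-- The memories `σ` and `σ'` agree except for the natural number arrays in `A`. -/
def SameExcept (A : List ℕ) (σ σ' : Store) : Prop :=
  σ'.real = σ.real ∧ ∀ a, a ∉ A → σ'.nat a = σ.nat a

namespace SameExcept

variable {A A' : List ℕ} {σ σ' σ'' : Store}

theorem refl : SameExcept A σ σ := ⟨rfl, fun _ _ => rfl⟩

theorem trans (h : SameExcept A σ σ') (h' : SameExcept A σ' σ'') : SameExcept A σ σ'' :=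
  ⟨h'.1.trans h.1, fun a ha => (h'.2 a ha).trans (h.2 a ha)⟩

theorem mono (h : SameExcept A σ σ') (hA : A ⊆ A') : SameExcept A' σ σ' :=
  ⟨h.1, fun a ha => h.2 a fun ha' => ha (hA ha')⟩

theorem write (h : SameExcept A σ σ') {a i j v : ℕ} (ha : a ∈ A) :
    SameExcept A σ (σ'.writeNat a i j v) :=
  ⟨h.1, fun a' ha' => by
    rw [Store.nat_writeNat_of_ne (by rintro rfl; exact ha' ha)]
    exact h.2 a' ha'⟩

end SameExcept

/-- The bundle of `j` under the owner function `o`. -/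
def bundle (m : ℕ) (o : ℕ → ℕ) (j : ℕ) : Finset ℕ := (Finset.range m).filter fun e => o e = j

/-- The partial allocation recorded in the memory. -/
abbrev bundles (m : ℕ) (σ : Store) : ℕ → Finset ℕ := bundle m (σ.nat 1 0)

theorem mem_bundle {m j e : ℕ} {o : ℕ → ℕ} : e ∈ bundle m o j ↔ e < m ∧ o e = j := by
  simp [bundle]

theorem bundle_subset {m j : ℕ} {o : ℕ → ℕ} : bundle m o j ⊆ Finset.range m :=
  Finset.filter_subset _ _

/-- Links a single write into the owner array with the abstract operation `Give`. -/
theorem give_update {n m i f : ℕ} {o o' : ℕ → ℕ} (hi : i < n) (hf : f < m) (ho : o f = n)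
    (h : ∀ e, o' e = if e = f then i else o e) : Give n i f (bundle m o) (bundle m o') := by
  refine ⟨hi, mem_bundle.2 ⟨hf, ho⟩, fun hm => ?_, ?_, ?_, ?_⟩
  · have := (mem_bundle.1 hm).2; omega
  · ext e
    simp only [mem_bundle, Finset.mem_insert, h]
    by_cases he : e = f
    · simp [he, hf]
    · simp [he]
  · ext e
    simp only [mem_bundle, Finset.mem_erase, h]
    by_cases he : e = f
    · simp [he, hi.ne]
    · simp [he]
  · intro j hj hji
    ext e
    simp only [mem_bundle, h]
    by_cases he : e = f
    · subst he
      simp only [if_true]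
      constructor
      · rintro ⟨-, h1⟩; exact absurd h1.symm hji
      · rintro ⟨-, h1⟩; omega
    · simp [he]

/-- The data structure used by the picking procedure. -/
structure State (n m : ℕ) (c : ℕ → ℕ → ℝ) (s : ℝ) (σ : Store) : Prop where
  agents : σ.nat 0 0 0 = n
  items : σ.nat 0 0 1 = m
  owner_le : ∀ e < m, σ.nat 1 0 e ≤ n
  hits : ∀ v < n + 2, ∀ e < m, 1 ≤ σ.nat 2 v e ↔ Hits n c s v e
  count : ∀ v < n + 2, σ.nat 3 v 0 = avail n c s (bundles m σ) v
  ptr : ∀ v < n + 2, σ.nat 4 v 0 ≤ m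
  passed : ∀ v < n + 2, ∀ e < σ.nat 4 v 0, σ.nat 1 0 e = n → ¬ Hits n c s v e

/-- The potential that pays for picks. -/
def potential (n m : ℕ) (σ : Store) : ℕ :=
  n * (bundles m σ n).card + ∑ v ∈ Finset.range (n + 2), (m - σ.nat 4 v 0)

abbrev numAgents : NatExpr := .cell 0 (.const 0) (.const 0)

abbrev numItems : NatExpr := .cell 0 (.const 0) (.const 1)

/-- Scalar `11` becomes the preference of agent `10`. -/
def chooseTarget : Program :=
  .seq (assign 11 (scalar 10))
    (.seq (.ite (.natLe (.cell 3 (scalar 11) (.const 0)) (.const 0)) (assign 11 numAgents) .skip)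
      (.ite (.natLe (.cell 3 (scalar 11) (.const 0)) (.const 0)) (assign 11 (.succ numAgents))
        .skip))

/-- Scalar `12` becomes the first free item hit by scalar `11`. -/
def scan : Program :=
  .seq (assign 12 (.cell 4 (scalar 11) (.const 0)))
    (.while (.not (.and (.natLe numAgents (.cell 1 (.const 0) (scalar 12)))
        (.natLe (.const 1) (.cell 2 (scalar 11) (scalar 12)))))
      (assign 12 (.succ (scalar 12))))

/-- Item `12` is handed over to agent `10`. -/
def handOver : Program :=
  .seq (.setNat 4 (scalar 11) (.const 0) (scalar 12))
    (.seq (.setNat 1 (.const 0) (scalar 12) (scalar 10))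
      (forLoop 13 (.succ (.succ numAgents))
        (.ite (.natLe (.const 1) (.cell 2 (scalar 13) (scalar 12)))
          (.setNat 3 (scalar 13) (.const 0) (.pred (.cell 3 (scalar 13) (.const 0)))) .skip)))

/-- Agent `10` picks an item. -/
def pick : Program := .seq chooseTarget (.seq scan handOver)

/-- The arrays changed by `pick`. -/
abbrev pickArrays : List ℕ := [1, 3, 4, 11, 12, 13]

/-! ### Amortised cost of one pick -/

section Pick

variable {n m : ℕ} {c : ℕ → ℕ → ℝ} {s : ℝ} {σ : Store}

theorem State.congr {A : List ℕ} {σ' : Store} (h : State n m c s σ) (hA : SameExcept A σ σ')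
    (h0 : 0 ∉ A := by simp) (h1 : 1 ∉ A := by simp) (h2 : 2 ∉ A := by simp)
    (h3 : 3 ∉ A := by simp) (h4 : 4 ∉ A := by simp) : State n m c s σ' := by
  have e0 := hA.2 0 h0
  have e1 := hA.2 1 h1
  have e2 := hA.2 2 h2
  have e3 := hA.2 3 h3
  have e4 := hA.2 4 h4
  constructor <;> simp only [bundles, e0, e1, e2, e3, e4]
  exacts [h.agents, h.items, h.owner_le, h.hits, h.count, h.ptr, h.passed]

/-- The counters i, n and n + 1 are tested in order of preference. The chosen one is positive, so
the subsequent scan must succeed. -/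
theorem runs_chooseTarget (hσ : State n m c s σ) {i : ℕ} (hi : i < n) (h10 : σ.nat 10 0 0 = i)
    (hfree : 0 < avail n c s (bundles m σ) (n + 1)) :
    Runs chooseTarget σ 40 fun σ' _ => SameExcept [11] σ σ' ∧ ∃ v < n + 2, σ'.nat 11 0 0 = v ∧
      0 < avail n c s (bundles m σ) v ∧
      ∀ f, Hits n c s v f → Prefers n c s (bundles m σ) i f := by
  have hn := hσ.agents
  have c1 := hσ.count i (by omega)
  have c2 := hσ.count n (by omega)
  refine Runs.seq (Runs.setNat (by simp [NatExpr.cost]) ?_)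
  simp only [NatExpr.eval, NatExpr.cost, h10]
  have same : SameExcept [11] σ (σ.writeNat 11 0 0 i) := SameExcept.refl.write (by simp)
  refine Runs.seq (Runs.ite (by simp [NatExpr.cost, Test.cost]) ?_ ?_)
  · intro hT
    simp [Test.Holds, NatExpr.eval, c1] at hT
    refine Runs.setNat (by simp [NatExpr.cost, Test.cost]) ?_
    simp only [NatExpr.eval, NatExpr.cost, Test.cost]
    refine Runs.ite (by simp [NatExpr.cost, Test.cost]) ?_ ?_
    · intro hT2
      simp [Test.Holds, NatExpr.eval, hn, c2] at hT2
      refine Runs.setNat (by simp [NatExpr.cost, Test.cost]) ⟨?_, ?_⟩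
      · exact ((same.write (by simp)).write (by simp))
      · simp only [NatExpr.eval]
        exact ⟨n + 1, by omega, by simp [hn], hfree, fun f _ => Or.inr ⟨hT, Or.inr hT2⟩⟩
    · intro hT2
      simp [Test.Holds, NatExpr.eval, hn, c2] at hT2
      refine Runs.skip (by simp [NatExpr.cost, Test.cost]) ⟨?_, ?_⟩
      · exact same.write (by simp)
      · exact ⟨n, by omega, by simp [hn], by omega, fun f hf => Or.inr ⟨hT, Or.inl hf⟩⟩
  · intro hT
    simp [Test.Holds, NatExpr.eval, c1] at hT
    refine Runs.skip (by simp [NatExpr.cost, Test.cost]) ?_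
    refine Runs.ite (by simp [NatExpr.cost, Test.cost]) ?_ ?_
    · intro hT2
      simp [Test.Holds, NatExpr.eval, c1] at hT2
      omega
    · intro _
      refine Runs.skip (by simp [NatExpr.cost, Test.cost]) ⟨same, ?_⟩
      exact ⟨i, by omega, by simp, by omega, fun f hf => Or.inl hf⟩

/-- Items before the pointer are no candidates by `passed`, so the search resumes there, and its
cost is proportional to the advance. -/
theorem runs_scan (hσ : State n m c s σ) {v b : ℕ} (hv : v < n + 2) (h11 : σ.nat 11 0 0 = v)
    (hfree : 0 < avail n c s (bundles m σ) v) (hb : 30 * (m - σ.nat 4 v 0) + 40 ≤ b) :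
    Runs scan σ b fun σ' b' => SameExcept [12] σ σ' ∧ ∃ f < m, σ'.nat 12 0 0 = f ∧
      σ.nat 4 v 0 ≤ f ∧ σ.nat 1 0 f = n ∧ Hits n c s v f ∧
      (∀ e < f, σ.nat 1 0 e = n → ¬ Hits n c s v e) ∧ b ≤ b' + 30 * (f - σ.nat 4 v 0) + 40 := by
  obtain ⟨e₀, he₀, hh₀⟩ := avail_pos_iff.1 hfree
  obtain ⟨he₀m, ho₀⟩ := mem_bundle.1 he₀
  refine Runs.seq (Runs.setNat (by simp [NatExpr.cost]; omega) ?_)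
  simp only [NatExpr.eval, NatExpr.cost, h11]
  refine Runs.while_loop (I := fun σ₁ b₁ => SameExcept [12] σ σ₁ ∧ ∃ f, σ₁.nat 12 0 0 = f ∧
      σ.nat 4 v 0 ≤ f ∧ (∀ e < f, σ.nat 1 0 e = n → ¬ Hits n c s v e) ∧
      b ≤ b₁ + 30 * (f - σ.nat 4 v 0) + 9) ?_ ?_ ?_
  · rintro σ₁ b₁ ⟨hs, f, h12, hle, hpass, hb₁⟩ hT
    -- The scan cannot overrun: the candidate `e₀` would have been passed.
    have hf : f < m := by
      by_contra hcon
      exact hpass e₀ (by omega) ho₀ hh₀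
    have hno : ¬ (σ.nat 1 0 f = n ∧ Hits n c s v f) := by
      rintro ⟨h1, h2⟩
      apply hT
      simp only [Test.Holds, NatExpr.eval, h12, hs.2 0 (by simp), hs.2 1 (by simp),
        hs.2 2 (by simp), hs.2 11 (by simp), h11]
      exact ⟨by rw [hσ.agents, h1], (hσ.hits v hv f hf).2 h2⟩
    have hp := hσ.ptr v hv
    refine ⟨by simp [NatExpr.cost, Test.cost]; omega, ?_⟩
    refine Runs.setNat (by simp [NatExpr.cost, Test.cost]; omega) ⟨hs.write (by simp), f + 1, ?_⟩
    refine ⟨by simp [NatExpr.eval, h12], by omega, ?_, by simp [NatExpr.cost, Test.cost]; omega⟩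
    intro e he ho hh
    rcases (Nat.lt_succ_iff.1 he).lt_or_eq with h | rfl
    · exact hpass e h ho hh
    · exact hno ⟨ho, hh⟩
  · rintro σ₁ b₁ ⟨hs, f, h12, hle, hpass, hb₁⟩ hT
    have hf : f < m := by
      by_contra hcon
      exact hpass e₀ (by omega) ho₀ hh₀
    simp only [Test.Holds, NatExpr.eval, h12, hs.2 0 (by simp), hs.2 1 (by simp),
        hs.2 2 (by simp), hs.2 11 (by simp), h11, not_not, hσ.agents] at hT
    refine ⟨by simp [NatExpr.cost, Test.cost]; omega, hs, f, hf, h12, hle, ?_, ?_, hpass, ?_⟩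
    · have := hσ.owner_le f hf
      omega
    · exact (hσ.hits v hv f hf).1 hT.2
    · simp [NatExpr.cost, Test.cost]; omega
  · refine ⟨SameExcept.refl.write (by simp), σ.nat 4 v 0, by simp, le_rfl, hσ.passed v hv, ?_⟩
    omega

theorem sum_pointer_lt {N v f m : ℕ} {p p' : ℕ → ℕ} (hv : v < N) (hf : f ≤ m) (hle : p v ≤ f)
    (h : ∀ u, p' u = if u = v then f else p u) :
    ∑ u ∈ Finset.range N, (m - p' u) + (f - p v) = ∑ u ∈ Finset.range N, (m - p u) := by
  have hv' : v ∈ Finset.range N := Finset.mem_range.2 hv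
  rw [← Finset.add_sum_erase _ _ hv', ← Finset.add_sum_erase (Finset.range N) (fun u => m - p u) hv']
  have : ∑ u ∈ (Finset.range N).erase v, (m - p' u) = ∑ u ∈ (Finset.range N).erase v, (m - p u) :=
    Finset.sum_congr rfl fun u hu => by rw [h, if_neg (Finset.ne_of_mem_erase hu)]
  rw [this, h, if_pos rfl]
  omega

/-- One free item fewer lowers the potential by n, which pays for updating the n + 2 counters; the
moved pointer lowers it by its advance. -/
theorem runs_handOver (hσ : State n m c s σ) {i v f : ℕ} (hi : i < n) (h10 : σ.nat 10 0 0 = i)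
    (hv : v < n + 2) (h11 : σ.nat 11 0 0 = v) (hf : f < m) (h12 : σ.nat 12 0 0 = f)
    (hle : σ.nat 4 v 0 ≤ f) (hown : σ.nat 1 0 f = n)
    (hpass : ∀ e < f, σ.nat 1 0 e = n → ¬ Hits n c s v e) :
    Runs handOver σ (45 * (n + 2) + 40) fun σ' _ => SameExcept [1, 3, 4, 13] σ σ' ∧
      State n m c s σ' ∧ Give n i f (bundles m σ) (bundles m σ') ∧
      potential n m σ' + n + (f - σ.nat 4 v 0) = potential n m σ := by
  refine Runs.seq (Runs.setNat (by simp [NatExpr.cost]) ?_)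
  simp only [NatExpr.eval, NatExpr.cost, h11, h12]
  refine Runs.seq (Runs.setNat (by simp [NatExpr.cost]) ?_)
  simp only [NatExpr.eval, NatExpr.cost]
  set σ₁ := (σ.writeNat 4 v 0 f) with hσ₁
  have e12 : σ₁.nat 12 0 0 = f := by simp [hσ₁, h12]
  have e10 : σ₁.nat 10 0 0 = i := by simp [hσ₁, h10]
  rw [e12, e10]
  set σ₂ := σ₁.writeNat 1 0 f i with hσ₂
  have same : SameExcept [1, 3, 4, 13] σ σ₂ := (SameExcept.refl.write (by simp)).write (by simp)
  have own : ∀ e, σ₂.nat 1 0 e = if e = f then i else σ.nat 1 0 e := fun e => by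
    simp [hσ₂, hσ₁]
  have ptr : ∀ u, σ₂.nat 4 u 0 = if u = v then f else σ.nat 4 u 0 := fun u => by
    simp [hσ₂, hσ₁]
  have cnt : σ₂.nat 3 = σ.nat 3 := by simp [hσ₂, hσ₁]
  have hG : Give n i f (bundles m σ) (bundles m σ₂) := give_update hi hf hown own
  have hpot := sum_pointer_lt (N := n + 2) (m := m) (p := fun u => σ.nat 4 u 0)
    (p' := fun u => σ₂.nat 4 u 0) hv hf.le hle ptr
  have hcard : (bundles m σ₂ n).card + 1 = (bundles m σ n).card := by
    rw [hG.rest]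
    exact Finset.card_erase_add_one hG.free
  -- The loop bound costs 5 steps to evaluate: 18 = 5 + 13 and 15 = 5 + 10.
  refine Runs.frame (C := (n + 2) * (25 + 18) + 15) ?_ (by omega) (fun _ => id)
  refine Runs.mono (Runs.for_loop_const (N := n + 2) (C := 25)
    (J := fun j σ₃ => SameExcept [3, 13] σ₂ σ₃ ∧ ∀ u < n + 2, σ₃.nat 3 u 0 =
      if u < j then avail n c s (bundles m σ₂) u else σ.nat 3 u 0) (P := _) ?_ ?_ ?_ ?_)
    (fun _ _ => id)
  · refine ⟨SameExcept.refl.write (by simp), fun u _ => by simp [cnt]⟩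
  · rintro j σ₃ ⟨h1, -⟩
    simp only [NatExpr.eval, h1.2 0 (by simp), same.2 0 (by simp), hσ.agents]
  · rintro j σ₃ hj h13 ⟨h1, h2⟩
    have g2 : σ₃.nat 2 = σ.nat 2 := (h1.2 2 (by simp)).trans (same.2 2 (by simp))
    have g12 : σ₃.nat 12 0 0 = f := by rw [h1.2 12 (by simp), same.2 12 (by simp), h12]
    have hcj := h2 j hj
    rw [if_neg (lt_irrefl j), hσ.count j hj] at hcj
    refine Runs.ite (by simp [NatExpr.cost, Test.cost]) ?_ ?_
    · intro hT
      simp only [Test.Holds, NatExpr.eval, h13, g2, g12] at hT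
      have hav := hG.avail_add_one ((hσ.hits j hj f hf).1 hT)
      refine Runs.setNat (by simp [NatExpr.cost, Test.cost]) ⟨by simp [h13],
        (h1.write (by simp)).write (by simp), ?_⟩
      intro u hu
      simp only [NatExpr.eval, h13, hcj]
      rw [Store.nat_writeNat_of_ne (by simp)]
      simp only [Store.nat_writeNat_same, and_true]
      by_cases huj : u = j
      · subst huj; simp; omega
      · rw [if_neg huj, h2 u hu]
        have : u < j ↔ u < j + 1 := by omega
        simp only [this]
    · intro hT
      simp only [Test.Holds, NatExpr.eval, h13, g2, g12] at hT
      have hav := hG.avail_eq (mt (hσ.hits j hj f hf).2 hT)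
      refine Runs.skip (by simp [NatExpr.cost, Test.cost]) ⟨h13, h1.write (by simp), ?_⟩
      intro u hu
      rw [Store.nat_writeNat_of_ne (by simp)]
      by_cases huj : u = j
      · subst huj; simp [hcj, hav]
      · rw [h2 u hu]
        have : u < j ↔ u < j + 1 := by omega
        simp only [this]
  · rintro σ₃ ⟨h1, h2⟩
    have b3 : bundles m σ₃ = bundles m σ₂ := by simp only [bundles, h1.2 1 (by simp)]
    refine ⟨same.trans (h1.mono (by simp)), ⟨?_, ?_, ?_, ?_, ?_, ?_, ?_⟩, b3 ▸ hG, ?_⟩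
    · rw [h1.2 0 (by simp), same.2 0 (by simp), hσ.agents]
    · rw [h1.2 0 (by simp), same.2 0 (by simp), hσ.items]
    · intro e he
      rw [h1.2 1 (by simp), own]
      split_ifs
      · exact hi.le
      · exact hσ.owner_le e he
    · intro u hu e he
      rw [h1.2 2 (by simp), same.2 2 (by simp)]
      exact hσ.hits u hu e he
    · intro u hu
      rw [h2 u hu, if_pos hu, b3]
    · intro u hu
      rw [h1.2 4 (by simp), ptr]
      split_ifs
      · exact hf.le
      · exact hσ.ptr u hu
    · intro u hu e
      rw [h1.2 4 (by simp), h1.2 1 (by simp), ptr, own]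
      intro he ho
      by_cases hef : e = f
      · rw [if_pos hef] at ho; omega
      · rw [if_neg hef] at ho
        by_cases huv : u = v
        · rw [if_pos huv] at he
          subst huv
          exact hpass e he ho
        · rw [if_neg huv] at he
          exact hσ.passed u hu e he ho
    · rw [potential, potential, b3, h1.2 4 (by simp), ← hpot, ← hcard]
      ring

/-- Every pick is paid for by the potential, with `100 * n` steps to spare. -/
theorem runs_pick (hn : 4 ≤ n) (hσ : State n m c s σ) {i b x : ℕ} (hi : i < n)
    (h10 : σ.nat 10 0 0 = i) (hfree : 0 < avail n c s (bundles m σ) (n + 1))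
    (hb : 200 * potential n m σ + x ≤ b) :
    Runs pick σ b fun σ' b' => SameExcept pickArrays σ σ' ∧ State n m c s σ' ∧
      200 * potential n m σ' + 100 * n + x ≤ b' ∧
      ∃ f, Give n i f (bundles m σ) (bundles m σ') ∧ Prefers n c s (bundles m σ) i f := by
  -- Since an item is free, the potential holds enough credit for the pick in advance.
  have hbig : n * 1 + ∑ v ∈ Finset.range (n + 2), (m - σ.nat 4 v 0) ≤ potential n m σ := by
    rw [avail_all] at hfree
    exact Nat.add_le_add_right (Nat.mul_le_mul_left n hfree) _
  refine Runs.seq (Runs.frame (runs_chooseTarget hσ hi h10 hfree) (by omega) ?_)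
  rintro σ₁ ⟨s1, v, hv, h11, hav, hpref⟩
  have hσ₁ := hσ.congr s1
  have b1 : bundles m σ₁ = bundles m σ := by simp only [bundles, s1.2 1 (by simp)]
  have p1 : σ₁.nat 4 = σ.nat 4 := s1.2 4 (by simp)
  have hterm : m - σ.nat 4 v 0 ≤ ∑ v ∈ Finset.range (n + 2), (m - σ.nat 4 v 0) :=
    Finset.single_le_sum (f := fun v => m - σ.nat 4 v 0) (fun _ _ => Nat.zero_le _)
      (Finset.mem_range.2 hv)
  refine Runs.seq (Runs.mono (runs_scan hσ₁ hv h11 (b1 ▸ hav) (by rw [p1]; omega)) ?_)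
  rintro σ₂ b₂ ⟨s2, f, hf, h12, hle, hown, hh, hpass, hb₂⟩
  have hσ₂ := hσ₁.congr s2
  have o2 : σ₂.nat 1 = σ₁.nat 1 := s2.2 1 (by simp)
  have b2 : bundles m σ₂ = bundles m σ := by simp only [bundles, o2, s1.2 1 (by simp)]
  have p2 : σ₂.nat 4 = σ.nat 4 := (s2.2 4 (by simp)).trans p1
  have pot2 : potential n m σ₂ = potential n m σ := by rw [potential, potential, b2, p2]
  have hR := runs_handOver hσ₂ hi (by rw [s2.2 10 (by simp), s1.2 10 (by simp), h10]) hv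
    (by rw [s2.2 11 (by simp), h11]) hf h12 (by rw [p2, ← p1]; exact hle) (o2 ▸ hown)
    (o2 ▸ hpass)
  have hptr := hσ.ptr v hv
  rw [p1] at hb₂ hle
  refine Runs.frame hR (by omega) ?_
  rintro σ₃ ⟨s3, hσ₃, hG, hpot⟩
  rw [b2] at hG
  rw [pot2, p2] at hpot
  refine ⟨((s1.mono (by simp)).trans (s2.mono (by simp))).trans (s3.mono (by simp)), hσ₃, ?_,
    f, hG, hpref f hh⟩
  omega

end Pick

/-! ### The main loop -/

/-- Agents `0, 1, …` pick one item each. -/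
def pickRound : Program := forLoop 10 numAgents pick

/-- Agent `10` takes all free items that are small for it. -/
def takeSmall : Program := .while (.natLe (.const 1) (.cell 3 (scalar 10) (.const 0))) pick

/-- Scalar `14` becomes an agent for which few free items are small, if there is one. -/
def findTaker : Program :=
  .seq (assign 14 numAgents) (forLoop 15 numAgents
    (.ite (.and (.natLe (.const 1) (.cell 3 (scalar 15) (.const 0)))
        (.natLe (.succ (.cell 3 (scalar 15) (.const 0))) numAgents))
      (assign 14 (scalar 15)) .skip))

/-- A round of picks is run only when no agent has between 1 and n - 1 small free items, as
`MainInv.pass` requires. -/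
def mainLoop : Program :=
  .while (.natLe numAgents (.cell 3 (.succ numAgents) (.const 0)))
    (.seq findTaker (.ite (.natLe (.succ (scalar 14)) numAgents)
      (.seq (assign 10 (scalar 14)) takeSmall) pickRound))

/-- Only items that are large for everybody remain free. -/
def mainPhase : Program :=
  .seq pickRound (.seq mainLoop (forLoop 10 numAgents takeSmall))

abbrev mainArrays : List ℕ := [1, 3, 4, 10, 11, 12, 13, 14, 15]

/-! ### Correctness and cost of the main phase -/

section Main

variable {n m : ℕ} {c : ℕ → ℕ → ℝ} {s l : ℝ} {σ : Store}

/-- Each pick leaves 100 n spare steps; keeping 90 of them per pick yields 90 n for the round. -/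
theorem runs_pickRound (hn : 4 ≤ n) (hσ : State n m c s σ) {b x : ℕ}
    (hfree : n ≤ avail n c s (bundles m σ) (n + 1)) (hb : 200 * potential n m σ + x + 30 ≤ b) :
    Runs pickRound σ b fun σ' b' => SameExcept mainArrays σ σ' ∧ State n m c s σ' ∧
      200 * potential n m σ' + 90 * n + x ≤ b' ∧ Picked n m c s (bundles m σ) n (bundles m σ') := by
  refine Runs.for_loop (N := n) (I := fun i σ₁ b₁ => SameExcept mainArrays σ σ₁ ∧
    State n m c s σ₁ ∧ 200 * potential n m σ₁ + 90 * i + x + 26 ≤ b₁ ∧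
    Picked n m c s (bundles m σ) i (bundles m σ₁)) (by omega) ?_ ?_ ?_ ?_
  · have same : SameExcept [10] σ (σ.writeNat 10 0 0 0) := SameExcept.refl.write (by simp)
    have b1 : bundles m (σ.writeNat 10 0 0 0) = bundles m σ := by simp [bundles]
    refine ⟨same.mono (by simp), hσ.congr same, ?_, ?_⟩
    · simp only [potential, b1, same.2 4 (by simp)] at hb ⊢; omega
    · rw [b1]; exact Picked.zero fun j _ => bundle_subset
  · exact fun i σ₁ b₁ h => by simp only [NatExpr.eval, h.2.1.agents]
  · rintro i σ₁ b₁ hi h10 ⟨h1, h2, h3, h4⟩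
    have hav : 0 < avail n c s (bundles m σ₁) (n + 1) := by
      have := h4.2.2.2.2 (n + 1)
      omega
    refine ⟨by simp [NatExpr.cost]; omega, ?_⟩
    refine Runs.mono (runs_pick (x := 90 * i + x + 10) hn h2 hi h10 hav
      (by simp [NatExpr.cost]; omega)) ?_
    rintro σ₂ b₂ ⟨g1, g2, g3, f, g4, g5⟩
    have same : SameExcept [10] σ₂ (σ₂.writeNat 10 0 0 (i + 1)) :=
      SameExcept.refl.write (by simp)
    have b2 : bundles m (σ₂.writeNat 10 0 0 (i + 1)) = bundles m σ₂ := by simp [bundles]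
    refine ⟨by rw [g1.2 10 (by simp), h10],
      (h1.trans (g1.mono (by simp))).trans (same.mono (by simp)), g2.congr same, ?_, ?_⟩
    · simp only [potential, b2, same.2 4 (by simp)] at g3 ⊢; omega
    · rw [b2]; exact h4.succ g4 g5
  · rintro σ₁ b₁ - ⟨h1, h2, h3, h4⟩
    simp only [NatExpr.cost]
    exact ⟨by omega, h1, h2, by omega, h4⟩

theorem runs_takeSmall (hI : Separated n m c s l) (hσ : State n m c s σ) {r i b x : ℕ}
    (hi : i < n) (h10 : σ.nat 10 0 0 = i) (hM : MainInv n m c s l r n (bundles m σ))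
    (hlt : avail n c s (bundles m σ) i < n) (hb : 200 * potential n m σ + x + 16 ≤ b) :
    Runs takeSmall σ b fun σ' b' => SameExcept pickArrays σ σ' ∧ State n m c s σ' ∧
      MainInv n m c s l r n (bundles m σ') ∧ avail n c s (bundles m σ') i = 0 ∧
      bundles m σ' n ⊆ bundles m σ n ∧ 200 * potential n m σ' + x ≤ b' ∧
      (0 < avail n c s (bundles m σ) i → 200 * potential n m σ' + 90 * n + x ≤ b') := by
  have hn := hI.four_le
  -- Agent i counts as taking exactly as long as it has small free items. The last disjunction
  -- records that the surplus of 90 n is earned by the first pick.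
  refine Runs.while_loop (I := fun σ₁ b₁ => SameExcept pickArrays σ σ₁ ∧ State n m c s σ₁ ∧
    MainInv n m c s l r (if avail n c s (bundles m σ₁) i = 0 then n else i) (bundles m σ₁) ∧
    bundles m σ₁ n ⊆ bundles m σ n ∧ 200 * potential n m σ₁ + x + 16 ≤ b₁ ∧
    (bundles m σ₁ = bundles m σ ∨ 200 * potential n m σ₁ + x + 16 + 90 * n ≤ b₁)) ?_ ?_ ?_
  · rintro σ₁ b₁ ⟨h1, h2, h3, h4, h5, -⟩ hT
    have h10' : σ₁.nat 10 0 0 = i := by rw [h1.2 10 (by simp), h10]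
    simp only [Test.Holds, NatExpr.eval, h10', h2.count i (by omega)] at hT
    rw [if_neg (by omega)] at h3
    refine ⟨by simp [Test.cost, NatExpr.cost]; omega, ?_⟩
    have hle := avail_le_all (n := n) (c := c) (s := s) (X := bundles m σ₁) (v := i)
    refine Runs.mono (runs_pick (x := x + 8) hn h2 hi h10' (by omega)
      (by simp [Test.cost, NatExpr.cost]; omega)) ?_
    rintro σ₂ b₂ ⟨g1, g2, g3, f, g4, g5⟩
    have hf : c i f = s := by
      rcases g5 with g5 | g5
      · exact (hits_agent hi).1 g5
      · omega
    have hM' := h3.give hI g4 hf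
    refine ⟨h1.trans g1, g2, ?_, g4.rest_subset.trans h4, by omega, Or.inr (by omega)⟩
    split_ifs with h0
    · exact hM'.release h0
    · exact hM'
  · rintro σ₁ b₁ ⟨h1, h2, h3, h4, h5, h6⟩ hT
    have h10' : σ₁.nat 10 0 0 = i := by rw [h1.2 10 (by simp), h10]
    simp only [Test.Holds, NatExpr.eval, h10', h2.count i (by omega)] at hT
    have h0 : avail n c s (bundles m σ₁) i = 0 := by omega
    rw [if_pos h0] at h3
    refine ⟨by simp [Test.cost, NatExpr.cost]; omega, h1, h2, h3, h0, h4,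
      by simp [Test.cost, NatExpr.cost]; omega, fun hp => ?_⟩
    rcases h6 with h6 | h6
    · rw [h6] at h0; omega
    · simp [Test.cost, NatExpr.cost]; omega
  · refine ⟨SameExcept.refl, hσ, ?_, subset_rfl, hb, Or.inl rfl⟩
    split_ifs with h0
    · exact hM
    · exact hM.seize hi (by omega) hlt

theorem runs_findTaker (hσ : State n m c s σ) :
    Runs findTaker σ (45 * n + 30) fun σ' _ => SameExcept [14, 15] σ σ' ∧
      ∃ j ≤ n, σ'.nat 14 0 0 = j ∧
        (j < n → 0 < avail n c s (bundles m σ) j ∧ avail n c s (bundles m σ) j < n) ∧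
        (j = n → ∀ i < n, avail n c s (bundles m σ) i = 0 ∨ n ≤ avail n c s (bundles m σ) i) := by
  refine Runs.seq (Runs.setNat (by simp [NatExpr.cost]) ?_)
  simp only [NatExpr.eval, NatExpr.cost, hσ.agents]
  refine Runs.frame (C := n * (28 + 16) + 13) ?_ (by omega) (fun _ => id)
  refine Runs.for_loop_const (N := n) (C := 28)
    (J := fun k σ₁ => SameExcept [14, 15] σ σ₁ ∧
      ∃ j ≤ n, σ₁.nat 14 0 0 = j ∧
        (j < n → 0 < avail n c s (bundles m σ) j ∧ avail n c s (bundles m σ) j < n) ∧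
        (j = n → ∀ i < k, avail n c s (bundles m σ) i = 0 ∨ n ≤ avail n c s (bundles m σ) i))
    ?_ ?_ ?_ (fun _ => id)
  · exact ⟨(SameExcept.refl.write (by simp)).write (by simp), n, le_rfl, by simp, by simp, by simp⟩
  · exact fun k σ₁ h => by simp only [NatExpr.eval, h.1.2 0 (by simp), hσ.agents]
  · rintro k σ₁ hk h15 ⟨h1, j, hj, h14, h2, h3⟩
    have e3 := hσ.count k (by omega)
    refine Runs.ite (by simp [NatExpr.cost, Test.cost]) ?_ ?_
    · intro hT
      simp only [Test.Holds, NatExpr.eval, h15, h1.2 3 (by simp), h1.2 0 (by simp), e3,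
        hσ.agents] at hT
      refine Runs.setNat (by simp [NatExpr.cost, Test.cost]) ⟨by simp [h15],
        (h1.write (by simp)).write (by simp), k, hk.le, by simp [NatExpr.eval, h15], ?_, ?_⟩
      · exact fun _ => ⟨by omega, by omega⟩
      · omega
    · intro hT
      simp only [Test.Holds, NatExpr.eval, h15, h1.2 3 (by simp), h1.2 0 (by simp), e3,
        hσ.agents] at hT
      refine Runs.skip (by simp [NatExpr.cost, Test.cost]) ⟨h15,
        h1.write (by simp), j, hj, by simp [h14], h2, ?_⟩
      intro hjn i hi
      rcases (Nat.lt_succ_iff.1 hi).lt_or_eq with hi | rfl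
      · exact h3 hjn i hi
      · omega

theorem runs_mainLoop (hI : Separated n m c s l) (hσ : State n m c s σ) {r b x : ℕ}
    (hM : MainInv n m c s l r n (bundles m σ))
    (hb : 200 * potential n m σ + 80 * n + x + 11 ≤ b) :
    Runs mainLoop σ b fun σ' b' => SameExcept mainArrays σ σ' ∧ State n m c s σ' ∧
      (∃ r', MainInv n m c s l r' n (bundles m σ')) ∧
      avail n c s (bundles m σ') (n + 1) < n ∧ 200 * potential n m σ' + x ≤ b' := by
  have hn := hI.four_le
  -- The reserve 80 n pays for the linear search of one iteration; either branch makes at least one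
  -- pick and replenishes it with 90 n.
  refine Runs.while_loop (I := fun σ₁ b₁ => SameExcept mainArrays σ σ₁ ∧ State n m c s σ₁ ∧
    (∃ r', MainInv n m c s l r' n (bundles m σ₁)) ∧
    200 * potential n m σ₁ + 80 * n + x + 11 ≤ b₁) ?_ ?_ ⟨SameExcept.refl, hσ, ⟨r, hM⟩, hb⟩
  · rintro σ₁ b₁ ⟨h1, h2, ⟨r', h3⟩, h4⟩ hT
    simp only [Test.Holds, NatExpr.eval, h2.agents, h2.count (n + 1) (by omega)] at hT
    refine ⟨by simp [Test.cost, NatExpr.cost]; omega, ?_⟩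
    refine Runs.seq (Runs.frame (runs_findTaker h2)
      (by simp [Test.cost, NatExpr.cost]; omega) ?_)
    rintro σ₂ ⟨g2, j, hj, h14, g3, g4⟩
    have hσ₂ := h2.congr g2
    have e1 : bundles m σ₂ = bundles m σ₁ := by simp only [bundles, g2.2 1 (by simp)]
    have p1 : potential n m σ₂ = potential n m σ₁ := by
      simp only [potential, e1, g2.2 4 (by simp)]
    have hs2 : SameExcept mainArrays σ σ₂ := h1.trans (g2.mono (by simp))
    rw [← e1] at g3 g4 hT h3
    rw [← p1] at h4
    refine Runs.ite (by simp [Test.cost, NatExpr.cost]; omega) ?_ ?_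
    · intro hT2
      simp only [Test.Holds, NatExpr.eval, hσ₂.agents, h14] at hT2
      obtain ⟨g5, g6⟩ := g3 hT2
      refine Runs.seq (Runs.setNat (by simp [Test.cost, NatExpr.cost]; omega) ?_)
      simp only [NatExpr.eval, h14]
      have same : SameExcept [10] σ₂ (σ₂.writeNat 10 0 0 j) := SameExcept.refl.write (by simp)
      have e2 : bundles m (σ₂.writeNat 10 0 0 j) = bundles m σ₂ := by simp [bundles]
      have p2 : potential n m (σ₂.writeNat 10 0 0 j) = potential n m σ₂ := by
        simp only [potential, e2, same.2 4 (by simp)]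
      refine Runs.mono (runs_takeSmall (x := x + 11) hI (hσ₂.congr same) hT2 (by simp)
        (by rw [e2]; exact h3) (by rw [e2]; exact g6)
        (by simp [Test.cost, NatExpr.cost, p2]; omega)) ?_
      rintro σ₃ b₃ ⟨k1, k2, k3, -, -, -, k4⟩
      rw [e2] at k4
      refine ⟨(hs2.trans (same.mono (by simp))).trans (k1.mono (by simp)), k2, ⟨r', k3⟩, ?_⟩
      have := k4 g5
      omega
    · intro hT2
      simp only [Test.Holds, NatExpr.eval, hσ₂.agents, h14] at hT2
      refine Runs.mono (runs_pickRound (x := x + 11) hn hσ₂ hT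
        (by simp [Test.cost, NatExpr.cost]; omega)) ?_
      rintro σ₃ b₃ ⟨k1, k2, k3, k4⟩
      exact ⟨hs2.trans k1, k2, ⟨_, h3.pass hI k4 (g4 (by omega))⟩, by omega⟩
  · rintro σ₁ b₁ ⟨h1, h2, h3, h4⟩ hT
    simp only [Test.Holds, NatExpr.eval, h2.agents, h2.count (n + 1) (by omega)] at hT
    exact ⟨by simp [Test.cost, NatExpr.cost]; omega, h1, h2, h3, by omega,
      by simp [Test.cost, NatExpr.cost]; omega⟩

theorem runs_mainPhase (hI : Separated n m c s l) (hσ : State n m c s σ) {b x : ℕ}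
    (hempty : ∀ i < n, bundles m σ i = ∅) (hnm : n ≤ m)
    (hb : 200 * potential n m σ + 130 * n + x + 50 ≤ b) :
    Runs mainPhase σ b fun σ' b' => SameExcept mainArrays σ σ' ∧ State n m c s σ' ∧
      (∃ r, MainInv n m c s l r n (bundles m σ')) ∧
      (∀ i < n, avail n c s (bundles m σ') i = 0) ∧
      avail n c s (bundles m σ') (n + 1) < n ∧ 200 * potential n m σ' + x ≤ b' := by
  have hn := hI.four_le
  have hall : n ≤ avail n c s (bundles m σ) (n + 1) := by
    rw [avail_all]
    have : bundles m σ n = Finset.range m := by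
      refine Finset.Subset.antisymm bundle_subset fun e he => mem_bundle.2 ?_
      have hem := Finset.mem_range.1 he
      refine ⟨hem, le_antisymm (hσ.owner_le e hem) ?_⟩
      by_contra hlt
      have : e ∈ bundles m σ (σ.nat 1 0 e) := mem_bundle.2 ⟨hem, rfl⟩
      rw [hempty _ (by omega)] at this
      simp at this
    rwa [this, Finset.card_range]
  refine Runs.seq (Runs.mono (runs_pickRound (x := 130 * n + x + 20) hn hσ hall (by omega)) ?_)
  rintro σ₁ b₁ ⟨h1, h2, h3, h4⟩
  refine Runs.seq (Runs.mono (runs_mainLoop (x := 50 * n + x + 9) hI h2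
    (h4.mainInv_one hI hempty) (by omega)) ?_)
  rintro σ₂ b₂ ⟨g1, g2, ⟨r, g3⟩, g4, g5⟩
  refine Runs.for_loop (N := n) (I := fun i σ₃ b₃ => SameExcept mainArrays σ σ₃ ∧
    State n m c s σ₃ ∧ MainInv n m c s l r n (bundles m σ₃) ∧
    (∀ j < i, avail n c s (bundles m σ₃) j = 0) ∧
    avail n c s (bundles m σ₃) (n + 1) < n ∧
    200 * potential n m σ₃ + 40 * (n - i) + x + 9 ≤ b₃) (by omega) ?_ ?_ ?_ ?_
  · have same : SameExcept [10] σ₂ (σ₂.writeNat 10 0 0 0) := SameExcept.refl.write (by simp)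
    have e1 : bundles m (σ₂.writeNat 10 0 0 0) = bundles m σ₂ := by simp [bundles]
    have p1 : potential n m (σ₂.writeNat 10 0 0 0) = potential n m σ₂ := by
      simp only [potential, e1, same.2 4 (by simp)]
    refine ⟨(h1.trans g1).trans (same.mono (by simp)), g2.congr same, ?_, by simp, ?_, ?_⟩
    · rw [e1]; exact g3
    · rw [e1]; exact g4
    · rw [p1]; omega
  · exact fun i σ₃ b₃ h => by simp only [NatExpr.eval, h.2.1.agents]
  · rintro i σ₃ b₃ hi h10 ⟨k1, k2, k3, k4, k5, k6⟩
    refine ⟨by simp [NatExpr.cost]; omega, ?_⟩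
    refine Runs.mono (runs_takeSmall (x := 40 * (n - (i + 1)) + x + 9) hI k2 hi h10 k3
      (avail_le_all.trans_lt k5) (by simp [NatExpr.cost]; omega)) ?_
    rintro σ₄ b₄ ⟨q1, q2, q3, q4, q5, q6, -⟩
    have same : SameExcept [10] σ₄ (σ₄.writeNat 10 0 0 (i + 1)) :=
      SameExcept.refl.write (by simp)
    have e1 : bundles m (σ₄.writeNat 10 0 0 (i + 1)) = bundles m σ₄ := by simp [bundles]
    have p1 : potential n m (σ₄.writeNat 10 0 0 (i + 1)) = potential n m σ₄ := by
      simp only [potential, e1, same.2 4 (by simp)]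
    refine ⟨by rw [q1.2 10 (by simp), h10],
      (k1.trans (q1.mono (by simp))).trans (same.mono (by simp)), q2.congr same, ?_, ?_, ?_, ?_⟩
    · rw [e1]; exact q3
    · rw [e1]
      intro j hj
      rcases (Nat.lt_succ_iff.1 hj).lt_or_eq with hj | rfl
      · exact Nat.eq_zero_of_le_zero ((avail_mono q5).trans (k4 j hj).le)
      · exact q4
    · rw [e1]; exact (avail_mono q5).trans_lt k5
    · rw [p1]; omega
  · rintro σ₃ b₃ - ⟨k1, k2, k3, k4, k5, k6⟩
    simp only [NatExpr.cost]
    exact ⟨by omega, k1, k2, ⟨r, k3⟩, k4, k5, by omega⟩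

end Main

/-! ### The last items -/

abbrev numFree : NatExpr := .cell 3 (.succ numAgents) (.const 0)

/-- Array `6` marks the agents having an item that is large for everybody; array `7` contains the
sizes of the bundles. -/
def inspect : Program :=
  forLoop 16 numItems (.seq
    (.ite (.natLe (.const 1) (.cell 2 numAgents (scalar 16)))
      (.setNat 6 (.cell 1 (.const 0) (scalar 16)) (.const 0) (.const 1)) .skip)
    (.setNat 7 (.cell 1 (.const 0) (scalar 16)) (.const 0)
      (.succ (.cell 7 (.cell 1 (.const 0) (scalar 16)) (.const 0)))))

/-- Scalar `17` becomes the number of unmarked agents, scalar `18` a marked agent with at least two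
items, if there is one. -/
def countPoor : Program :=
  .seq (assign 17 (.const 0)) (.seq (assign 18 numAgents) (forLoop 16 numAgents
    (.ite (.natLe (.cell 6 (scalar 16) (.const 0)) (.const 0)) (assign 17 (.succ (scalar 17)))
      (.ite (.natLe (.const 2) (.cell 7 (scalar 16) (.const 0))) (assign 18 (scalar 16)) .skip))))

/-- Poor agents are served first; what is left goes to rich agents, at most one item each. -/
def giveEach : Program :=
  .seq (forLoop 10 numAgents (.ite (.natLe (.cell 6 (scalar 10) (.const 0)) (.const 0)) pick .skip))
    (forLoop 10 numAgents (.ite (.and (.natLe (.const 1) (.cell 6 (scalar 10) (.const 0)))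
      (.natLe (.const 1) numFree)) pick .skip))

def feed : Program := .seq (assign 10 (scalar 18)) (.while (.natLe (.const 1) numFree) pick)

/-! ### Classifying agents as poor or rich -/

section Inspect

variable {n m : ℕ} {c : ℕ → ℕ → ℝ} {s l : ℝ} {σ : Store}

theorem bundle_succ {k j : ℕ} {o : ℕ → ℕ} :
    bundle (k + 1) o j = if o k = j then insert k (bundle k o j) else bundle k o j := by
  rw [bundle, Finset.range_add_one, Finset.filter_insert]
  rfl

theorem bundle_succ_card {k j : ℕ} {o : ℕ → ℕ} :
    (bundle (k + 1) o j).card = (bundle k o j).card + if o k = j then 1 else 0 := by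
  rw [bundle_succ]
  split_ifs
  · exact Finset.card_insert_of_notMem fun h => lt_irrefl _ (mem_bundle.1 h).1
  · rfl

/-- Free items have owner n, so the cells with index n are written too; only those of agents matter.
-/
theorem runs_inspect (hσ : State n m c s σ) (h6 : ∀ i, σ.nat 6 i 0 = 0)
    (h7 : ∀ i, σ.nat 7 i 0 = 0) :
    Runs inspect σ (m * 66 + 13) fun σ' _ => SameExcept [6, 7, 16] σ σ' ∧
      ∀ i < n, (σ'.nat 6 i 0 = 0 ↔ Poor n c s (bundles m σ) i) ∧
        σ'.nat 7 i 0 = (bundles m σ i).card := by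
  refine Runs.for_loop_const (N := m) (C := 50) (J := fun k σ₁ => SameExcept [6, 7, 16] σ σ₁ ∧
    ∀ i < n, (σ₁.nat 6 i 0 = 0 ↔ ∀ e < k, σ.nat 1 0 e = i → ¬ Hits n c s n e) ∧
        σ₁.nat 7 i 0 = (bundle k (σ.nat 1 0) i).card) ?_ ?_ ?_ ?_
  · refine ⟨SameExcept.refl.write (by simp), fun i hi => ⟨by simp [h6], ?_⟩⟩
    simp [h7, bundle]
  · exact fun k σ₁ h => by simp only [NatExpr.eval, h.1.2 0 (by simp), hσ.items]
  · rintro k σ₁ hk h16 ⟨h1, h2⟩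
    have e1 : σ₁.nat 1 = σ.nat 1 := h1.2 1 (by simp)
    have hT : (Test.natLe (.const 1) (.cell 2 numAgents (scalar 16))).Holds σ₁ ↔
        Hits n c s n k := by
      simp only [Test.Holds, NatExpr.eval, h16, h1.2 0 (by simp), h1.2 2 (by simp), hσ.agents]
      exact hσ.hits n (by omega) k hk
    have key : ∀ σ₂ : Store, SameExcept [6] σ₁ σ₂ → ∀ b, 30 ≤ b →
        (∀ i < n, σ₂.nat 6 i 0 = 0 ↔ ∀ e < k + 1, σ.nat 1 0 e = i → ¬ Hits n c s n e) →
        Runs (.setNat 7 (.cell 1 (.const 0) (scalar 16)) (.const 0)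
          (.succ (.cell 7 (.cell 1 (.const 0) (scalar 16)) (.const 0)))) σ₂ b fun σ' _ =>
          σ'.nat 16 0 0 = k ∧ (SameExcept [6, 7, 16] σ (σ'.writeNat 16 0 0 (k + 1)) ∧
          ∀ i < n, ((σ'.writeNat 16 0 0 (k + 1)).nat 6 i 0 = 0 ↔
            ∀ e < k + 1, σ.nat 1 0 e = i → ¬ Hits n c s n e) ∧
            (σ'.writeNat 16 0 0 (k + 1)).nat 7 i 0 = (bundle (k + 1) (σ.nat 1 0) i).card) := by
      intro σ₂ g1 b hb g2
      refine Runs.setNat (by simp [NatExpr.cost]; omega) ?_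
      simp only [NatExpr.eval, g1.2 1 (by simp), g1.2 16 (by simp), e1, h16]
      refine ⟨by simp [g1.2 16 (by simp), h16],
        ((h1.trans (g1.mono (by simp))).write (by simp)).write (by simp), fun i hi => ⟨?_, ?_⟩⟩
      · simpa using g2 i hi
      · rw [bundle_succ_card, ← (h2 i hi).2]
        by_cases hik : i = σ.nat 1 0 k
        · subst hik; simp [g1.2 7 (by simp)]
        · simp [g1.2 7 (by simp), hik, Ne.symm hik]
    refine Runs.seq (Runs.ite (by simp [NatExpr.cost, Test.cost]) ?_ ?_)
    · intro hh
      have hh := hT.1 hh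
      refine Runs.setNat (by simp [NatExpr.cost, Test.cost]) ?_
      simp only [NatExpr.eval, e1, h16]
      refine key _ (SameExcept.refl.write (by simp)) _ (by simp [NatExpr.cost, Test.cost]) ?_
      intro i hi
      by_cases hik : i = σ.nat 1 0 k
      · subst hik
        simp only [Store.nat_writeNat_same, and_self, if_true, one_ne_zero, false_iff]
        exact fun h => h k (by omega) rfl hh
      · simp only [Store.nat_writeNat_same, hik, false_and, if_false, (h2 i hi).1]
        refine ⟨fun h e he ho => ?_, fun h e he ho => h e (by omega) ho⟩
        rcases (Nat.lt_succ_iff.1 he).lt_or_eq with he | rfl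
        · exact h e he ho
        · exact absurd ho.symm hik
    · intro hh
      have hh := mt hT.2 hh
      refine Runs.skip (by simp [NatExpr.cost, Test.cost]) ?_
      refine key _ SameExcept.refl _ (by simp [NatExpr.cost, Test.cost]) ?_
      intro i hi
      rw [(h2 i hi).1]
      refine ⟨fun h e he ho => ?_, fun h e he ho => h e (by omega) ho⟩
      rcases (Nat.lt_succ_iff.1 he).lt_or_eq with he | rfl
      · exact h e he ho
      · exact hh
  · rintro σ₁ ⟨h1, h2⟩
    refine ⟨h1, fun i hi => ⟨?_, (h2 i hi).2⟩⟩
    rw [(h2 i hi).1]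
    exact ⟨fun h e he => h e (mem_bundle.1 he).1 (mem_bundle.1 he).2,
      fun h e he ho => h e (mem_bundle.2 ⟨he, ho⟩)⟩

/-- The agents not marked in array `6`. -/
def unmarked (σ : Store) (k : ℕ) : Finset ℕ := (Finset.range k).filter fun i => σ.nat 6 i 0 = 0

theorem unmarked_succ {k : ℕ} : unmarked σ (k + 1) =
    if σ.nat 6 k 0 = 0 then insert k (unmarked σ k) else unmarked σ k := by
  rw [unmarked, Finset.range_add_one, Finset.filter_insert]
  rfl

theorem mem_unmarked {k i : ℕ} : i ∈ unmarked σ k ↔ i < k ∧ σ.nat 6 i 0 = 0 := by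
  simp [unmarked]

theorem runs_countPoor (h0 : σ.nat 0 0 0 = n) :
    Runs countPoor σ (n * 61 + 30) fun σ' _ => SameExcept [16, 17, 18] σ σ' ∧
      σ'.nat 17 0 0 = (unmarked σ n).card ∧ ∃ k ≤ n, σ'.nat 18 0 0 = k ∧
        (k < n → σ.nat 6 k 0 ≠ 0 ∧ 2 ≤ σ.nat 7 k 0) ∧
        (k = n → ∀ i < n, σ.nat 6 i 0 ≠ 0 → σ.nat 7 i 0 < 2) := by
  refine Runs.seq (Runs.setNat (by simp [NatExpr.cost]) ?_)
  refine Runs.seq (Runs.setNat (by simp [NatExpr.cost]) ?_)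
  simp only [NatExpr.eval, NatExpr.cost]
  refine Runs.frame (C := n * (45 + 16) + 13) ?_ (by omega) (fun _ => id)
  refine Runs.for_loop_const (N := n) (C := 45) (J := fun j σ₁ => SameExcept [16, 17, 18] σ σ₁ ∧
      σ₁.nat 17 0 0 = (unmarked σ j).card ∧ ∃ k ≤ n, σ₁.nat 18 0 0 = k ∧
        (k < n → σ.nat 6 k 0 ≠ 0 ∧ 2 ≤ σ.nat 7 k 0) ∧
        (k = n → ∀ i < j, σ.nat 6 i 0 ≠ 0 → σ.nat 7 i 0 < 2)) ?_ ?_ ?_ (fun _ => id)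
  · refine ⟨((SameExcept.refl.write (by simp)).write (by simp)).write (by simp), ?_, n, le_rfl, ?_⟩
    · simp [unmarked]
    · simp [h0]
  · exact fun k σ₁ h => by simp only [NatExpr.eval, h.1.2 0 (by simp), h0]
  · rintro j σ₁ hj h16 ⟨h1, h2, k, hk, h3, h4, h5⟩
    have e6 := h1.2 6 (by simp)
    have e7 := h1.2 7 (by simp)
    have step : ∀ i < j + 1, i < j ∨ i = j := fun i hi => by omega
    refine Runs.ite (by simp [NatExpr.cost, Test.cost]) ?_ ?_
    · intro hT
      simp only [Test.Holds, NatExpr.eval, h16, e6, Nat.le_zero] at hT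
      refine Runs.setNat (by simp [NatExpr.cost, Test.cost]) ⟨by simp [h16],
        (h1.write (by simp)).write (by simp), ?_, k, hk, by simp [h3], h4, ?_⟩
      · rw [unmarked_succ, if_pos hT, Finset.card_insert_of_notMem (by simp [mem_unmarked])]
        simp [NatExpr.eval, h2]
      · intro hkn i hi h6
        rcases step i hi with hi | rfl
        · exact h5 hkn i hi h6
        · exact absurd hT h6
    · intro hT
      simp only [Test.Holds, NatExpr.eval, h16, e6, Nat.le_zero] at hT
      refine Runs.ite (by simp [NatExpr.cost, Test.cost]) ?_ ?_
      · intro hT2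
        simp only [Test.Holds, NatExpr.eval, h16, e7] at hT2
        refine Runs.setNat (by simp [NatExpr.cost, Test.cost]) ⟨by simp [h16],
          (h1.write (by simp)).write (by simp), ?_, j, hj.le, by simp [NatExpr.eval, h16],
          fun _ => ⟨hT, hT2⟩, by omega⟩
        rw [unmarked_succ, if_neg hT]
        simp [h2]
      · intro hT2
        simp only [Test.Holds, NatExpr.eval, h16, e7] at hT2
        refine Runs.skip (by simp [NatExpr.cost, Test.cost]) ⟨h16, h1.write (by simp), ?_, k, hk,
          by simp [h3], h4, ?_⟩
        · rw [unmarked_succ, if_neg hT]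
          simp [h2]
        · intro hkn i hi h6
          rcases step i hi with hi | rfl
          · exact h5 hkn i hi h6
          · omega

end Inspect

/-! ### One item for each of several agents, or all items for one -/

section Gifts

variable {n m : ℕ} {c : ℕ → ℕ → ℝ} {s l : ℝ} {σ : Store} {X X' X'' : ℕ → Finset ℕ}

/-- Every agent in `D` has received one free item. -/
structure Gifts (n : ℕ) (D : Finset ℕ) (X X' : ℕ → Finset ℕ) : Prop where
  gift : ∀ i < n, i ∈ D → ∃ f ∈ X n, f ∉ X i ∧ X' i = insert f (X i)
  keep : ∀ i < n, i ∉ D → X' i = X i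
  rest : X' n ⊆ X n
  card : (X' n).card + D.card = (X n).card

theorem Gifts.empty : Gifts n ∅ X X := ⟨by simp, by simp, subset_rfl, by simp⟩

theorem Gifts.give {D : Finset ℕ} {i f : ℕ} (h : Gifts n D X X') (hi : i ∉ D)
    (hG : Give n i f X' X'') : Gifts n (insert i D) X X'' := by
  refine ⟨fun j hj hjD => ?_, fun j hj hjD => ?_, hG.rest_subset.trans h.rest, ?_⟩
  · by_cases hji : j = i
    · subst hji
      have e := h.keep j hj hi
      exact ⟨f, h.rest hG.free, e ▸ hG.notMem, e ▸ hG.self⟩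
    · rw [hG.other j hj hji]
      exact h.gift j hj ((Finset.mem_insert.1 hjD).resolve_left hji)
  · have hji : j ≠ i := fun e => hjD (e ▸ Finset.mem_insert_self _ _)
    rw [hG.other j hj hji]
    exact h.keep j hj fun hd => hjD (Finset.mem_insert_of_mem hd)
  · rw [hG.rest, Finset.card_insert_of_notMem hi, ← h.card,
      ← Finset.card_erase_add_one hG.free]
    omega

theorem runs_giveEach (hI : Separated n m c s l) (hσ : State n m c s σ) {r b x : ℕ}
    (hR : Ready n m c s l r (bundles m σ))
    (h6 : ∀ i < n, σ.nat 6 i 0 = 0 ↔ Poor n c s (bundles m σ) i)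
    (hw : (unmarked σ n).card ≤ (bundles m σ n).card) (hlt : (bundles m σ n).card < n)
    (hb : 200 * potential n m σ + 100 * n + x + 50 ≤ b) :
    Runs giveEach σ b fun σ' b' => State n m c s σ' ∧ bundles m σ' n = ∅ ∧
      (∀ i < n, Tolerates n c l (bundles m σ') i 0) ∧ x ≤ b' := by
  have hn := hI.four_le
  refine Runs.seq (Runs.for_loop (N := n) (I := fun i σ₁ b₁ => SameExcept mainArrays σ σ₁ ∧
    State n m c s σ₁ ∧ Gifts n (unmarked σ i) (bundles m σ) (bundles m σ₁) ∧
    200 * potential n m σ₁ + 50 * n + 50 * (n - i) + x + 40 ≤ b₁) (by omega) ?_ ?_ ?_ ?_)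
  · have same : SameExcept [10] σ (σ.writeNat 10 0 0 0) := SameExcept.refl.write (by simp)
    have e1 : bundles m (σ.writeNat 10 0 0 0) = bundles m σ := by simp [bundles]
    refine ⟨same.mono (by simp), hσ.congr same, ?_, ?_⟩
    · rw [e1, unmarked]; simpa using Gifts.empty
    · simp only [potential, e1, same.2 4 (by simp)] at hb ⊢; omega
  · exact fun i σ₁ b₁ h => by simp only [NatExpr.eval, h.2.1.agents]
  · rintro i σ₁ b₁ hi h10 ⟨h1, h2, h3, h4⟩
    refine ⟨by simp [NatExpr.cost]; omega, ?_⟩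
    refine Runs.ite (by simp [NatExpr.cost, Test.cost]; omega) ?_ ?_
    · intro hT
      simp only [Test.Holds, NatExpr.eval, h10, h1.2 6 (by simp), Nat.le_zero] at hT
      have hnot : i ∉ unmarked σ i := by simp [mem_unmarked]
      have hsub : insert i (unmarked σ i) ⊆ unmarked σ n := by
        intro j hj
        rcases Finset.mem_insert.1 hj with rfl | hj
        · exact mem_unmarked.2 ⟨hi, hT⟩
        · have := mem_unmarked.1 hj
          exact mem_unmarked.2 ⟨by omega, this.2⟩
      have hcard := Finset.card_le_card hsub
      rw [Finset.card_insert_of_notMem hnot] at hcard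
      have hav : 0 < avail n c s (bundles m σ₁) (n + 1) := by
        rw [avail_all]
        have := h3.card
        omega
      refine Runs.mono (runs_pick (x := 50 * (n - (i + 1)) + x + 40) hn h2 hi h10 hav
        (by simp [NatExpr.cost, Test.cost]; omega)) ?_
      rintro σ₂ b₂ ⟨g1, g2, g3, f, g4, -⟩
      have same : SameExcept [10] σ₂ (σ₂.writeNat 10 0 0 (i + 1)) :=
        SameExcept.refl.write (by simp)
      have b2 : bundles m (σ₂.writeNat 10 0 0 (i + 1)) = bundles m σ₂ := by simp [bundles]
      refine ⟨by rw [g1.2 10 (by simp), h10],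
        (h1.trans (g1.mono (by simp))).trans (same.mono (by simp)), g2.congr same, ?_, ?_⟩
      · rw [b2, unmarked_succ, if_pos hT]; exact h3.give hnot g4
      · simp only [potential, b2, same.2 4 (by simp)] at g3 ⊢; omega
    · intro hT
      simp only [Test.Holds, NatExpr.eval, h10, h1.2 6 (by simp), Nat.le_zero] at hT
      have same : SameExcept [10] σ₁ (σ₁.writeNat 10 0 0 (i + 1)) :=
        SameExcept.refl.write (by simp)
      have b2 : bundles m (σ₁.writeNat 10 0 0 (i + 1)) = bundles m σ₁ := by simp [bundles]
      refine Runs.skip (by simp [NatExpr.cost, Test.cost]; omega) ⟨h10,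
        h1.trans (same.mono (by simp)), h2.congr same, ?_, ?_⟩
      · rw [b2, unmarked_succ, if_neg hT]; exact h3
      · simp only [potential, b2, same.2 4 (by simp)] at h4 ⊢
        simp [NatExpr.cost, Test.cost]; omega
  rintro σ₁ b₁ - ⟨h1, h2, h3, h4⟩
  refine ⟨by simp [NatExpr.cost]; omega, ?_⟩
  -- D is the set of recipients so far. A marked agent is skipped only if nothing is free, so
  -- otherwise all agents below i have been served.
  refine Runs.for_loop (N := n) (I := fun i σ₂ b₂ => SameExcept mainArrays σ σ₂ ∧
    State n m c s σ₂ ∧ (∃ D, Gifts n D (bundles m σ) (bundles m σ₂) ∧ unmarked σ n ⊆ D ∧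
      (∀ j ∈ D, j < n) ∧ (∀ j ∈ D, i ≤ j → σ.nat 6 j 0 = 0) ∧
      (bundles m σ₂ n = ∅ ∨ Finset.range i ⊆ D)) ∧
    200 * potential n m σ₂ + 50 * (n - i) + x + 20 ≤ b₂) (by simp [NatExpr.cost]; omega)
    ?_ ?_ ?_ ?_
  · have same : SameExcept [10] σ₁ (σ₁.writeNat 10 0 0 0) := SameExcept.refl.write (by simp)
    have e1 : bundles m (σ₁.writeNat 10 0 0 0) = bundles m σ₁ := by simp [bundles]
    refine ⟨h1.trans (same.mono (by simp)), h2.congr same, ⟨unmarked σ n, ?_, subset_rfl,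
      fun j hj => (mem_unmarked.1 hj).1, fun j hj _ => (mem_unmarked.1 hj).2, by simp⟩, ?_⟩
    · rw [e1]; exact h3
    · simp only [potential, e1, same.2 4 (by simp)] at h4 ⊢
      simp [NatExpr.cost]; omega
  · exact fun i σ₁ b₁ h => by simp only [NatExpr.eval, h.2.1.agents]
  · rintro i σ₂ b₂ hi h10 ⟨g1, g2, ⟨D, g3, g4, g5, g6, g7⟩, g8⟩
    have hc := g2.count (n + 1) (by omega)
    refine ⟨by simp [NatExpr.cost]; omega, ?_⟩
    refine Runs.ite (by simp [NatExpr.cost, Test.cost]; omega) ?_ ?_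
    · intro hT
      simp only [Test.Holds, NatExpr.eval, h10, g1.2 6 (by simp), g2.agents, hc] at hT
      have hnot : i ∉ D := fun hd => by
        have := g6 i hd le_rfl
        omega
      refine Runs.mono (runs_pick (x := 50 * (n - (i + 1)) + x + 20) hn g2 hi h10 hT.2
        (by simp [NatExpr.cost, Test.cost]; omega)) ?_
      rintro σ₃ b₃ ⟨k1, k2, k3, f, k4, -⟩
      have same : SameExcept [10] σ₃ (σ₃.writeNat 10 0 0 (i + 1)) :=
        SameExcept.refl.write (by simp)
      have b3 : bundles m (σ₃.writeNat 10 0 0 (i + 1)) = bundles m σ₃ := by simp [bundles]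
      refine ⟨by rw [k1.2 10 (by simp), h10],
        (g1.trans (k1.mono (by simp))).trans (same.mono (by simp)), k2.congr same,
        ⟨insert i D, ?_, g4.trans (Finset.subset_insert _ _), ?_, ?_, ?_⟩, ?_⟩
      · rw [b3]; exact g3.give hnot k4
      · intro j hj
        rcases Finset.mem_insert.1 hj with rfl | hj
        exacts [hi, g5 j hj]
      · intro j hj hij
        rcases Finset.mem_insert.1 hj with rfl | hj
        · omega
        · exact g6 j hj (by omega)
      · rw [b3]
        rcases g7 with g7 | g7
        · exact Or.inl (Finset.subset_empty.1 (g7 ▸ k4.rest_subset))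
        · right
          rw [Finset.range_add_one]
          exact Finset.insert_subset_insert i g7
      · simp only [potential, b3, same.2 4 (by simp)] at k3 ⊢; omega
    · intro hT
      simp only [Test.Holds, NatExpr.eval, h10, g1.2 6 (by simp), g2.agents, hc] at hT
      have same : SameExcept [10] σ₂ (σ₂.writeNat 10 0 0 (i + 1)) :=
        SameExcept.refl.write (by simp)
      have b3 : bundles m (σ₂.writeNat 10 0 0 (i + 1)) = bundles m σ₂ := by simp [bundles]
      refine Runs.skip (by simp [NatExpr.cost, Test.cost]; omega) ⟨h10,
        g1.trans (same.mono (by simp)), g2.congr same,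
        ⟨D, by rw [b3]; exact g3, g4, g5, fun j hj hij => g6 j hj (by omega), ?_⟩, ?_⟩
      · rw [b3]
        rcases g7 with g7 | g7
        · exact Or.inl g7
        · by_cases h0 : σ.nat 6 i 0 = 0
          · right
            rw [Finset.range_add_one]
            exact Finset.insert_subset (g4 (mem_unmarked.2 ⟨hi, h0⟩)) g7
          · left
            rw [avail_all] at hT
            exact Finset.card_eq_zero.1 (by omega)
      · simp only [potential, b3, same.2 4 (by simp)] at g8 ⊢
        simp [NatExpr.cost, Test.cost]; omega
  · rintro σ₂ b₂ - ⟨g1, g2, ⟨D, g3, g4, g5, g6, g7⟩, g8⟩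
    refine ⟨by simp [NatExpr.cost]; omega, g2, ?_, ?_, by simp [NatExpr.cost]; omega⟩
    · rcases g7 with g7 | g7
      · exact g7
      -- If all n agents had been served, n gifts would have come from fewer than n free items.
      · have h1 := Finset.card_le_card g7
        have h2 := g3.card
        rw [Finset.card_range] at h1
        omega
    · exact hR.efx_of_gifts hI (D := (· ∈ D))
        (fun i hi hp => g4 (mem_unmarked.2 ⟨hi, (h6 i hi).2 hp⟩)) (fun j _ => bundle_subset)
        g3.gift g3.keep

theorem runs_feed (hI : Separated n m c s l) (hσ : State n m c s σ) {k b x : ℕ} (hk : k < n)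
    (h18 : σ.nat 18 0 0 = k) (hF : FeedInv n m c l k (bundles m σ))
    (hb : 200 * potential n m σ + x + 50 ≤ b) :
    Runs feed σ b fun σ' b' => State n m c s σ' ∧ bundles m σ' n = ∅ ∧
      (∀ i < n, Tolerates n c l (bundles m σ') i 0) ∧ x ≤ b' := by
  have hn := hI.four_le
  refine Runs.seq (Runs.setNat (by simp [NatExpr.cost]; omega) ?_)
  simp only [NatExpr.eval, NatExpr.cost, h18]
  refine Runs.while_loop (I := fun σ₁ b₁ => State n m c s σ₁ ∧ σ₁.nat 10 0 0 = k ∧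
    FeedInv n m c l k (bundles m σ₁) ∧ 200 * potential n m σ₁ + x + 30 ≤ b₁) ?_ ?_ ?_
  · rintro σ₁ b₁ ⟨h1, h10, h2, h3⟩ hT
    simp only [Test.Holds, NatExpr.eval, h1.agents, h1.count (n + 1) (by omega)] at hT
    refine ⟨by simp [NatExpr.cost, Test.cost]; omega, ?_⟩
    refine Runs.mono (runs_pick (x := x + 10) hn h1 hk h10 hT
        (by simp [NatExpr.cost, Test.cost]; omega)) ?_
    rintro σ₂ b₂ ⟨g1, g2, g3, f, g4, -⟩
    exact ⟨g2, by rw [g1.2 10 (by simp), h10], h2.give hI g4, by omega⟩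
  · rintro σ₁ b₁ ⟨h1, h10, h2, h3⟩ hT
    simp only [Test.Holds, NatExpr.eval, h1.agents, h1.count (n + 1) (by omega), avail_all] at hT
    have h0 : (bundles m σ₁ n).card = 0 := by omega
    refine ⟨by simp [NatExpr.cost, Test.cost]; omega, h1, Finset.card_eq_zero.1 h0, ?_,
      by simp [NatExpr.cost, Test.cost]; omega⟩
    intro i hi
    by_cases hik : i = k
    · subst hik
      have := h2.tolerates
      rwa [h0, Nat.cast_zero] at this
    · exact h2.efx i hi hik
  · have same : SameExcept [10] σ (σ.writeNat 10 0 0 k) := SameExcept.refl.write (by simp)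
    have e1 : bundles m (σ.writeNat 10 0 0 k) = bundles m σ := by simp [bundles]
    refine ⟨hσ.congr same, by simp, by rw [e1]; exact hF, ?_⟩
    simp only [potential, e1, same.2 4 (by simp)] at hb ⊢
    omega

end Gifts

/-! ### Giving the last items to agents all of whose items are small -/

/-- Scalar `19` becomes an unmarked agent with the fewest items. -/
def findFewest : Program :=
  .seq (assign 19 numAgents) (forLoop 16 numAgents
    (.ite (.and (.natLe (.cell 6 (scalar 16) (.const 0)) (.const 0))
        (.not (.and (.natLe (.succ (scalar 19)) numAgents)
          (.natLe (.cell 7 (scalar 19) (.const 0)) (.cell 7 (scalar 16) (.const 0))))))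
      (assign 19 (scalar 16)) .skip))

/-- The real array `3` becomes the costs of all bundles to agent `19`. -/
def computeCosts : Program :=
  .seq (forLoop 16 (.succ numAgents) (.setReal 3 (scalar 16) (.const 0) .zero))
    (forLoop 16 numItems (.setReal 3 (.cell 1 (.const 0) (scalar 16)) (.const 0)
      (.add (.cell 3 (.cell 1 (.const 0) (scalar 16)) (.const 0))
        (.cell 0 (scalar 19) (scalar 16)))))

/-- Scalar `20` becomes an unmarked agent other than `19` whose bundle is cheapest according to the
real array `3`. -/
def findCheapest : Program :=
  .seq (assign 20 numAgents) (forLoop 16 numAgents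
    (.ite (.and (.natLe (.cell 6 (scalar 16) (.const 0)) (.const 0))
        (.and (.not (.and (.natLe (scalar 16) (scalar 19)) (.natLe (scalar 19) (scalar 16))))
          (.not (.and (.natLe (.succ (scalar 20)) numAgents)
            (.realLe (.cell 3 (scalar 20) (.const 0)) (.cell 3 (scalar 16) (.const 0)))))))
      (assign 20 (scalar 16)) .skip))

/-- Agent `19` takes over the bundle of agent `20`, who is selected for the next pick. -/
def takeOver : Program :=
  .seq (forLoop 16 numItems
    (.ite (.and (.natLe (.cell 1 (.const 0) (scalar 16)) (scalar 20))
        (.natLe (scalar 20) (.cell 1 (.const 0) (scalar 16))))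
      (.seq (.setNat 1 (.const 0) (scalar 16) (scalar 19))
        (.setNat 7 (scalar 19) (.const 0) (.succ (.cell 7 (scalar 19) (.const 0))))) .skip))
    (assign 10 (scalar 20))

/-- One of the last items is given away. -/
def splitStep : Program :=
  .seq findFewest (.seq computeCosts (.seq findCheapest (.seq
    (.ite (.realLe (.cell 2 (.const 0) (.const 0))
        (.add (.cell 3 (scalar 20) (.const 0)) (.cell 3 (scalar 20) (.const 0))))
      (assign 10 (scalar 19)) takeOver)
    (.seq pick (.setNat 6 (scalar 10) (.const 0) (.const 1))))))

def split : Program := .while (.natLe (.const 1) numFree) splitStep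

/-! ### Searches and updates within a split step -/

section SplitLoop

variable {n m : ℕ} {c : ℕ → ℕ → ℝ} {s l : ℝ} {σ : Store}

theorem runs_findFewest (h0 : σ.nat 0 0 0 = n) (hne : (unmarked σ n).Nonempty) :
    Runs findFewest σ (n * 66 + 30) fun σ' _ => SameExcept [16, 19] σ σ' ∧
      ∃ i < n, σ'.nat 19 0 0 = i ∧ σ.nat 6 i 0 = 0 ∧
        ∀ j < n, σ.nat 6 j 0 = 0 → σ.nat 7 i 0 ≤ σ.nat 7 j 0 := by
  refine Runs.seq (Runs.setNat (by simp [NatExpr.cost]) ?_)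
  simp only [NatExpr.eval, NatExpr.cost, h0]
  refine Runs.frame (C := n * (50 + 16) + 13) ?_ (by omega) (fun _ => id)
  -- The value n of the scalar means that no unmarked agent has been met yet.
  refine Runs.for_loop_const (N := n) (C := 50) (J := fun k σ₁ => SameExcept [16, 19] σ σ₁ ∧
      ∃ i ≤ n, σ₁.nat 19 0 0 = i ∧ (i = n → ∀ j < k, σ.nat 6 j 0 ≠ 0) ∧
        (i < n → σ.nat 6 i 0 = 0 ∧ ∀ j < k, σ.nat 6 j 0 = 0 → σ.nat 7 i 0 ≤ σ.nat 7 j 0))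
    ?_ ?_ ?_ ?_
  · exact ⟨(SameExcept.refl.write (by simp)).write (by simp), n, le_rfl, by simp, by simp, by simp⟩
  · exact fun k σ₁ h => by simp only [NatExpr.eval, h.1.2 0 (by simp), h0]
  · rintro k σ₁ hk h16 ⟨h1, i, hi, h19, h2, h3⟩
    have step : ∀ j < k + 1, j < k ∨ j = k := fun i hi => by omega
    refine Runs.ite (by simp [NatExpr.cost, Test.cost]) ?_ ?_
    · intro hT
      simp only [Test.Holds, NatExpr.eval, h16, h19, h1.2 6 (by simp), h1.2 7 (by simp),
        h1.2 0 (by simp), h0, Nat.le_zero] at hT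
      refine Runs.setNat (by simp [NatExpr.cost, Test.cost]) ⟨by simp [h16],
        (h1.write (by simp)).write (by simp), k, hk.le, by simp [NatExpr.eval, h16], by omega, ?_⟩
      refine fun _ => ⟨hT.1, fun j hj h6 => ?_⟩
      rcases step j hj with hj | rfl
      · rcases hi.lt_or_eq with hi | hi
        · have := (h3 hi).2 j hj h6
          have := hT.2
          omega
        · exact absurd h6 (h2 hi j hj)
      · exact le_rfl
    · intro hT
      simp only [Test.Holds, NatExpr.eval, h16, h19, h1.2 6 (by simp), h1.2 7 (by simp),
        h1.2 0 (by simp), h0, Nat.le_zero] at hT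
      refine Runs.skip (by simp [NatExpr.cost, Test.cost]) ⟨h16, h1.write (by simp), i, hi,
        by simp [h19], ?_, ?_⟩
      · intro hin j hj h6
        rcases step j hj with hj | rfl
        · exact h2 hin j hj h6
        · exact hT ⟨h6, by omega⟩
      · refine fun hin => ⟨(h3 hin).1, fun j hj h6 => ?_⟩
        rcases step j hj with hj | rfl
        · exact (h3 hin).2 j hj h6
        · by_contra hlt
          exact hT ⟨h6, fun h => hlt h.2⟩
  · rintro σ₁ ⟨h1, i, hi, h19, h2, h3⟩
    rcases hi.lt_or_eq with hi | hi
    · exact ⟨h1, i, hi, h19, h3 hi⟩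
    · obtain ⟨j, hj⟩ := hne
      obtain ⟨hj, h6⟩ := mem_unmarked.1 hj
      exact absurd h6 (h2 hi j hj)

/-- Index n is included because the costs of free items accumulate there; a single sweep over the
items thus needs no test. -/
theorem runs_computeCosts (h0 : σ.nat 0 0 0 = n) (hm : σ.nat 0 0 1 = m)
    (hle : ∀ e < m, σ.nat 1 0 e ≤ n) {i : ℕ} (h19 : σ.nat 19 0 0 = i) :
    Runs computeCosts σ ((n + m) * 60 + 100) fun σ' _ =>
      (∀ a, a ≠ 16 → σ'.nat a = σ.nat a) ∧ (∀ a, a ≠ 3 → σ'.real a = σ.real a) ∧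
      ∀ j ≤ n, σ'.real 3 j 0 = setCost (σ.real 0) i (bundle m (σ.nat 1 0) j) := by
  refine Runs.seq (Runs.frame (C := (n + 1) * (20 + 17) + 14) (P := fun σ' =>
    (∀ a, a ≠ 16 → σ'.nat a = σ.nat a) ∧ (∀ a, a ≠ 3 → σ'.real a = σ.real a) ∧
      ∀ j < n + 1, σ'.real 3 j 0 = 0) ?_ (by omega) ?_)
  · refine Runs.for_loop_const (N := n + 1) (C := 20) (J := fun k σ' =>
      (∀ a, a ≠ 16 → σ'.nat a = σ.nat a) ∧ (∀ a, a ≠ 3 → σ'.real a = σ.real a) ∧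
      ∀ j < k, σ'.real 3 j 0 = 0) ?_ ?_ ?_ (fun _ => id)
    · exact ⟨fun a ha => by simp [ha], fun a _ => by simp, by simp⟩
    · exact fun k σ₁ h => by simp only [NatExpr.eval, h.1 0 (by simp), h0]
    · rintro k σ₁ hk h16 ⟨h1, h2, h3⟩
      refine Runs.setReal (by simp [NatExpr.cost, RealExpr.cost]) ?_
      simp only [NatExpr.eval, RealExpr.eval, h16]
      refine ⟨by simp [h16], fun a ha => by simp [ha, h1 a ha], fun a ha => by simp [ha, h2 a ha],
        fun j hj => ?_⟩
      simp only [Store.real_writeNat, Store.real_writeReal_same, and_true]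
      split_ifs with hjk
      · rfl
      · exact h3 j (by omega)
  · rintro σ₁ ⟨h1, h2, h3⟩
    refine Runs.frame (C := m * (40 + 16) + 13) ?_ (by omega) (fun _ => id)
    refine Runs.for_loop_const (N := m) (C := 40) (J := fun k σ' =>
      (∀ a, a ≠ 16 → σ'.nat a = σ.nat a) ∧ (∀ a, a ≠ 3 → σ'.real a = σ.real a) ∧
      ∀ j ≤ n, σ'.real 3 j 0 = setCost (σ.real 0) i (bundle k (σ.nat 1 0) j)) ?_ ?_ ?_
        (fun _ => id)
    · refine ⟨fun a ha => by simp [ha, h1 a ha], fun a ha => by simp [h2 a ha], fun j hj => ?_⟩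
      simp [h3 j (by omega), setCost, bundle]
    · exact fun k σ₁ h => by simp only [NatExpr.eval, h.1 0 (by simp), hm]
    · rintro k σ₂ hk h16 ⟨g1, g2, g3⟩
      refine Runs.setReal (by simp [NatExpr.cost, RealExpr.cost]) ?_
      simp only [NatExpr.eval, RealExpr.eval, h16, g1 1 (by simp), g1 19 (by simp), h19,
        g2 0 (by simp)]
      refine ⟨by simp [h16], fun a ha => by simp [ha, g1 a ha], fun a ha => by simp [ha, g2 a ha],
        fun j hj => ?_⟩
      simp only [Store.real_writeNat, Store.real_writeReal_same, and_true]
      rw [bundle_succ, g3 _ (hle k hk)]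
      by_cases hjk : j = σ.nat 1 0 k
      · rw [if_pos hjk, if_pos hjk.symm, hjk, setCost_insert]
        exact fun h => lt_irrefl _ (mem_bundle.1 h).1
      · rw [if_neg hjk, if_neg (Ne.symm hjk), g3 j hj]

theorem runs_findCheapest (h0 : σ.nat 0 0 0 = n) {i : ℕ} (h19 : σ.nat 19 0 0 = i)
    (hne : ∃ j < n, j ≠ i ∧ σ.nat 6 j 0 = 0) :
    Runs findCheapest σ (n * 76 + 30) fun σ' _ => SameExcept [16, 20] σ σ' ∧
      ∃ j < n, σ'.nat 20 0 0 = j ∧ j ≠ i ∧ σ.nat 6 j 0 = 0 ∧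
        ∀ k < n, k ≠ i → σ.nat 6 k 0 = 0 → σ.real 3 j 0 ≤ σ.real 3 k 0 := by
  refine Runs.seq (Runs.setNat (by simp [NatExpr.cost]) ?_)
  simp only [NatExpr.eval, NatExpr.cost, h0]
  refine Runs.frame (C := n * (60 + 16) + 13) ?_ (by omega) (fun _ => id)
  refine Runs.for_loop_const (N := n) (C := 60) (J := fun k σ₁ => SameExcept [16, 20] σ σ₁ ∧
      ∃ j ≤ n, σ₁.nat 20 0 0 = j ∧ (j = n → ∀ j' < k, j' ≠ i → σ.nat 6 j' 0 ≠ 0) ∧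
        (j < n → j ≠ i ∧ σ.nat 6 j 0 = 0 ∧
          ∀ j' < k, j' ≠ i → σ.nat 6 j' 0 = 0 → σ.real 3 j 0 ≤ σ.real 3 j' 0)) ?_ ?_ ?_ ?_
  · exact ⟨(SameExcept.refl.write (by simp)).write (by simp), n, le_rfl, by simp, by simp, by simp⟩
  · exact fun k σ₁ h => by simp only [NatExpr.eval, h.1.2 0 (by simp), h0]
  · rintro k σ₁ hk h16 ⟨h1, j, hj, h20, h2, h3⟩
    have step : ∀ j < k + 1, j < k ∨ j = k := fun i hi => by omega
    have hiff : ∀ p : Prop, (¬ (k ≤ i ∧ i ≤ k) ∧ p) ↔ (k ≠ i ∧ p) := fun p =>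
      and_congr_left' (by omega)
    refine Runs.ite (by simp [NatExpr.cost, Test.cost, RealExpr.cost]) ?_ ?_
    · intro hT
      simp only [Test.Holds, NatExpr.eval, RealExpr.eval, h16, h20, h1.2 6 (by simp),
        h1.2 19 (by simp), h19, h1.1, h1.2 0 (by simp), h0, Nat.le_zero, hiff] at hT
      obtain ⟨t1, t2, t3⟩ := hT
      refine Runs.setNat (by simp [NatExpr.cost, Test.cost, RealExpr.cost]) ⟨by simp [h16],
        (h1.write (by simp)).write (by simp), k, hk.le, by simp [NatExpr.eval, h16], by omega, ?_⟩
      refine fun _ => ⟨t2, t1, fun j' hj' hne h6 => ?_⟩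
      rcases step j' hj' with hj' | rfl
      · rcases hj.lt_or_eq with hj | hj
        · have g1 := (h3 hj).2.2 j' hj' hne h6
          have g2 : ¬ σ.real 3 j 0 ≤ σ.real 3 k 0 := fun h => t3 ⟨hj, h⟩
          linarith
        · exact absurd h6 (h2 hj j' hj' hne)
      · exact le_rfl
    · intro hT
      simp only [Test.Holds, NatExpr.eval, RealExpr.eval, h16, h20, h1.2 6 (by simp),
        h1.2 19 (by simp), h19, h1.1, h1.2 0 (by simp), h0, Nat.le_zero, hiff] at hT
      refine Runs.skip (by simp [NatExpr.cost, Test.cost, RealExpr.cost]) ⟨h16,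
        h1.write (by simp), j, hj, by simp [h20], ?_, ?_⟩
      · intro hjn j' hj' hne h6
        rcases step j' hj' with hj' | rfl
        · exact h2 hjn j' hj' hne h6
        · exact hT ⟨h6, hne, by omega⟩
      · refine fun hjn => ⟨(h3 hjn).1, (h3 hjn).2.1, fun j' hj' hne h6 => ?_⟩
        rcases step j' hj' with hj' | rfl
        · exact (h3 hjn).2.2 j' hj' hne h6
        · by_contra hlt
          exact hT ⟨h6, hne, fun h => hlt h.2⟩
  · rintro σ₁ ⟨h1, j, hj, h20, h2, h3⟩
    rcases hj.lt_or_eq with hj | hj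
    · exact ⟨h1, j, hj, h20, h3 hj⟩
    · obtain ⟨j', hj', hne', h6⟩ := hne
      exact absurd h6 (h2 hj j' hj' hne')

theorem runs_takeOver (hm : σ.nat 0 0 1 = m) {i j : ℕ} (h19 : σ.nat 19 0 0 = i)
    (h20 : σ.nat 20 0 0 = j) :
    Runs takeOver σ (m * 66 + 30) fun σ' _ => SameExcept [1, 7, 10, 16] σ σ' ∧
      σ'.nat 10 0 0 = j ∧ (∀ e < m, σ'.nat 1 0 e = if σ.nat 1 0 e = j then i else σ.nat 1 0 e) ∧
      (∀ e, m ≤ e → σ'.nat 1 0 e = σ.nat 1 0 e) ∧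
      σ'.nat 7 i 0 = σ.nat 7 i 0 + (bundle m (σ.nat 1 0) j).card ∧
      ∀ k, k ≠ i → σ'.nat 7 k 0 = σ.nat 7 k 0 := by
  refine Runs.seq (Runs.frame (C := m * (50 + 16) + 13) (P := fun σ' =>
      SameExcept [1, 7, 16] σ σ' ∧
      (∀ e, σ'.nat 1 0 e = if e < m ∧ σ.nat 1 0 e = j then i else σ.nat 1 0 e) ∧
      σ'.nat 7 i 0 = σ.nat 7 i 0 + (bundle m (σ.nat 1 0) j).card ∧
      ∀ k, k ≠ i → σ'.nat 7 k 0 = σ.nat 7 k 0) ?_ (by omega) ?_)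
  · refine Runs.for_loop_const (N := m) (C := 50) (J := fun k σ' => SameExcept [1, 7, 16] σ σ' ∧
      (∀ e, σ'.nat 1 0 e = if e < k ∧ σ.nat 1 0 e = j then i else σ.nat 1 0 e) ∧
      σ'.nat 7 i 0 = σ.nat 7 i 0 + (bundle k (σ.nat 1 0) j).card ∧
      ∀ k, k ≠ i → σ'.nat 7 k 0 = σ.nat 7 k 0) ?_ ?_ ?_ (fun _ => id)
    · exact ⟨SameExcept.refl.write (by simp), by simp, by simp [bundle], by simp⟩
    · exact fun k σ₁ h => by simp only [NatExpr.eval, h.1.2 0 (by simp), hm]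
    · rintro k σ₁ hk h16 ⟨h1, h2, h3, h4⟩
      have e1 : σ₁.nat 1 0 k = σ.nat 1 0 k := by simp [h2]
      refine Runs.ite (by simp [NatExpr.cost, Test.cost]) ?_ ?_
      · intro hT
        simp only [Test.Holds, NatExpr.eval, h16, e1, h1.2 20 (by simp), h20] at hT
        have hT := le_antisymm hT.1 hT.2
        refine Runs.seq (Runs.setNat (by simp [NatExpr.cost, Test.cost]) (Runs.setNat
          (by simp [NatExpr.cost, Test.cost]) ⟨by simp [h16], ?_⟩))
        simp only [NatExpr.eval, h16, h1.2 19 (by simp), h19, ne_eq, OfNat.ofNat_ne_one,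
          not_false_eq_true, Store.nat_writeNat_of_ne, OfNat.one_ne_ofNat]
        refine ⟨((h1.write (by simp)).write (by simp)).write (by simp), fun e => ?_, ?_, ?_⟩
        · simp only [Store.nat_writeNat_same, true_and, h2]
          by_cases hek : e = k
          · subst hek; simp [hT]
          · have : e < k ↔ e < k + 1 := by omega
            simp only [hek, if_false, this]
        · rw [bundle_succ_card, if_pos hT]
          simp [h3, add_assoc]
        · intro k' hk'
          simp [hk', h4 k' hk']
      · intro hT
        simp only [Test.Holds, NatExpr.eval, h16, e1, h1.2 20 (by simp), h20] at hT
        have hT : σ.nat 1 0 k ≠ j := by omega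
        refine Runs.skip (by simp [NatExpr.cost, Test.cost]) ⟨h16, h1.write (by simp),
          fun e => ?_, ?_, ?_⟩
        · rw [Store.nat_writeNat_of_ne (by simp), h2]
          by_cases hek : e = k
          · subst hek; simp [hT]
          · have : e < k ↔ e < k + 1 := by omega
            simp only [this]
        · rw [bundle_succ_card, if_neg hT]
          simp [h3]
        · intro k' hk'
          simp [h4 k' hk']
  · rintro σ₁ ⟨h1, h2, h3, h4⟩
    refine Runs.setNat (by simp [NatExpr.cost])
      ⟨(h1.mono (by simp)).write (by simp), ?_, ?_, ?_, ?_, ?_⟩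
    · simp [NatExpr.eval, h1.2 20 (by simp), h20]
    · intro e he
      simp [h2, he]
    · intro e he
      simp [h2, he]
    · simp [h3]
    · intro k hk
      simp [h4 k hk]

end SplitLoop

/-! ### The split loop and the whole end phase -/

section SplitRun

variable {n m : ℕ} {c : ℕ → ℕ → ℝ} {s l : ℝ} {σ σ' : Store} {X : ℕ → Finset ℕ}

theorem SplitInv.congr {r : ℕ} {W W' : ℕ → Prop} (h : SplitInv n m c s l r W X)
    (hW : ∀ i < n, W i ↔ W' i) : SplitInv n m c s l r W' X :=
  ⟨h.subset, h.pos, h.efx, fun i hi hw => h.small i hi ((hW i hi).2 hw),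
    fun j hj hw => h.large j hj (mt (hW j hj).1 hw),
    fun i hi hw j hj hw' => h.tolerant i hi ((hW i hi).2 hw) j hj (mt (hW j hj).1 hw'),
    fun hr i hi => ⟨(h.light hr i hi).1, fun hw => (h.light hr i hi).2 ((hW i hi).2 hw)⟩, h.free⟩

theorem runs_pick_mark (hn : 4 ≤ n) (hσ : State n m c s σ) {i b x : ℕ} (hi : i < n)
    (h10 : σ.nat 10 0 0 = i) (hfree : 0 < avail n c s (bundles m σ) (n + 1))
    (hb : 200 * potential n m σ + x ≤ b) :
    Runs (.seq pick (.setNat 6 (scalar 10) (.const 0) (.const 1))) σ b fun σ' b' =>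
      SameExcept (6 :: pickArrays) σ σ' ∧ State n m c s σ' ∧
      200 * potential n m σ' + 90 * n + x ≤ b' ∧
      (∃ f, Give n i f (bundles m σ) (bundles m σ')) ∧
      ∀ k, σ'.nat 6 k 0 = if k = i then 1 else σ.nat 6 k 0 := by
  refine Runs.seq (Runs.mono (runs_pick hn hσ hi h10 hfree hb) ?_)
  rintro σ₁ b₁ ⟨h1, h2, h3, f, h4, -⟩
  have e10 : σ₁.nat 10 0 0 = i := by rw [h1.2 10 (by simp), h10]
  refine Runs.setNat (by simp [NatExpr.cost]; omega) ?_
  simp only [NatExpr.eval, e10]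
  have same : SameExcept [6] σ₁ (σ₁.writeNat 6 i 0 1) := SameExcept.refl.write (by simp)
  have e1 : bundles m (σ₁.writeNat 6 i 0 1) = bundles m σ₁ := by simp [bundles]
  have p1 : potential n m (σ₁.writeNat 6 i 0 1) = potential n m σ₁ := by
    simp only [potential, e1, same.2 4 (by simp)]
  refine ⟨(h1.mono (by simp)).trans (same.mono (by simp)), h2.congr same, ?_,
    ⟨f, by rw [e1]; exact h4⟩, ?_⟩
  · rw [p1]; simp [NatExpr.cost]; omega
  · intro k
    simp [h1.2 6 (by simp)]

theorem bundle_reassign {i j k : ℕ} {o o' : ℕ → ℕ} (hij : j ≠ i)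
    (ho : ∀ e < m, o' e = if o e = j then i else o e) :
    bundle m o' k = if k = i then bundle m o i ∪ bundle m o j else
      if k = j then ∅ else bundle m o k := by
  ext e
  by_cases he : e < m
  · have := ho e he
    by_cases hki : k = i
    · subst hki
      simp only [mem_bundle, if_true, Finset.mem_union, this, he, true_and]
      split_ifs with h <;> simp [h]
    · by_cases hkj : k = j
      · subst hkj
        simp only [mem_bundle, this, hki, if_false, if_true, Finset.notMem_empty, iff_false]
        split_ifs with h
        · exact fun h' => hij h'.2.symm
        · exact fun h' => h h'.2
      · simp only [mem_bundle, this, hki, hkj, if_false, he, true_and]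
        split_ifs with h
        · rw [h]
          exact ⟨fun h' => absurd h'.symm hki, fun h' => absurd h'.symm hkj⟩
        · rfl
  · have : ∀ k (o : ℕ → ℕ), e ∉ bundle m o k := fun k o h => he (mem_bundle.1 h).1
    simp only [this, false_iff]
    split_ifs <;> simp [this]

/-- Counters and pointers depend on the free items only, and moving a bundle between agents leaves
those alone. -/
theorem State.reassign {A : List ℕ} (hσ : State n m c s σ) (hA : SameExcept A σ σ')
    (h0 : 0 ∉ A) (h2 : 2 ∉ A) (h3 : 3 ∉ A) (h4 : 4 ∉ A) {i j : ℕ} (hi : i < n) (hj : j < n)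
    (hij : j ≠ i) (ho : ∀ e < m, σ'.nat 1 0 e = if σ.nat 1 0 e = j then i else σ.nat 1 0 e) :
    State n m c s σ' := by
  have e0 := hA.2 0 h0
  have e2 := hA.2 2 h2
  have e3 := hA.2 3 h3
  have e4 := hA.2 4 h4
  have en : bundles m σ' n = bundles m σ n := by
    rw [bundles, bundle_reassign hij ho, if_neg hi.ne', if_neg hj.ne']
  refine ⟨e0 ▸ hσ.agents, e0 ▸ hσ.items, ?_, e2 ▸ hσ.hits, ?_, e4 ▸ hσ.ptr, ?_⟩
  · intro e he
    rw [ho e he]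
    split_ifs
    · exact hi.le
    · exact hσ.owner_le e he
  · intro v hv
    rw [e3, hσ.count v hv, avail, avail, en]
  · intro v hv e he hoe
    rw [e4] at he
    have hem : e < m := he.trans_le (hσ.ptr v hv)
    rw [ho e hem] at hoe
    split_ifs at hoe
    · omega
    · exact hσ.passed v hv e he hoe

theorem unmarked_mark {i k : ℕ} (h : ∀ k, σ'.nat 6 k 0 = if k = i then 1 else σ.nat 6 k 0) :
    unmarked σ' k = (unmarked σ k).erase i := by
  ext j
  simp only [mem_unmarked, Finset.mem_erase, h]
  by_cases hji : j = i <;> simp [hji]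

/-- The invariant of the loop `split`. -/
structure SplitState (n m : ℕ) (c : ℕ → ℕ → ℝ) (s l : ℝ) (r : ℕ) (σ : Store) : Prop where
  state : State n m c s σ
  inv : SplitInv n m c s l r (fun j => σ.nat 6 j 0 = 0) (bundles m σ)
  lt : (bundles m σ n).card < (unmarked σ n).card
  size : ∀ j < n, σ.nat 6 j 0 = 0 → σ.nat 7 j 0 = (bundles m σ j).card
  costs : σ.real 0 = c
  large : σ.real 2 0 0 = l

/-- Array 6 now marks the complement of W. Both the number of free items and the number of unmarked
agents drop by one, so the latter stays larger. -/
theorem runs_splitStep (hI : Separated n m c s l) {r b x : ℕ} (hS : SplitState n m c s l r σ)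
    (hpos : 0 < (bundles m σ n).card)
    (hb : 200 * potential n m σ + 300 * (n + m) + x ≤ b) :
    Runs splitStep σ b fun σ' b' => SplitState n m c s l r σ' ∧
      (bundles m σ' n).card + 1 = (bundles m σ n).card ∧
      200 * potential n m σ' + x + 40 ≤ b' := by
  have hn := hI.four_le
  obtain ⟨hσ, hinv, hlt, hsize, hc, hl⟩ := hS
  refine Runs.seq (Runs.frame (runs_findFewest hσ.agents (Finset.card_pos.1 (by omega)))
    (by omega) ?_)
  rintro σ₂ ⟨g1, i, hi, h19, hWi, hmin⟩
  refine Runs.seq (Runs.frame (runs_computeCosts (n := n) (m := m) (σ := σ₂) (i := i)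
    (by rw [g1.2 0 (by simp), hσ.agents]) (by rw [g1.2 0 (by simp), hσ.items])
    (by rw [g1.2 1 (by simp)]; exact hσ.owner_le) h19) (by omega) ?_)
  rintro σ₃ ⟨g2, g3, g4⟩
  have hne : ∃ j < n, j ≠ i ∧ σ₃.nat 6 j 0 = 0 := by
    -- There are more unmarked agents than free items and at least one free item, so i has an
    -- unmarked rival.
    have h1 : 1 < (unmarked σ n).card := by omega
    obtain ⟨j, hj, hji⟩ := Finset.exists_mem_ne h1 i
    obtain ⟨h2, h3⟩ := mem_unmarked.1 hj
    exact ⟨j, h2, hji, by rw [g2 6 (by simp), g1.2 6 (by simp), h3]⟩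
  refine Runs.seq (Runs.frame (runs_findCheapest (n := n) (σ := σ₃) (i := i)
    (by rw [g2 0 (by simp), g1.2 0 (by simp), hσ.agents]) (by rw [g2 19 (by simp), h19]) hne)
    (by omega) ?_)
  rintro σ₄ ⟨g5, j, hj, h20, hji, hWj, hmin'⟩
  rw [g2 6 (by simp), g1.2 6 (by simp)] at hWj hmin'
  have nat4 : ∀ a, a ∉ [16, 19, 20] → σ₄.nat a = σ.nat a := by
    intro a ha
    simp only [List.mem_cons, List.not_mem_nil, or_false, not_or] at ha
    rw [g5.2 a (by simp; omega), g2 a (by omega), g1.2 a (by simp; omega)]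
  have real4 : ∀ a, a ≠ 3 → σ₄.real a = σ.real a := fun a ha => by rw [g5.1, g3 a ha, g1.1]
  have acc : ∀ k ≤ n, σ₃.real 3 k 0 = setCost c i (bundles m σ k) := fun k hk => by
    rw [g4 k hk, g1.1, hc, g1.2 1 (by simp)]
  have hcard : ∀ k < n, σ.nat 6 k 0 = 0 → (bundles m σ i).card ≤ (bundles m σ k).card :=
    fun k hk h6 => by
      rw [← hsize i hi hWi, ← hsize k hk h6]
      exact hmin k hk h6
  have hcost : ∀ k < n, k ≠ i → σ.nat 6 k 0 = 0 →
      setCost c i (bundles m σ j) ≤ setCost c i (bundles m σ k) := fun k hk hki h6 => by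
    rw [← acc j hj.le, ← acc k hk.le]
    exact hmin' k hk hki h6
  have hT : (Test.realLe (.cell 2 (.const 0) (.const 0))
      (.add (.cell 3 (scalar 20) (.const 0)) (.cell 3 (scalar 20) (.const 0)))).Holds σ₄ ↔
      l ≤ 2 * setCost c i (bundles m σ j) := by
    simp only [Test.Holds, RealExpr.eval, NatExpr.eval, h20, real4 2 (by simp), hl, g5.1,
      acc j hj.le, two_mul]
  have hσ₄ : State n m c s σ₄ := by
    have e0 := nat4 0 (by simp)
    have e1 := nat4 1 (by simp)
    have e2 := nat4 2 (by simp)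
    have e3 := nat4 3 (by simp)
    have e4 := nat4 4 (by simp)
    constructor <;> simp only [bundles, e0, e1, e2, e3, e4]
    exacts [hσ.agents, hσ.items, hσ.owner_le, hσ.hits, hσ.count, hσ.ptr, hσ.passed]
  have b4 : bundles m σ₄ = bundles m σ := by simp only [bundles, nat4 1 (by simp)]
  have p4 : potential n m σ₄ = potential n m σ := by
    simp only [potential, b4, nat4 4 (by simp)]
  -- Common end of both branches: p, which is i after no merging and j after merging, picks the item
  -- and leaves W.
  have finish : ∀ (σ₅ : Store) (p b₅ : ℕ), State n m c s σ₅ → p < n → σ₅.nat 10 0 0 = p →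
      bundles m σ₅ n = bundles m σ n → potential n m σ₅ = potential n m σ →
      σ₅.nat 6 = σ.nat 6 → σ₅.real 0 = c → σ₅.real 2 0 0 = l →
      (∀ k < n, k ≠ p → σ.nat 6 k 0 = 0 → σ₅.nat 7 k 0 = (bundles m σ₅ k).card) →
      σ.nat 6 p 0 = 0 → 200 * potential n m σ + x ≤ b₅ →
      (∀ f X', Give n p f (bundles m σ₅) X' →
        SplitInv n m c s l r (fun k => σ.nat 6 k 0 = 0 ∧ k ≠ p) X') →
      Runs (.seq pick (.setNat 6 (scalar 10) (.const 0) (.const 1))) σ₅ b₅ fun σ' b' =>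
        SplitState n m c s l r σ' ∧ (bundles m σ' n).card + 1 = (bundles m σ n).card ∧
        200 * potential n m σ' + x + 40 ≤ b' := by
    intro σ₅ p b₅ k1 hp k2 k3 k4 k5 k6 k7 k8 k9 k10 k11
    refine Runs.mono (runs_pick_mark (x := x) hn k1 hp k2 (by rw [avail_all, k3]; exact hpos)
      (by omega)) ?_
    rintro σ₆ b₆ ⟨q1, q2, q3, ⟨f, q4⟩, q5⟩
    have hcard6 : (bundles m σ₆ n).card + 1 = (bundles m σ n).card := by
      rw [q4.rest, k3]
      exact Finset.card_erase_add_one (k3 ▸ q4.free)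
    rw [k5] at q5
    refine ⟨⟨q2, (k11 f _ q4).congr fun k _ => ?_, ?_, ?_, ?_, ?_⟩, hcard6, by omega⟩
    · rw [q5]
      by_cases hkp : k = p <;> simp [hkp]
    · rw [unmarked_mark q5, Finset.card_erase_of_mem (mem_unmarked.2 ⟨hp, k9⟩)]
      omega
    · intro k hk h6
      rw [q5] at h6
      by_cases hkp : k = p
      · simp [hkp] at h6
      · rw [if_neg hkp] at h6
        rw [q1.2 7 (by simp), k8 k hk hkp h6, q4.other k hk hkp]
    · rw [q1.1, k6]
    · rw [q1.1, k7]
  refine Runs.seq (Runs.ite (by simp [NatExpr.cost, RealExpr.cost, Test.cost]; omega) ?_ ?_)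
  · intro hh
    have hh := hT.1 hh
    refine Runs.setNat (by simp [NatExpr.cost, RealExpr.cost, Test.cost]; omega) ?_
    simp only [NatExpr.eval, g5.2 19 (by simp), g2 19 (by simp), h19]
    have same : SameExcept [10] σ₄ (σ₄.writeNat 10 0 0 i) := SameExcept.refl.write (by simp)
    have b5 : bundles m (σ₄.writeNat 10 0 0 i) = bundles m σ := by
      rw [← b4]; simp [bundles]
    refine finish _ i _ (hσ₄.congr same) hi (by simp) (by rw [b5]) ?_ ?_ ?_ ?_ ?_ hWi ?_ ?_
    · rw [← p4]; simp only [potential, b5, b4, same.2 4 (by simp)]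
    · rw [same.2 6 (by simp), nat4 6 (by simp)]
    · rw [same.1, real4 0 (by simp), hc]
    · rw [same.1, real4 2 (by simp), hl]
    · intro k hk _ h6
      rw [b5, same.2 7 (by simp), nat4 7 (by simp), hsize k hk h6]
    · simp [NatExpr.cost, RealExpr.cost, Test.cost]; omega
    · intro f X' hG
      rw [b5] at hG
      refine hinv.take hI hWi (fun k hk h6 _ => hcard k hk h6) (fun k hk h6 hki => ?_) hG
      linarith [hcost k hk hki h6]
  · intro hh
    have hh := not_le.1 (mt hT.2 hh)
    have h19' : σ₄.nat 19 0 0 = i := by rw [g5.2 19 (by simp), g2 19 (by simp), h19]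
    refine Runs.frame (runs_takeOver hσ₄.items h19' h20)
      (by simp [NatExpr.cost, RealExpr.cost, Test.cost]; omega) ?_
    rintro σ₅ ⟨q1, q2, q3, q4, q5, q6⟩
    have hX : ∀ k, bundles m σ₅ k = if k = i then bundles m σ i ∪ bundles m σ j else
        if k = j then ∅ else bundles m σ k := fun k => by
      rw [← b4]; exact bundle_reassign hji q3
    have hXn : bundles m σ₅ n = bundles m σ n := by
      rw [hX, if_neg hi.ne', if_neg hj.ne']
    have hdisj : Disjoint (bundles m σ i) (bundles m σ j) :=
      Finset.disjoint_left.2 fun e h1 h2 =>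
        hji ((mem_bundle.1 h2).2.symm.trans (mem_bundle.1 h1).2)
    refine finish _ j _ (hσ₄.reassign q1 (by simp) (by simp) (by simp) (by simp) hi hj hji q3) hj
      q2 hXn ?_ ?_ ?_ ?_ ?_ hWj ?_ ?_
    · rw [← p4]; simp only [potential, hXn, b4, q1.2 4 (by simp)]
    · rw [q1.2 6 (by simp), nat4 6 (by simp)]
    · rw [q1.1, real4 0 (by simp), hc]
    · rw [q1.1, real4 2 (by simp), hl]
    · intro k hk hkj h6
      rw [hX]
      by_cases hki : k = i
      · rw [if_pos hki, hki, q5, nat4 7 (by simp), hsize i hi hWi, nat4 1 (by simp),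
          Finset.card_union_of_disjoint hdisj]
      · rw [if_neg hki, if_neg hkj, q6 k hki, nat4 7 (by simp), hsize k hk h6]
    · simp [NatExpr.cost, RealExpr.cost, Test.cost]; omega
    · intro f X' hG
      refine hinv.merge hI hi hWi hWj hji hdisj hcard (fun k hk h6 hki => hcost k hk hki h6) hh
        (by rw [hX, if_pos rfl]) (by rw [hX, if_neg hji, if_pos rfl]) ?_ hG
      intro k _ hki hkj
      rw [hX, if_neg hki, if_neg hkj]

theorem runs_split (hI : Separated n m c s l) {r b x : ℕ} (hS : SplitState n m c s l r σ)
    (hb : 200 * potential n m σ + 300 * (n + m) * (bundles m σ n).card + x + 20 ≤ b) :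
    Runs split σ b fun σ' b' => State n m c s σ' ∧ bundles m σ' n = ∅ ∧
      (∀ i < n, Tolerates n c l (bundles m σ') i 0) ∧ x ≤ b' := by
  refine Runs.while_loop (I := fun σ₁ b₁ => SplitState n m c s l r σ₁ ∧
    200 * potential n m σ₁ + 300 * (n + m) * (bundles m σ₁ n).card + x + 20 ≤ b₁) ?_ ?_ ⟨hS, hb⟩
  · rintro σ₁ b₁ ⟨h1, h2⟩ hT
    have hst := h1.state
    simp only [Test.Holds, NatExpr.eval, hst.agents, hst.count (n + 1) (by omega), avail_all] at hT
    refine ⟨by simp [NatExpr.cost, Test.cost]; omega, ?_⟩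
    obtain ⟨k, hk⟩ : ∃ k, (bundles m σ₁ n).card = k + 1 := ⟨_, (Nat.sub_add_cancel hT).symm⟩
    rw [hk, mul_add, mul_one] at h2
    refine Runs.mono (runs_splitStep (x := 300 * (n + m) * k + x) hI h1 hT
      (by simp [NatExpr.cost, Test.cost]; omega)) ?_
    rintro σ₂ b₂ ⟨g1, g2, g3⟩
    have : (bundles m σ₂ n).card = k := by omega
    exact ⟨g1, by rw [this]; omega⟩
  · rintro σ₁ b₁ ⟨h1, h2⟩ hT
    have hst := h1.state
    simp only [Test.Holds, NatExpr.eval, hst.agents, hst.count (n + 1) (by omega), avail_all] at hT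
    have h0 : (bundles m σ₁ n).card = 0 := by omega
    exact ⟨by simp [NatExpr.cost, Test.cost]; omega, hst, Finset.card_eq_zero.1 h0, h1.inv.efx,
      by simp [NatExpr.cost, Test.cost]; omega⟩

/-- All remaining items are given away. -/
def endPhase : Program :=
  .ite (.natLe (.const 1) numFree)
    (.seq inspect (.seq countPoor (.ite (.natLe (scalar 17) numFree) giveEach
      (.ite (.natLe (.succ (scalar 18)) numAgents) feed split)))) .skip

theorem runs_endPhase (hI : Separated n m c s l) (hσ : State n m c s σ) {r b x : ℕ}
    (hM : MainInv n m c s l r n (bundles m σ))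
    (hav : ∀ i < n, avail n c s (bundles m σ) i = 0)
    (hlt : avail n c s (bundles m σ) (n + 1) < n)
    (h6 : ∀ i, σ.nat 6 i 0 = 0) (h7 : ∀ i, σ.nat 7 i 0 = 0) (hc : σ.real 0 = c)
    (hl : σ.real 2 0 0 = l)
    (hb : 200 * potential n m σ + 300 * (n + m) * n + 200 * (n + m) + x + 200 ≤ b) :
    Runs endPhase σ b fun σ' b' => State n m c s σ' ∧ bundles m σ' n = ∅ ∧
      (∀ i < n, Tolerates n c l (bundles m σ') i 0) ∧ x ≤ b' := by
  have hn := hI.four_le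
  refine Runs.ite (by simp [NatExpr.cost, Test.cost]; omega) ?_ ?_
  · intro hT
    simp only [Test.Holds, NatExpr.eval, hσ.agents, hσ.count (n + 1) (by omega)] at hT
    have hR := hM.ready hI hav hT
    rw [avail_all] at hlt hT
    refine Runs.seq (Runs.frame (runs_inspect hσ h6 h7)
      (by simp [NatExpr.cost, Test.cost]; omega) ?_)
    rintro σ₁ ⟨g1, g2⟩
    have e0 : σ₁.nat 0 0 0 = n := by rw [g1.2 0 (by simp), hσ.agents]
    refine Runs.seq (Runs.frame (runs_countPoor e0)
      (by simp [NatExpr.cost, Test.cost]; omega) ?_)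
    rintro σ₂ ⟨g3, hw, k, hk, h18, hk1, hk2⟩
    have same : SameExcept [6, 7, 16, 17, 18] σ σ₂ :=
      (g1.mono (by simp)).trans (g3.mono (by simp))
    have hσ₂ := hσ.congr same
    have b2 : bundles m σ₂ = bundles m σ := by simp only [bundles, same.2 1 (by simp)]
    have p2 : potential n m σ₂ = potential n m σ := by
      simp only [potential, b2, same.2 4 (by simp)]
    have e6 : σ₂.nat 6 = σ₁.nat 6 := g3.2 6 (by simp)
    have e7 : σ₂.nat 7 = σ₁.nat 7 := g3.2 7 (by simp)
    have hu : unmarked σ₂ n = unmarked σ₁ n := by simp only [unmarked, e6]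
    rw [← hu] at hw
    have hpoor : ∀ i < n, σ₂.nat 6 i 0 = 0 ↔ Poor n c s (bundles m σ₂) i := fun i hi => by
      rw [e6, b2]; exact (g2 i hi).1
    have hmul : 300 * (n + m) * (bundles m σ n).card ≤ 300 * (n + m) * n :=
      Nat.mul_le_mul_left _ hlt.le
    rw [← b2] at hR hlt hmul
    refine Runs.ite (by simp [NatExpr.cost, Test.cost]; omega) ?_ ?_
    · intro hT2
      simp only [Test.Holds, NatExpr.eval, hσ₂.agents, hσ₂.count (n + 1) (by omega), avail_all,
        hw] at hT2
      exact runs_giveEach hI hσ₂ hR hpoor hT2 hlt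
        (by simp [NatExpr.cost, Test.cost, p2]; omega)
    · intro hT2
      simp only [Test.Holds, NatExpr.eval, hσ₂.agents, hσ₂.count (n + 1) (by omega), avail_all,
        hw] at hT2
      refine Runs.ite (by simp [NatExpr.cost, Test.cost]; omega) ?_ ?_
      · intro hT3
        simp only [Test.Holds, NatExpr.eval, hσ₂.agents, h18] at hT3
        obtain ⟨k1, k2⟩ := hk1 hT3
        rw [(g2 k hT3).2, ← b2] at k2
        -- Agent k is marked; as there are fewer free items than unmarked agents, at most n - 2
        -- items are free.
        have hun : (unmarked σ₂ n).card < n := by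
          have h1 : unmarked σ₂ n ⊂ Finset.range n := by
            refine Finset.ssubset_iff_subset_ne.2 ⟨Finset.filter_subset _ _, fun h => ?_⟩
            have : k ∈ unmarked σ₂ n := h ▸ Finset.mem_range.2 hT3
            exact k1 (e6 ▸ (mem_unmarked.1 this).2)
          simpa using Finset.card_lt_card h1
        refine runs_feed hI hσ₂ hT3 h18 (hR.feed hI hT3 ?_ k2 (by omega))
          (by simp [NatExpr.cost, Test.cost, p2]; omega)
        rw [← hpoor k hT3, e6]
        exact k1
      · intro hT3
        simp only [Test.Holds, NatExpr.eval, hσ₂.agents, h18] at hT3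
        have hkn : k = n := by omega
        refine runs_split hI (r := r) ⟨hσ₂, ?_, by omega, ?_, ?_, ?_⟩
          (by simp [NatExpr.cost, Test.cost, p2]; omega)
        · refine (hR.split hI fun i hi hp => ?_).congr fun i hi => (hpoor i hi).symm
          rw [b2, ← (g2 i hi).2]
          refine hk2 hkn i hi ?_
          rw [← hpoor i hi, e6] at hp
          exact hp
        · intro j hj _
          rw [e7, b2, (g2 j hj).2]
        · rw [same.1, hc]
        · rw [same.1, hl]
  · intro hT
    simp only [Test.Holds, NatExpr.eval, hσ.agents, hσ.count (n + 1) (by omega), avail_all] at hT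
    refine Runs.skip (by simp [NatExpr.cost, Test.cost]; omega) ⟨hσ,
      Finset.card_eq_zero.1 (by omega), hM.efx, by simp [NatExpr.cost, Test.cost]; omega⟩

end SplitRun

/-! ### Initialization -/

/-- The real scalars `1` and `2` become the least and the largest cost of an item. -/
def findExtremes : Program :=
  .seq (.setReal 1 (.const 0) (.const 0) (.cell 0 (.const 0) (.const 0)))
    (.seq (.setReal 2 (.const 0) (.const 0) (.cell 0 (.const 0) (.const 0)))
      (forLoop 21 numAgents (forLoop 22 numItems (.seq
        (.ite (.realLe (.cell 0 (scalar 21) (scalar 22)) (.cell 1 (.const 0) (.const 0)))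
          (.setReal 1 (.const 0) (.const 0) (.cell 0 (scalar 21) (scalar 22))) .skip)
        (.ite (.realLe (.cell 2 (.const 0) (.const 0)) (.cell 0 (scalar 21) (scalar 22)))
          (.setReal 2 (.const 0) (.const 0) (.cell 0 (scalar 21) (scalar 22))) .skip)))))

/-- Item `e` is given to agent `e % n`. -/
def dealOut : Program :=
  .seq (assign 23 (.const 0)) (forLoop 16 numItems
    (.seq (.setNat 1 (.const 0) (scalar 16) (scalar 23))
      (.seq (assign 23 (.succ (scalar 23)))
        (.ite (.natLe numAgents (scalar 23)) (assign 23 (.const 0)) .skip))))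

/-- All items become free, and array `2` is filled. -/
def fillTables : Program :=
  forLoop 16 numItems (.seq (.setNat 1 (.const 0) (scalar 16) numAgents)
    (.seq (.setNat 2 numAgents (scalar 16) (.const 1))
      (.seq (.setNat 2 (.succ numAgents) (scalar 16) (.const 1))
        (forLoop 21 numAgents
          (.ite (.realLe (.cell 0 (scalar 21) (scalar 16)) (.cell 1 (.const 0) (.const 0)))
            (.seq (.setNat 2 (scalar 21) (scalar 16) (.const 1))
              (.setNat 2 numAgents (scalar 16) (.const 0))) .skip)))))

/-- Array `3` is filled. -/
def countItems : Program :=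
  forLoop 21 (.succ (.succ numAgents)) (forLoop 16 numItems
    (.ite (.natLe (.const 1) (.cell 2 (scalar 21) (scalar 16)))
      (.setNat 3 (scalar 21) (.const 0) (.succ (.cell 3 (scalar 21) (.const 0)))) .skip))

/-- The complete program. -/
def efxProgram : Program :=
  .seq findExtremes
    (.ite (.and (.not (.natLe numItems numAgents))
        (.not (.realLe (.cell 2 (.const 0) (.const 0))
          (.add (.cell 1 (.const 0) (.const 0)) (.cell 1 (.const 0) (.const 0))))))
      (.seq fillTables (.seq countItems (.seq mainPhase endPhase))) dealOut)

/-! ### Extreme costs, cyclic dealing and the initial tables -/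

section Init

variable {n m : ℕ} {c : ℕ → ℕ → ℝ} {s l : ℝ} {σ : Store}

/-- `s` and `l` are the least and the largest cost. -/
def Extremes (n m : ℕ) (c : ℕ → ℕ → ℝ) (s l : ℝ) : Prop :=
  (∃ i < n, ∃ e < m, c i e = s) ∧ (∃ i < n, ∃ e < m, c i e = l) ∧
    ∀ i < n, ∀ e < m, s ≤ c i e ∧ c i e ≤ l

/-- The real scalars `1` and `2` are the extremes of the costs of the pairs satisfying `P`. -/
def ExtremesOn (n m : ℕ) (c : ℕ → ℕ → ℝ) (σ : Store) (P : ℕ → ℕ → Prop) (σ' : Store) : Prop :=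
  (∀ a, a ≠ 21 → a ≠ 22 → σ'.nat a = σ.nat a) ∧ σ'.real 0 = c ∧
    (∃ i < n, ∃ e < m, c i e = σ'.real 1 0 0) ∧ (∃ i < n, ∃ e < m, c i e = σ'.real 2 0 0) ∧
    ∀ i < n, ∀ e < m, P i e → σ'.real 1 0 0 ≤ c i e ∧ c i e ≤ σ'.real 2 0 0

theorem ExtremesOn.write {P Q : ℕ → ℕ → Prop} {σ' : Store} {a v : ℕ}
    (h : ExtremesOn n m c σ P σ') (hPQ : ∀ i < n, ∀ e < m, Q i e → P i e)
    (ha : a = 21 ∨ a = 22) : ExtremesOn n m c σ Q (σ'.writeNat a 0 0 v) := by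
  obtain ⟨g1, g2, g3, g4, g5⟩ := h
  refine ⟨fun a' h1 h2 => ?_, g2, g3, g4, fun i hi e he hq => g5 i hi e he (hPQ i hi e he hq)⟩
  rw [Store.nat_writeNat_of_ne (by omega)]
  exact g1 a' h1 h2

theorem runs_findExtremes (h0 : σ.nat 0 0 0 = n) (h1 : σ.nat 0 0 1 = m) (hn : 0 < n) (hm : 0 < m)
    (hc : σ.real 0 = c) :
    Runs findExtremes σ (n * (m * 76 + 29) + 40) fun σ' _ =>
      (∀ a, a ≠ 21 → a ≠ 22 → σ'.nat a = σ.nat a) ∧ σ'.real 0 = c ∧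
      Extremes n m c (σ'.real 1 0 0) (σ'.real 2 0 0) := by
  refine Runs.seq (Runs.setReal (by simp [NatExpr.cost, RealExpr.cost]) (Runs.seq
    (Runs.setReal (by simp [NatExpr.cost, RealExpr.cost]) ?_)))
  simp only [NatExpr.eval, RealExpr.eval, NatExpr.cost, RealExpr.cost]
  have hb : n * ((m * (60 + 16) + 13) + 16) = n * (m * 76 + 29) := by ring
  refine Runs.frame (C := n * ((m * (60 + 16) + 13) + 16) + 13) ?_ (by omega) (fun _ => id)
  refine Runs.for_loop_const (N := n) (C := m * (60 + 16) + 13)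
    (J := fun i σ₁ => ExtremesOn n m c σ (fun i' _ => i' < i) σ₁) ?_ ?_ ?_ ?_
  · refine ExtremesOn.write (P := fun _ _ => False) ⟨fun a _ _ => by simp, by simp [hc], ?_, ?_, ?_⟩
      (by simp) (Or.inl rfl)
    · exact ⟨0, hn, 0, hm, by simp [hc]⟩
    · exact ⟨0, hn, 0, hm, by simp [hc]⟩
    · simp
  · exact fun i σ₁ h => by simp only [NatExpr.eval, h.1 0 (by simp) (by simp), h0]
  · rintro i σ₁ hi h21 hJ
    refine Runs.for_loop_const (N := m) (C := 60)
      (J := fun e σ₂ => σ₂.nat 21 0 0 = i ∧ ExtremesOn n m c σ (fun i' e' => i' < i ∨ i' = i ∧ e' < e) σ₂)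
      ?_ ?_ ?_ ?_
    · exact ⟨by simp [h21], hJ.write (by simp) (Or.inr rfl)⟩
    · exact fun i σ₁ h => by simp only [NatExpr.eval, h.2.1 0 (by simp) (by simp), h1]
    · rintro e σ₂ he h22 ⟨h21, g1, g2, g3, g4, g5⟩
      have key : ∀ σ₃ : Store, ExtremesOn n m c σ (fun i' e' => i' < i ∨ i' = i ∧ e' ≤ e) σ₃ →
          σ₃.nat 21 0 0 = i → σ₃.nat 22 0 0 = e → σ₃.nat 22 0 0 = e ∧
            ((σ₃.writeNat 22 0 0 (e + 1)).nat 21 0 0 = i ∧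
            ExtremesOn n m c σ (fun i' e' => i' < i ∨ i' = i ∧ e' < e + 1) (σ₃.writeNat 22 0 0 (e + 1))) :=
        fun σ₃ k1 k2 k3 => ⟨k3, by simp [k2], k1.write (fun _ _ _ _ h => by omega) (Or.inr rfl)⟩
      have step : ∀ {lo hi' : ℝ}, lo ≤ σ₂.real 1 0 0 → lo ≤ c i e → σ₂.real 2 0 0 ≤ hi' →
          c i e ≤ hi' → ∀ i' < n, ∀ e' < m, (i' < i ∨ i' = i ∧ e' ≤ e) →
          lo ≤ c i' e' ∧ c i' e' ≤ hi' := by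
        intro lo hi' k1 k2 k3 k4 i' hi'' e' he' h
        by_cases hh : i' < i ∨ i' = i ∧ e' < e
        · have := g5 i' hi'' e' he' hh
          exact ⟨k1.trans this.1, this.2.trans k3⟩
        · have e1 : i' = i := by omega
          have e2 : e' = e := by omega
          rw [e1, e2]; exact ⟨k2, k4⟩
      refine Runs.seq (Runs.ite (by simp [NatExpr.cost, RealExpr.cost, Test.cost]) ?_ ?_)
      · intro hT
        simp only [Test.Holds, NatExpr.eval, RealExpr.eval, h21, h22, g2] at hT
        refine Runs.setReal (by simp [NatExpr.cost, RealExpr.cost, Test.cost]) ?_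
        simp only [NatExpr.eval, RealExpr.eval, h21, h22, g2]
        refine Runs.ite (by simp [NatExpr.cost, RealExpr.cost, Test.cost]) ?_ ?_
        · intro hT2
          simp [Test.Holds, NatExpr.eval, RealExpr.eval, h21, h22, g2] at hT2
          refine Runs.setReal (by simp [NatExpr.cost, RealExpr.cost, Test.cost])
            (key _ ⟨?_, ?_, ?_, ?_, ?_⟩ ?_ ?_)
          · simpa using g1
          · simpa using g2
          · exact ⟨i, hi, e, he, by simp⟩
          · exact ⟨i, hi, e, he, by simp [NatExpr.eval, RealExpr.eval, h21, h22, g2]⟩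
          · simp [NatExpr.eval, RealExpr.eval, h21, h22, g2]
            exact step hT le_rfl hT2 le_rfl
          · simp [h21]
          · simp [h22]
        · intro hT2
          simp [Test.Holds, NatExpr.eval, RealExpr.eval, h21, h22, g2] at hT2
          refine Runs.skip (by simp [NatExpr.cost, RealExpr.cost, Test.cost])
            (key _ ⟨?_, ?_, ?_, ?_, ?_⟩ ?_ ?_)
          · simpa using g1
          · simpa using g2
          · exact ⟨i, hi, e, he, by simp⟩
          · simpa using g4
          · simp
            exact step hT le_rfl le_rfl hT2.le
          · simp [h21]
          · simp [h22]
      · intro hT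
        simp only [Test.Holds, NatExpr.eval, RealExpr.eval, h21, h22, g2, not_le] at hT
        refine Runs.skip (by simp [NatExpr.cost, RealExpr.cost, Test.cost]) ?_
        refine Runs.ite (by simp [NatExpr.cost, RealExpr.cost, Test.cost]) ?_ ?_
        · intro hT2
          simp only [Test.Holds, NatExpr.eval, RealExpr.eval, h21, h22, g2] at hT2
          refine Runs.setReal (by simp [NatExpr.cost, RealExpr.cost, Test.cost])
            (key _ ⟨?_, ?_, ?_, ?_, ?_⟩ ?_ ?_)
          · simpa using g1
          · simpa using g2
          · simpa using g3
          · exact ⟨i, hi, e, he, by simp [NatExpr.eval, RealExpr.eval, h21, h22, g2]⟩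
          · simp [NatExpr.eval, RealExpr.eval, h21, h22, g2]
            exact step le_rfl hT.le hT2 le_rfl
          · simp [h21]
          · simp [h22]
        · intro hT2
          simp only [Test.Holds, NatExpr.eval, RealExpr.eval, h21, h22, g2, not_le] at hT2
          exact Runs.skip (by simp [NatExpr.cost, RealExpr.cost, Test.cost])
            (key _ ⟨g1, g2, g3, g4, step le_rfl hT.le le_rfl hT2.le⟩ h21 h22)
    · rintro σ₂ ⟨h21, hJ⟩
      refine ⟨h21, hJ.write (fun i' _ e' he' h => ?_) (Or.inl rfl)⟩
      omega
  · rintro σ₁ ⟨g1, g2, g3, g4, g5⟩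
    exact ⟨g1, g2, g3, g4, fun i hi e he => g5 i hi e he hi⟩

/-- Scalar 23 is a cyclic counter, since the machine has no division. -/
theorem runs_dealOut (hn : 1 < n) (h0 : σ.nat 0 0 0 = n) (h1 : σ.nat 0 0 1 = m) :
    Runs dealOut σ (m * 56 + 30) fun σ' _ => ∀ e < m, σ'.nat 1 0 e = e % n := by
  refine Runs.seq (Runs.setNat (by simp [NatExpr.cost]) ?_)
  simp only [NatExpr.eval, NatExpr.cost]
  refine Runs.frame (C := m * (40 + 16) + 13) ?_ (by omega) (fun _ => id)
  refine Runs.for_loop_const (N := m) (C := 40) (J := fun k σ₁ => σ₁.nat 0 = σ.nat 0 ∧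
    σ₁.nat 23 0 0 = k % n ∧ ∀ e < k, σ₁.nat 1 0 e = e % n) ?_ ?_ ?_ (fun _ h => h.2.2)
  · simp
  · exact fun i σ₁ h => by simp only [NatExpr.eval, h.1, h1]
  · rintro k σ₁ hk h16 ⟨g1, g2, g3⟩
    refine Runs.seq (Runs.setNat (by simp [NatExpr.cost]) (Runs.seq
      (Runs.setNat (by simp [NatExpr.cost]) ?_)))
    simp only [NatExpr.eval, h16, g2]
    have own : ∀ e < k + 1, (if e = k then k % n else σ₁.nat 1 0 e) = e % n := fun e he => by
      split_ifs with h
      · rw [h]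
      · exact g3 e (by omega)
    have hmod := Nat.add_mod_eq_ite (m := k) (n := 1) (k := n)
    rw [Nat.mod_eq_of_lt hn] at hmod
    have hkn := Nat.mod_lt k (by omega : 0 < n)
    refine Runs.ite (by simp [NatExpr.cost, Test.cost]) ?_ ?_
    · intro hT
      simp [Test.Holds, NatExpr.eval, g1, g2, h0] at hT
      refine Runs.setNat (by simp [NatExpr.cost, Test.cost]) ⟨by simp [h16], by simp [g1], ?_, ?_⟩
      · simp [NatExpr.eval]; rw [hmod, if_pos hT]; omega
      · simpa using own
    · intro hT
      simp [Test.Holds, NatExpr.eval, g1, g2, h0] at hT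
      refine Runs.skip (by simp [NatExpr.cost, Test.cost]) ⟨by simp [h16], by simp [g1], ?_, ?_⟩
      · simp [g2]; rw [hmod, if_neg (by omega)]
      · simpa using own

/-- Row n starts as 1 and is cleared as soon as some agent finds the item small. As s is the least
cost, the test c_i(e) ≤ s detects equality. -/
theorem runs_fillTables (h0 : σ.nat 0 0 0 = n) (h1 : σ.nat 0 0 1 = m) (hc : σ.real 0 = c)
    (hs : σ.real 1 0 0 = s) (hle : ∀ i < n, ∀ e < m, s ≤ c i e)
    (h2 : ∀ v e, σ.nat 2 v e = 0) :
    Runs fillTables σ (m * (n * 66 + 80) + 13) fun σ' _ => SameExcept [1, 2, 16, 21] σ σ' ∧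
      (∀ e < m, σ'.nat 1 0 e = n) ∧
      ∀ v < n + 2, ∀ e < m, 1 ≤ σ'.nat 2 v e ↔ Hits n c s v e := by
  refine Runs.mono (Runs.for_loop_const (N := m) (C := (n * (50 + 16) + 13) + 51)
    (J := fun k σ₁ => SameExcept [1, 2, 16, 21] σ σ₁ ∧ (∀ e < k, σ₁.nat 1 0 e = n) ∧
      (∀ v < n + 2, ∀ e < k, 1 ≤ σ₁.nat 2 v e ↔ Hits n c s v e) ∧
      ∀ v, ∀ e, k ≤ e → σ₁.nat 2 v e = 0) (P := _) ?_ ?_ ?_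
      (fun _ h => ⟨h.1, h.2.1, h.2.2.1⟩)) (fun _ _ => id) |>.frame ?_ (fun _ => id)
  · exact ⟨SameExcept.refl.write (by simp), by simp, by simp, by simp [h2]⟩
  · exact fun i σ₁ h => by simp only [NatExpr.eval, h.1.2 0 (by simp), h1]
  · rintro k σ₁ hk h16 ⟨g1, g2, g3, g4⟩
    refine Runs.seq (Runs.setNat (by simp [NatExpr.cost]) (Runs.seq
      (Runs.setNat (by simp [NatExpr.cost]) (Runs.seq
      (Runs.setNat (by simp [NatExpr.cost]) ?_)))))
    refine Runs.frame (C := n * (50 + 16) + 13) ?_ (by simp [NatExpr.cost]) (fun _ => id)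
    refine Runs.for_loop_const (N := n) (C := 50) (J := fun q σ₂ => SameExcept [1, 2, 16, 21] σ σ₂ ∧
      σ₂.nat 16 0 0 = k ∧ (∀ e < k + 1, σ₂.nat 1 0 e = n) ∧
      (∀ v < n + 2, ∀ e < k, 1 ≤ σ₂.nat 2 v e ↔ Hits n c s v e) ∧
      (∀ v, ∀ e, k + 1 ≤ e → σ₂.nat 2 v e = 0) ∧ (∀ v < q, 1 ≤ σ₂.nat 2 v k ↔ c v k = s) ∧
      (∀ v, q ≤ v → v < n → σ₂.nat 2 v k = 0) ∧ (1 ≤ σ₂.nat 2 n k ↔ ∀ i < q, c i k ≠ s) ∧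
      1 ≤ σ₂.nat 2 (n + 1) k) ?_ ?_ ?_ ?_
    · have hA := g1.2 0 (by simp)
      simp only [NatExpr.eval, h16, hA, h0]
      refine ⟨(((g1.write (by simp)).write (by simp)).write (by simp)).write (by simp),
        by simp [h16], ?_, ?_, ?_, by simp, ?_, ?_, ?_⟩
      · intro e he
        by_cases h : e = k
        · simp [h16, hA, h0, h]
        · simpa [h16, hA, h0, h] using g2 e (by omega)
      · intro v hv e he
        simpa [h16, hA, h0, he.ne] using g3 v hv e he
      · intro v e he
        simpa [h16, hA, h0, (show e ≠ k by omega)] using g4 v e (by omega)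
      · intro v _ hv
        simpa [h16, hA, h0, hv.ne, (show v ≠ n + 1 by omega)] using g4 v k le_rfl
      · simp [h16, hA, h0]
      · simp [h16, hA, h0]
    · exact fun i σ₂ h => by simp only [NatExpr.eval, h.1.2 0 (by simp), h0]
    · rintro q σ₂ hq h21 ⟨f1, f2, f3, f4, f5, f6, f7, f8, f9⟩
      have hA := f1.2 0 (by simp)
      have hc' : σ₂.real 0 = c := by rw [f1.1, hc]
      have hs' : σ₂.real 1 0 0 = s := by rw [f1.1, hs]
      refine Runs.ite (by simp [NatExpr.cost, RealExpr.cost, Test.cost]) ?_ ?_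
      · intro hT
        simp only [Test.Holds, NatExpr.eval, RealExpr.eval, h21, f2, hc', hs'] at hT
        have heq : c q k = s := le_antisymm hT (hle q hq k hk)
        refine Runs.seq (Runs.setNat (by simp [NatExpr.cost, RealExpr.cost, Test.cost])
          (Runs.setNat (by simp [NatExpr.cost, RealExpr.cost, Test.cost]) ?_))
        refine ⟨by simp [h21], ((f1.write (by simp)).write (by simp)).write (by simp),
          by simp [f2], by simpa using f3, ?_, ?_, ?_, ?_, ?_, ?_⟩
        · intro v hv e he
          simpa [NatExpr.eval, h21, f2, hA, h0, he.ne] using f4 v hv e he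
        · intro v e he
          simpa [NatExpr.eval, h21, f2, hA, h0, (show e ≠ k by omega)] using f5 v e he
        · intro v hv
          by_cases h : v = q
          · simp [NatExpr.eval, h21, f2, hA, h0, h, heq, hq.ne]
          · simpa [NatExpr.eval, h21, f2, hA, h0, h, (show v ≠ n by omega)]
              using f6 v (by omega)
        · intro v hv hv'
          simpa [NatExpr.eval, h21, f2, hA, h0, (show v ≠ q by omega), hv'.ne]
            using f7 v (by omega) hv'
        · simp [NatExpr.eval, hA, h0, h21, f2]
          exact ⟨q, by omega, heq⟩
        · simpa [NatExpr.eval, h21, f2, hA, h0, (show n + 1 ≠ q by omega)] using f9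
      · intro hT
        simp only [Test.Holds, NatExpr.eval, RealExpr.eval, h21, f2, hc', hs', not_le] at hT
        refine Runs.skip (by simp [NatExpr.cost, RealExpr.cost, Test.cost])
          ⟨h21, f1.write (by simp), by simp [f2], by simpa using f3, by simpa using f4,
            by simpa using f5, ?_, fun v hv hv' => by simpa using f7 v (by omega) hv', ?_,
            by simpa using f9⟩
        · intro v hv
          rw [Store.nat_writeNat_of_ne (by simp)]
          by_cases h : v = q
          · rw [h, f7 q le_rfl hq]
            simpa using hT.ne'
          · exact f6 v (by omega)
        · rw [Store.nat_writeNat_of_ne (by simp), f8]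
          refine ⟨fun h i hi => ?_, fun h i hi => h i (by omega)⟩
          by_cases h' : i = q
          · rw [h']; exact hT.ne'
          · exact h i (by omega)
    · rintro σ₂ ⟨f1, f2, f3, f4, f5, f6, f7, f8, f9⟩
      refine ⟨f2, f1.write (by simp), by simpa using f3, ?_, by simpa using f5⟩
      intro v hv e he
      rw [Store.nat_writeNat_of_ne (by simp)]
      by_cases h : e = k
      · subst h
        rcases (by omega : v < n ∨ v = n ∨ v = n + 1) with h | h | h
        · rw [hits_agent h]; exact f6 v h
        · rw [h, hits_none]; exact f8
        · rw [h]; exact iff_of_true f9 hits_all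
      · exact f4 v hv e (by omega)
  · simp only [NatExpr.cost]
    have : m * (n * (50 + 16) + 13 + 51 + (1 + 1 + 1 + 13)) = m * (n * 66 + 80) := by ring
    omega

theorem runs_countItems (h0 : σ.nat 0 0 0 = n) (h1 : σ.nat 0 0 1 = m)
    (h2 : ∀ v < n + 2, ∀ e < m, 1 ≤ σ.nat 2 v e ↔ Hits n c s v e)
    (h3 : ∀ v, σ.nat 3 v 0 = 0) (ho : ∀ e < m, σ.nat 1 0 e = n) :
    Runs countItems σ ((n + 2) * (m * 46 + 31) + 15) fun σ' _ => SameExcept [3, 16, 21] σ σ' ∧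
      ∀ v < n + 2, σ'.nat 3 v 0 = avail n c s (bundles m σ) v := by
  classical
  have hav : ∀ v < n + 2, avail n c s (bundles m σ) v =
      ((Finset.range m).filter fun e => 1 ≤ σ.nat 2 v e).card := by
    intro v hv
    refine congrArg Finset.card (Finset.ext fun e => ?_)
    simp only [Finset.mem_filter, mem_bundle, Finset.mem_range]
    exact ⟨fun h => ⟨h.1.1, (h2 v hv e h.1.1).2 h.2⟩,
      fun h => ⟨⟨h.1, ho e h.1⟩, (h2 v hv e h.1).1 h.2⟩⟩
  have hb : (n + 2) * ((m * (30 + 16) + 13) + 18) + 15 = (n + 2) * (m * 46 + 31) + 15 := by ring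
  refine Runs.frame (C := (n + 2) * ((m * (30 + 16) + 13) + 18) + 15) ?_ hb.le (fun _ => id)
  refine Runs.for_loop_const (N := n + 2) (C := m * (30 + 16) + 13)
    (J := fun v σ₁ => SameExcept [3, 16, 21] σ σ₁ ∧
      (∀ u < v, σ₁.nat 3 u 0 = avail n c s (bundles m σ) u) ∧
      ∀ u, v ≤ u → σ₁.nat 3 u 0 = 0) ?_ ?_ ?_ (fun _ h => ⟨h.1, h.2.1⟩)
  · exact ⟨SameExcept.refl.write (by simp), by simp, by simpa using h3⟩
  · exact fun i σ₁ h => by simp only [NatExpr.eval, h.1.2 0 (by simp), h0]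
  · rintro v σ₁ hv h21 ⟨g1, g2, g3⟩
    refine Runs.for_loop_const (N := m) (C := 30)
      (J := fun e σ₂ => SameExcept [3, 16, 21] σ σ₂ ∧ σ₂.nat 21 0 0 = v ∧
        (∀ u < v, σ₂.nat 3 u 0 = avail n c s (bundles m σ) u) ∧
        (∀ u, v + 1 ≤ u → σ₂.nat 3 u 0 = 0) ∧
        σ₂.nat 3 v 0 = ((Finset.range e).filter fun e => 1 ≤ σ.nat 2 v e).card) ?_ ?_ ?_ ?_
    · exact ⟨g1.write (by simp), by simp [h21], by simpa using g2,
        fun u hu => by simpa using g3 u (by omega), by simpa using g3 v le_rfl⟩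
    · exact fun i σ₁ h => by simp only [NatExpr.eval, h.1.2 0 (by simp), h1]
    · rintro e σ₂ he h16 ⟨f1, f2, f3, f4, f5⟩
      have hA := f1.2 2 (by simp)
      refine Runs.ite (by simp [NatExpr.cost, Test.cost]) ?_ ?_
      · intro hT
        simp only [Test.Holds, NatExpr.eval, f2, h16, hA] at hT
        refine Runs.setNat (by simp [NatExpr.cost, Test.cost]) ⟨by simp [h16],
          (f1.write (by simp)).write (by simp), by simp [f2], fun u hu => ?_, fun u hu => ?_, ?_⟩
        · simpa [NatExpr.eval, f2, hu.ne] using f3 u hu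
        · simpa [NatExpr.eval, f2, (show u ≠ v by omega)] using f4 u hu
        · rw [Finset.range_add_one, Finset.filter_insert, if_pos hT,
            Finset.card_insert_of_notMem (by simp)]
          simp [NatExpr.eval, f2, f5]
      · intro hT
        simp only [Test.Holds, NatExpr.eval, f2, h16, hA] at hT
        refine Runs.skip (by simp [NatExpr.cost, Test.cost]) ⟨h16, f1.write (by simp),
          by simp [f2], by simpa using f3, by simpa using f4, ?_⟩
        rw [Finset.range_add_one, Finset.filter_insert, if_neg hT]
        simpa using f5
    · rintro σ₂ ⟨f1, f2, f3, f4, f5⟩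
      refine ⟨f2, f1.write (by simp), fun u hu => ?_, by simpa using f4⟩
      rw [Store.nat_writeNat_of_ne (by simp)]
      by_cases h : u = v
      · rw [h, f5, hav v hv]
      · exact f3 u (by omega)

end Init

/-! ### Correctness and running time of the complete program -/

section Complete

variable {n m : ℕ} {c : ℕ → ℕ → ℝ} {s l : ℝ} {σ : Store}

/-- The extremes are attained and distinct, so they are a and b in some order. -/
theorem separated_of_bivalued {a b : ℝ} (hn : 4 ≤ n) (ha : 0 ≤ a) (hb : 0 ≤ b)
    (hab : ∀ i < n, ∀ e < m, c i e = a ∨ c i e = b) (hE : Extremes n m c s l) (hsl : s + s < l) :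
    Separated n m c s l := by
  obtain ⟨⟨i, hi, e, he, h1⟩, ⟨j, hj, f, hf, h2⟩, -⟩ := hE
  have hs : s = a ∨ s = b := h1 ▸ hab i hi e he
  have hl : l = a ∨ l = b := h2 ▸ hab j hj f hf
  have h0 : 0 ≤ s := by rcases hs with h | h <;> rw [h] <;> assumption
  refine ⟨hn, h0, by linarith, fun k hk g hg => ?_⟩
  have hne : s ≠ l := by intro h; linarith
  have := hab k hk g hg
  rcases hs with rfl | rfl <;> rcases hl with rfl | rfl
  · exact absurd rfl hne
  · exact this
  · exact this.symm
  · exact absurd rfl hne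

theorem card_bundle_of_mod {o : ℕ → ℕ} {i : ℕ} (hi : i < n) (ho : ∀ e < m, o e = e % n) :
    (bundle m o i).card = m / n + if i < m % n then 1 else 0 := by
  have h := Nat.count_modEq_card m (by omega : 0 < n) i
  rw [Nat.mod_eq_of_lt hi, Nat.count_eq_card_filter_range] at h
  rw [← h]
  refine congrArg Finset.card (Finset.filter_congr fun e he => ?_)
  rw [ho e (Finset.mem_range.1 he), Nat.ModEq, Nat.mod_eq_of_lt hi]

/-- Dealing out the items in turn suffices if there are few items or all costs are similar. -/
theorem efx_of_mod {o : ℕ → ℕ} (hn : 4 ≤ n) (hs : 0 ≤ s)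
    (hc : ∀ i < n, ∀ e < m, s ≤ c i e ∧ c i e ≤ l) (h : m ≤ n ∨ l ≤ s + s)
    (ho : ∀ e < m, o e = e % n) : EFX n c (bundle m o) := by
  intro i hi j hj _ e he
  have hn' : (4 : ℝ) ≤ n := by exact_mod_cast hn
  have hl : 0 ≤ l := by
    have := hc i hi e (mem_bundle.1 he).1
    linarith
  have hci := card_bundle_of_mod hi ho
  have hcj := card_bundle_of_mod hj ho
  have hpos := Finset.card_pos.2 ⟨e, he⟩
  have h1 : setCost c i (bundle m o i) - c i e ≤ ((bundle m o i).card - 1 : ℕ) * l := by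
    have h2 : setCost c i ((bundle m o i).erase e) + c i e = setCost c i (bundle m o i) :=
      Finset.sum_erase_add _ _ he
    rw [← h2, add_sub_cancel_right, ← Finset.card_erase_of_mem he, ← nsmul_eq_mul]
    exact Finset.sum_le_card_nsmul _ _ _ fun f hf =>
      (hc i hi f (mem_bundle.1 (Finset.mem_of_mem_erase hf)).1).2
  have h2 : (bundle m o j).card * s ≤ setCost c i (bundle m o j) := by
    rw [← nsmul_eq_mul]
    exact Finset.card_nsmul_le_sum _ _ _ fun f hf => (hc i hi f (mem_bundle.1 hf).1).1
  have h3 : 0 ≤ (bundle m o j).card * s := by positivity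
  refine h1.trans ?_
  -- With at most n items, every bundle has at most one. With l ≤ 2s, (|X_i| - 1) l ≤ |X_j| l ≤ 2
  -- |X_j| s.
  rcases h with h | h
  · have : (bundle m o i).card - 1 = 0 := by
      rcases h.lt_or_eq with h | rfl
      · rw [hci, Nat.div_eq_of_lt h]; split_ifs <;> rfl
      · rw [hci, Nat.div_self (by omega), Nat.mod_self]; rfl
    rw [this, Nat.cast_zero, zero_mul]
    exact mul_nonneg (by linarith) (h3.trans h2)
  · have h4 : (bundle m o i).card - 1 ≤ (bundle m o j).card := by
      have : (if i < m % n then 1 else 0) ≤ 1 := by split_ifs <;> simp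
      omega
    have h5 : (((bundle m o i).card - 1 : ℕ) : ℝ) ≤ (bundle m o j).card := by exact_mod_cast h4
    nlinarith [mul_le_mul_of_nonneg_right h5 hl,
      mul_le_mul_of_nonneg_left h (Nat.cast_nonneg (α := ℝ) (bundle m o j).card),
      mul_nonneg (by linarith : (0 : ℝ) ≤ (n : ℝ) - 3) h3, mul_le_mul_of_nonneg_left h2
        (by linarith : (0 : ℝ) ≤ (n : ℝ) - 1)]

theorem potential_le : potential n m σ ≤ n * m + (n + 2) * m := by
  refine Nat.add_le_add (Nat.mul_le_mul_left _ ?_) ?_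
  · exact (Finset.card_filter_le _ _).trans (Finset.card_range m).le
  · refine (Finset.sum_le_card_nsmul _ _ m fun v _ => Nat.sub_le _ _).trans ?_
    rw [Finset.card_range, smul_eq_mul]

/-- The part of the program run when there are many items and the costs differ much. -/
theorem runs_separated (hI : Separated n m c s l) (hE : ∀ i < n, ∀ e < m, s ≤ c i e)
    (hnm : n < m) (h0 : σ.nat 0 0 0 = n) (h1 : σ.nat 0 0 1 = m)
    (hz : ∀ a, 1 ≤ a → a ≤ 7 → σ.nat a = 0) (hc : σ.real 0 = c) (hs : σ.real 1 0 0 = s)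
    (hl : σ.real 2 0 0 = l) :
    Runs (.seq fillTables (.seq countItems (.seq mainPhase endPhase))) σ (2800 * (n * m))
      fun σ' _ => (∀ e < m, σ'.nat 1 0 e < n) ∧ EFX n c (bundles m σ') := by
  have hn := hI.four_le
  -- This absorbs the quadratic cost n (n + m) of the split loop into n m.
  have hnn : n * n ≤ n * m := Nat.mul_le_mul_left _ hnm.le
  have hm1 : m ≤ n * m := Nat.le_mul_of_pos_left m (by omega)
  refine Runs.seq (Runs.frame (runs_fillTables h0 h1 hc hs hE (by simp [hz])) (by nlinarith) ?_)
  rintro σ₁ ⟨hA1, ho1, hh1⟩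
  refine Runs.seq (Runs.frame (runs_countItems (n := n) (m := m) (c := c) (s := s)
    (by rw [hA1.2 0 (by simp), h0]) (by rw [hA1.2 0 (by simp), h1]) hh1
    (by simp [hA1.2 3 (by simp), hz]) ho1) ?_ ?_)
  · have : m * (n * 66 + 80) + 13 + ((n + 2) * (m * 46 + 31) + 15) ≤ 2800 * (n * m) := by nlinarith
    omega
  rintro σ₂ ⟨hA2, hcount⟩
  have hA := (hA1.mono (A' := [1, 2, 3, 16, 21]) (by simp)).trans
    (hA2.mono (A' := [1, 2, 3, 16, 21]) (by simp))
  have ho2 : ∀ e < m, σ₂.nat 1 0 e = n := by rw [hA2.2 1 (by simp)]; exact ho1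
  have hp : ∀ v, σ₂.nat 4 v 0 = 0 := by simp [hA.2 4 (by simp), hz]
  have hS : State n m c s σ₂ := by
    refine ⟨by rw [hA.2 0 (by simp), h0], by rw [hA.2 0 (by simp), h1], fun e he => (ho2 e he).le,
      ?_, ?_, by simp [hp], by simp [hp]⟩
    · rw [hA2.2 2 (by simp)]; exact hh1
    · rw [bundles, hA2.2 1 (by simp)]; exact hcount
  have hempty : ∀ i < n, bundles m σ₂ i = ∅ := by
    refine fun i hi => Finset.eq_empty_of_forall_notMem fun e he => ?_
    have h := mem_bundle.1 he
    have := ho2 e h.1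
    omega
  refine Runs.seq (Runs.mono (runs_mainPhase hI hS
    (x := 300 * (n + m) * n + 200 * (n + m) + 0 + 200) hempty hnm.le ?_) ?_)
  · have : m * (n * 66 + 80) + 13 + ((n + 2) * (m * 46 + 31) + 15) + (200 * (n * m + (n + 2) * m) +
      130 * n + (300 * (n + m) * n + 200 * (n + m) + 0 + 200) + 50) ≤ 2800 * (n * m) := by nlinarith
    rw [Nat.sub_sub]
    refine Nat.le_sub_of_add_le' (le_trans ?_ this)
    gcongr
    exact potential_le
  rintro σ₃ b₃ ⟨hA3, hS3, ⟨r, hM⟩, hav, hlt, hb⟩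
  refine Runs.mono (runs_endPhase hI hS3 (x := 0) hM hav hlt ?_ ?_ ?_ ?_ (by omega)) ?_
  · simp [hA3.2 6 (by simp), hA.2 6 (by simp), hz]
  · simp [hA3.2 7 (by simp), hA.2 7 (by simp), hz]
  · rw [hA3.1, hA.1, hc]
  · rw [hA3.1, hA.1, hl]
  rintro σ' _ ⟨hS', hfree, htol, -⟩
  refine ⟨fun e he => (hS'.owner_le e he).lt_of_ne fun h => ?_, efx_iff.2 htol⟩
  have : e ∈ bundles m σ' n := mem_bundle.2 ⟨he, h⟩
  simp [hfree] at this

theorem runs_efxProgram {a b : ℝ} (hn : 4 ≤ n) (hm : 1 ≤ m) (ha : 0 ≤ a) (hb : 0 ≤ b)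
    (hab : ∀ i < n, ∀ e < m, c i e = a ∨ c i e = b) (h0 : σ.nat 0 0 0 = n) (h1 : σ.nat 0 0 1 = m)
    (hz : ∀ a, 1 ≤ a → a ≤ 7 → σ.nat a = 0) (hc : σ.real 0 = c) :
    Runs efxProgram σ (3000 * (n * m))
      fun σ' _ => (∀ e < m, σ'.nat 1 0 e < n) ∧ EFX n c (bundles m σ') := by
  have hn1 : n ≤ n * m := Nat.le_mul_of_pos_right n hm
  have hm1 : m ≤ n * m := Nat.le_mul_of_pos_left m (by omega)
  have hB : n * (m * 76 + 29) + 40 + 22 + 2800 * (n * m) ≤ 3000 * (n * m) := by nlinarith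
  refine Runs.seq (Runs.frame (runs_findExtremes h0 h1 (by omega) (by omega) hc) (by omega) ?_)
  rintro σ₁ ⟨hA, hc1, hE⟩
  have h0' : σ₁.nat 0 0 0 = n := by rw [hA 0 (by simp) (by simp), h0]
  have h1' : σ₁.nat 0 0 1 = m := by rw [hA 0 (by simp) (by simp), h1]
  refine Runs.ite (by simp [NatExpr.cost, RealExpr.cost, Test.cost]; omega) ?_ ?_
  · intro hT
    simp only [Test.Holds, NatExpr.eval, RealExpr.eval, h0', h1', not_le] at hT
    refine Runs.frame (runs_separated (separated_of_bivalued hn ha hb hab hE hT.2)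
      (fun i hi e he => (hE.2.2 i hi e he).1) hT.1 h0' h1' (fun a h h' => ?_) hc1 rfl rfl) ?_
      (fun _ => id)
    · rw [hA a (by omega) (by omega), hz a h h']
    · simp [NatExpr.cost, RealExpr.cost, Test.cost]; omega
  · intro hT
    simp only [Test.Holds, NatExpr.eval, RealExpr.eval, h0', h1', not_and_or, not_not] at hT
    refine Runs.frame (runs_dealOut (by omega) h0' h1') ?_ fun σ' ho => ⟨fun e he => ?_, ?_⟩
    · simp [NatExpr.cost, RealExpr.cost, Test.cost]; omega
    · rw [ho e he]; exact Nat.mod_lt _ (by omega)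
    · refine efx_of_mod hn ?_ hE.2.2 hT ho
      obtain ⟨i, hi, e, he, h⟩ := hE.1
      rcases hab i hi e he with h' | h' <;> rw [← h, h'] <;> assumption

end Complete

/-! ### Translation to allocations indexed by `Fin` -/

section Output

variable {n m : ℕ}

theorem inputStore_real (c : Fin n → Fin m → ℝ) (i : Fin n) (e : Fin m) :
    (inputStore c).real 0 i e = c i e := by
  simp [inputStore]

/-- The bundle of agent `i` under the owner function `o`, as a set of indices. -/
def outputBundle (m : ℕ) (o : ℕ → ℕ) (i : ℕ) : Finset (Fin m) :=
  Finset.univ.filter fun e => o e = i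

theorem bundleCost_outputBundle (c : Fin n → Fin m → ℝ) (o : ℕ → ℕ) (i : Fin n) (j : ℕ) :
    bundleCost c i (outputBundle m o j) = setCost ((inputStore c).real 0) i (bundle m o j) := by
  rw [bundleCost, setCost, outputBundle, bundle, Finset.sum_filter, Finset.sum_filter,
    Finset.sum_range]
  simp [inputStore_real]

theorem isEFX_of_efx {c : Fin n → Fin m → ℝ} {o : ℕ → ℕ} (hn : 2 ≤ n) (h0 : ∀ i e, 0 ≤ c i e)
    (h : EFX n ((inputStore c).real 0) (bundle m o)) :
    IsEFX ((n : ℝ) - 1) c fun i => outputBundle m o i := by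
  intro i j e he
  have hn' : (2 : ℝ) ≤ n := by exact_mod_cast hn
  have hsum : bundleCost c i ((outputBundle m o i).erase e) + c i e =
    bundleCost c i (outputBundle m o i) := Finset.sum_erase_add _ _ he
  -- `IsEFX` also compares an agent with itself, which `EFX` leaves out; there n - 1 ≥ 1 and
  -- nonnegative costs suffice.
  by_cases hij : i = j
  · subst hij
    have hpos : 0 ≤ bundleCost c i (outputBundle m o i) := Finset.sum_nonneg fun f _ => h0 i f
    nlinarith [h0 i e]
  · have he' : (e : ℕ) ∈ bundle m o i :=
      mem_bundle.2 ⟨e.2, by simpa [outputBundle] using he⟩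
    have := h i i.2 j j.2 (fun h => hij (Fin.ext h)) e he'
    rw [← bundleCost_outputBundle, ← bundleCost_outputBundle, inputStore_real] at this
    linarith

theorem isAllocation_outputBundle {o : ℕ → ℕ} (h : ∀ e < m, o e < n) :
    IsAllocation fun i : Fin n => outputBundle m o i := by
  refine ⟨fun i j hij => Finset.disjoint_left.2 fun e hi hj => hij (Fin.ext ?_), fun e =>
    ⟨⟨o e, h e e.2⟩, by simp [outputBundle]⟩⟩
  simp only [outputBundle, Finset.mem_filter, Finset.mem_univ, true_and] at hi hj
  rw [← hi, hj]

end Output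

end ChoreDivision

theorem theorem4 :
    ∃ (p : ChoreDivision.Program) (C : ℕ),
      ∀ (n m : ℕ), 4 ≤ n → 1 ≤ m →
        ∀ c : Fin n → Fin m → ℝ, ChoreDivision.IsBivalued c →
          ∃ (t : ℕ) (s : ChoreDivision.Store) (X : Fin n → Finset (Fin m)),
            ChoreDivision.Exec p (ChoreDivision.inputStore c) t s ∧
            t ≤ C * (n * m) ∧
            ChoreDivision.Outputs s X ∧
            ChoreDivision.IsAllocation X ∧
            ChoreDivision.IsEFX ((n : ℝ) - 1) c X := by
  refine ⟨ChoreDivision.efxProgram, 3000, ?_⟩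
  rintro n m hn hm c ⟨a, b, ha, hb, hab⟩
  obtain ⟨t, s, b', hexec, hb', howner, hefx⟩ := ChoreDivision.runs_efxProgram (n := n) (m := m)
    (c := (ChoreDivision.inputStore c).real 0) (σ := ChoreDivision.inputStore c) hn hm ha hb
    (fun i hi e he => by
      rw [show (ChoreDivision.inputStore c).real 0 i e = c ⟨i, hi⟩ ⟨e, he⟩ from
        ChoreDivision.inputStore_real c ⟨i, hi⟩ ⟨e, he⟩]
      exact hab _ _)
    (by simp [ChoreDivision.inputStore]) (by simp [ChoreDivision.inputStore])
    (fun a h _ => by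
      funext i j
      have : a ≠ 0 := by omega
      simp [ChoreDivision.inputStore, this]) rfl
  refine ⟨t, s, fun i => ChoreDivision.outputBundle m (s.nat 1 0) i, hexec, by omega,
    fun i e => by simp [ChoreDivision.outputBundle], ChoreDivision.isAllocation_outputBundle howner,
    ChoreDivision.isEFX_of_efx (by omega) (fun i e => ?_) hefx⟩
  rcases hab i e with h | h <;> rw [h] <;> assumption
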